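/- **Setting.** Let $T>0$, $\varepsilon\ge 0$, $\Omega=(0,1)$, $f\in C^2(\mathbb R)$, $A\in C^2(\mathbb R)$ with $\inf_{\mathbb R}A=1$. Let $u\in L^\infty((0,T)\times\Omega)$ be an entropy solution of $$\partial_t u+\partial_x f(u)=\varepsilon\,\partial_x\big(A(u)\partial_x u\big)$$ for the pair $\eta(u)=\tfrac12u^2$, $q(u)=\int_0^u vf'(v)\,dv$, with initial datum $u(0)$. That is, $u$ satisfies the weak formulation and the weak entropy inequality, tested with $C_0^\infty([0,T)\times\Omega)$ functions (in the periodic case, with smooth functions that are 1-periodic in $x$ and vanish for $t$ near $T$). Either Dirichlet conditions $u(t,0)=g_0(t)$, $u(t,1)=g_1(t)$ with $g_0,g_1$ Lipschitz on $[0,T]$ are imposed, or periodic ones. If $\varepsilon=0$ the conditions are periodic; if $\varepsilon>0$ then $u\in L^2(0,T;H^1(\Omega))$. The representative of $u$ that is weakly continuous in time with values in $L^2(\Omega)$ is used, so $u(t)$ is defined for every $t\in[0,T]$. **Scheme.** Let $0=x_0<\dots<x_M=1$ and $0=t_0<\dots<t_N=T$, $I_j=(x_j,x_{j+1})$, $h=\max_j|I_j|$,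 and let $\mathbb V_p$ be the space of functions that are polynomials of degree at most $p$ on each $I_j$ ($\mathbb V_{-1}=\{0\}$). In the periodic case $x_M$ is identified with $x_0$; in the Dirichlet case $g_0(t),g_1(t)$ serve as exterior traces of elements of $\mathbb V_q$ at $x_0,x_M$. Write $[\![\psi]\!]_k=\psi(x_k^-)-\psi(x_k^+)$. The numerical flux is either $F(a,b)=f(w(a,b))$ or $F(a,b)=f(w(a,b))-\mu(a,b;h)h^\nu(b-a)$ with $\nu\in\mathbb N_0$, where $w:\mathbb R^2\to\mathbb R$ is locally Lipschitz and, for each compact $K$, $|w(a,b)-a|+|w(a,b)-b|\le C_w(K)|b-a|$ and $|\mu(a,b;h)|\le\mu_K(1+|a-b|/h)$ for $a,b\in K$ (the latter for small $h$). The operator $\mathfrak f_h:\mathbb V_q\to\mathbb V_q$ is defined by $$\int_\Omega\mathfrak f_h(\phi)\psi\,dx=-\int_\Omega f(\phi)\partial_x\psi\,dx+\sum_kF(\phi(x_k^-),\phi(x_k^+))[\![\psi]\!]_k\qquad\forall\psi\in\mathbb V_q$$ (in the Dirichlet case the sum is over $k=0,\dots,M$ and the test function $\psi$ is continued by zero),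 and $\mathfrak A_h:\mathbb V_q\to\mathbb V_q$ is any continuous map (which may depend continuously on time, to allow for boundary data). Let $u_h^0,\dots,u_h^N\in\mathbb V_q$ be arbitrary, for instance the output of an (IMEX) Runge–Kutta method of order at most 3 applied to $\partial_tu_h+\mathfrak f_h(u_h)=\varepsilon\mathfrak A_h(u_h)$. **Reconstructions.** $\widehat u_h^t:[0,T]\to\mathbb V_q$ is a cubic polynomial in time on each $[t_n,t_{n+1}]$ with $\widehat u_h^t(t_j)=u_h^j$ and one-sided derivatives $\partial_t\widehat u_h^t(t_j)=-\mathfrak f_h(u_h^j)+\varepsilon\mathfrak A_h(u_h^j)$ for $j=n,n+1$. For each $t\in[0,T]$, $\widehat u^{ts}(t)\in\mathbb V_{q+1}$ satisfies $\int_\Omega(\widehat u^{ts}-\widehat u_h^t)\psi\,dx=0$ for all $\psi\in\mathbb V_{q-1}$ and $\widehat u^{ts}(t,x_k^\pm)=w(\widehat u_h^t(t,x_k^-),\widehat u_h^t(t,x_k^+))$ at all nodes, except that in the Dirichlet case $\widehat u^{ts}(t,0)=g_0(t)$ and $\widehat u^{ts}(t,1)=g_1(t)$. The residuals are $$r_1=\partial_t\widehat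 u^{ts}+\partial_xf(\widehat u^{ts})-\varepsilon\mathfrak A_h(\widehat u_h^t),\qquad r_2=\mathfrak A_h(\widehat u_h^t)-\partial_x\big(A(\widehat u^{ts})\partial_x\widehat u^{ts}\big).$$ **Norms.** $\|r\|_{H^{-1}}=\sup\{|\langle r,\varphi\rangle|:\|\partial_x\varphi\|_{L^2(\Omega)}\le1\}\in[0,\infty]$ with $\varphi\in H^1_0(\Omega)$ (Dirichlet) or $\varphi\in H^1$ periodic, and $$|||v|||^2_{L^2(0,t)}=\int_0^t\Big(\sum_{j=0}^{M-1}\|\partial_xv(s)\|_{L^2(I_j)}^2+\sum_kh_k^{-1}|[\![v(s)]\!]_k|^2\Big)ds,$$ where $h_k$ is the mean length of the two elements at $x_k$ and the jumps are summed over $k=0,\dots,M-1$ in the periodic case. In the Dirichlet case the sum is over $k=0,\dots,M$, $v$ is continued by zero outside $\Omega$, and $h_0=|I_0|$, $h_M=|I_{M-1}|$. **Claim.** Let $[a,b]$ be a bounded interval that contains the values of $\widehat u^{ts}$ on $[0,T]\times\Omega$, those of $u(0)$ a.e. in $\Omega$ and, if $\varepsilon=0$, those of $u$ a.e. in $(0,T)\times\Omega$.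 Put $$K=\Big(\varepsilon\|\partial_x\widehat u^{ts}\|_{L^\infty((0,T)\times\Omega)}\sup_{[a,b]}|A'|^2+\sup_{[a,b]}|f''|\Big)\|\partial_x\widehat u^{ts}\|_{L^\infty((0,T)\times\Omega)}.$$ Then for every $i=0,\dots,N$ $$\begin{aligned}&\|u(t_i)-u_h^i\|_{L^2(\Omega)}^2+\varepsilon\,|||u-\widehat u_h^t|||^2_{L^2(0,t_i)}\\&\le2\Big(4\|u(0)-\widehat u^{ts}(0)\|_{L^2(\Omega)}^2+16\|r_1\|_{L^1(0,t_i;L^2(\Omega))}^2+8\varepsilon\|r_2\|_{L^2(0,t_i;H^{-1}(\Omega))}^2\Big)e^{8Kt_i}\\&\quad+2\Big(\|\widehat u^{ts}(t_i)-u_h^i\|_{L^2(\Omega)}^2+\varepsilon\,|||\widehat u^{ts}-\widehat u_h^t|||^2_{L^2(0,t_i)}\Big),\end{aligned}$$ with the convention that all terms with the factor $\varepsilon$ are zero if $\varepsilon=0$. -/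

import Mathlib

open MeasureTheory Set Filter Topology
open scoped ENNReal NNReal ContDiff

noncomputable section

namespace RKdG

/-! ### Domains, meshes, piecewise polynomials -/

/-- Lebesgue measure on the spatial domain `Ω = (0,1)`. -/
abbrev spaceMeasure : Measure ℝ := volume.restrict (Ioo 0 1)

/-- Lebesgue measure on the space-time cylinder `(0,T) × Ω`; points are pairs `(t, x)`. -/
abbrev cylinderMeasure (T : ℝ) : Measure (ℝ × ℝ) := volume.restrict (Ioo 0 T ×ˢ Ioo 0 1)

/-- A partition `a = z 0 < z 1 < ... < z n = b`. -/
structure Partition (n : ℕ) (a b : ℝ) where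
  z : Fin (n + 1) → ℝ
  strictMono : StrictMono z
  first : z 0 = a
  final : z (Fin.last n) = b

/-- Broken polynomials of degree `< n` on a mesh with `M` elements: `v j k` is the coefficient of
`x ^ k` on the `j`-th element.  So `𝕍_q^s` is `Broken M (q + 1)`, and `𝕍_{q-1}^s` is `Broken M q`
(which is `0` for `q = 0`). -/
abbrev Broken (M n : ℕ) : Type := Fin M → Fin n → ℝ

/-- The polynomial with the coefficients `c`, as a function. -/
def polyEval {n : ℕ} (c : Fin n → ℝ) (x : ℝ) : ℝ := ∑ k, c k * x ^ (k : ℕ)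

/-- The derivative of the polynomial with the coefficients `c`, as a function. -/
def polyDeriv {n : ℕ} (c : Fin n → ℝ) (x : ℝ) : ℝ :=
  ∑ k, c k * ((k : ℕ) : ℝ) * x ^ ((k : ℕ) - 1)

namespace Partition

variable {M n : ℕ}

/-- The length of the `j`-th element. -/
def size (X : Partition M 0 1) (j : Fin M) : ℝ := X.z j.succ - X.z j.castSucc

/-- The maximal mesh size. -/
def meshSize (X : Partition M 0 1) : ℝ := ⨆ j, X.size j

/-- The function on `[0,1)` that a broken polynomial represents. -/
def eval (X : Partition M 0 1) (v : Broken M n) (x : ℝ) : ℝ :=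
  ∑ j, (Ico (X.z j.castSucc) (X.z j.succ)).indicator (polyEval (v j)) x

/-- The elementwise derivative of a broken polynomial. -/
def evalDeriv (X : Partition M 0 1) (v : Broken M n) (x : ℝ) : ℝ :=
  ∑ j, (Ico (X.z j.castSucc) (X.z j.succ)).indicator (polyDeriv (v j)) x

/-- One-sided limit of `v` at the left end of the `j`-th element, from inside the element. -/
def leftVal (X : Partition M 0 1) (v : Broken M n) (j : Fin M) : ℝ :=
  polyEval (v j) (X.z j.castSucc)

/-- One-sided limit of `v` at the right end of the `j`-th element, from inside the element. -/
def rightVal (X : Partition M 0 1) (v : Broken M n) (j : Fin M) : ℝ :=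
  polyEval (v j) (X.z j.succ)

end Partition

/-! ### Boundary conditions -/

/-- Periodic boundary conditions, or Dirichlet conditions with the data `gL t` at `x = 0` and
`gR t` at `x = 1`. -/
inductive BoundaryCondition : Type
  | periodic : BoundaryCondition
  | dirichlet (gL gR : ℝ → ℝ) : BoundaryCondition

namespace BoundaryCondition

/-- Dirichlet data are Lipschitz continuous in time. -/
def LipschitzData (T : ℝ) : BoundaryCondition → Prop
  | periodic => True
  | dirichlet gL gR =>
      (∃ C : ℝ≥0, LipschitzOnWith C gL (Icc 0 T)) ∧ ∃ C : ℝ≥0, LipschitzOnWith C gR (Icc 0 T)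

/-- A function of `x ∈ [0,1]` satisfies the boundary condition at time `t`. -/
def Holds (t : ℝ) (v : ℝ → ℝ) : BoundaryCondition → Prop
  | periodic => v 0 = v 1
  | dirichlet gL gR => v 0 = gL t ∧ v 1 = gR t

/-- A function of `x ∈ [0,1]` satisfies the homogeneous boundary condition: it is periodic, or it
vanishes at both ends. -/
def Homogeneous (v : ℝ → ℝ) : BoundaryCondition → Prop
  | periodic => v 0 = v 1
  | dirichlet _ _ => v 0 = 0 ∧ v 1 = 0

/-- Smooth test functions: `C^∞` and periodic in `x`, vanishing for `t` near `T` and beyond, in the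
periodic case; `C_0^∞([0,T) × Ω)` in the Dirichlet case. -/
def IsTest (T : ℝ) (φ : ℝ → ℝ → ℝ) (bc : BoundaryCondition) : Prop :=
  ContDiff ℝ ∞ (fun p : ℝ × ℝ => φ p.1 p.2) ∧
  match bc with
  | periodic => (∀ t x, φ t (x + 1) = φ t x) ∧ ∃ T' < T, ∀ t, T' ≤ t → ∀ x, φ t x = 0
  | dirichlet _ _ =>
      HasCompactSupport (fun p : ℝ × ℝ => φ p.1 p.2) ∧
      tsupport (fun p : ℝ × ℝ => φ p.1 p.2) ⊆ Iio T ×ˢ Ioo 0 1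

variable {M n : ℕ} [NeZero M]

/-- The state to the left of `x = 0`: the value `v(1^-)` in the periodic case, the boundary datum in
the Dirichlet case.  The last element has the index `Fin.rev 0`. -/
def exteriorLeft (X : Partition M 0 1) (t : ℝ) (v : Broken M n) : BoundaryCondition → ℝ
  | periodic => X.rightVal v (Fin.rev 0)
  | dirichlet gL _ => gL t

/-- The state to the right of `x = 1`. -/
def exteriorRight (X : Partition M 0 1) (t : ℝ) (v : Broken M n) : BoundaryCondition → ℝ
  | periodic => X.leftVal v 0
  | dirichlet _ gR => gR t

/-- The traces `v(x_k^-)` at all nodes `x_0, ..., x_M`. -/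
def traceMinus (bc : BoundaryCondition) (X : Partition M 0 1) (t : ℝ) (v : Broken M n) :
    Fin (M + 1) → ℝ :=
  Fin.cons (bc.exteriorLeft X t v) (X.rightVal v)

/-- The traces `v(x_k^+)` at all nodes `x_0, ..., x_M`. -/
def tracePlus (bc : BoundaryCondition) (X : Partition M 0 1) (t : ℝ) (v : Broken M n) :
    Fin (M + 1) → ℝ :=
  Fin.snoc (X.leftVal v) (bc.exteriorRight X t v)

end BoundaryCondition

/-! ### The scheme and the reconstructions -/

/-- Admissible numerical fluxes `F(a, b)`, which may depend on the mesh size `h`. -/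
def IsAdmissibleFlux (f : ℝ → ℝ) (w : ℝ → ℝ → ℝ) (F : ℝ → ℝ → ℝ → ℝ) : Prop :=
  LocallyLipschitz (fun p : ℝ × ℝ => w p.1 p.2) ∧
  (∀ K : Set ℝ, IsCompact K → ∃ C > 0, ∀ a ∈ K, ∀ b ∈ K,
    |w a b - a| + |w a b - b| ≤ C * |b - a|) ∧
  ((∀ h > 0, ∀ a b, F h a b = f (w a b)) ∨
    ∃ (ν : ℕ) (μ : ℝ → ℝ → ℝ → ℝ),
      (∀ h > 0, ∀ a b, F h a b = f (w a b) - μ a b h * h ^ ν * (b - a)) ∧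
      ∀ K : Set ℝ, IsCompact K → ∃ μK > 0, ∃ h₀ > 0, ∀ h ∈ Ioo 0 h₀, ∀ a ∈ K, ∀ b ∈ K,
        |μ a b h| ≤ μK * (1 + |a - b| / h))

section Scheme

variable {M q : ℕ} [NeZero M]

/-- `g = 𝔣_h(φ)`, the discrete convection operator at time `t`.  The last sum is the sum over the
nodes of the numerical flux times the jump of `ψ`, sorted by elements. -/
def IsDiscreteConvection (bc : BoundaryCondition) (X : Partition M 0 1) (f : ℝ → ℝ)
    (F : ℝ → ℝ → ℝ → ℝ) (t : ℝ) (φ g : Broken M (q + 1)) : Prop :=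
  let flux : Fin (M + 1) → ℝ := fun k =>
    F X.meshSize (bc.traceMinus X t φ k) (bc.tracePlus X t φ k)
  ∀ ψ : Broken M (q + 1),
    (∫ x in Ioo (0 : ℝ) 1, X.eval g x * X.eval ψ x) =
      -(∫ x in Ioo (0 : ℝ) 1, f (X.eval φ x) * X.evalDeriv ψ x)
        + ∑ j : Fin M, (flux j.succ * X.rightVal ψ j - flux j.castSucc * X.leftVal ψ j)

/-- `ut` is the temporal reconstruction of the discrete solutions `uh 0, ..., uh N`: on every time
step a cubic polynomial with values in the dG space, that matches the discrete solution and the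
right hand side `-𝔣_h + ε 𝔄_h` of the semi-discrete scheme at both ends. -/
def IsTemporalReconstruction {N : ℕ} {T : ℝ} (bc : BoundaryCondition) (X : Partition M 0 1)
    (τ : Partition N 0 T) (f : ℝ → ℝ) (F : ℝ → ℝ → ℝ → ℝ) (ε : ℝ)
    (Ah : ℝ → Broken M (q + 1) → Broken M (q + 1))
    (uh : Fin (N + 1) → Broken M (q + 1)) (ut : ℝ → Broken M (q + 1)) : Prop :=
  ∀ n : Fin N,
    (∃ c : Fin 4 → Broken M (q + 1), ∀ t ∈ Icc (τ.z n.castSucc) (τ.z n.succ),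
      ut t = ∑ k : Fin 4, (t ^ (k : ℕ)) • c k) ∧
    ∀ j : Fin (N + 1), j = n.castSucc ∨ j = n.succ →
      ut (τ.z j) = uh j ∧
      ∃ g : Broken M (q + 1), IsDiscreteConvection bc X f F (τ.z j) (uh j) g ∧
        HasDerivWithinAt ut (-g + ε • Ah (τ.z j) (uh j))
          (Icc (τ.z n.castSucc) (τ.z n.succ)) (τ.z j)

/-- The prescribed value of the spatial reconstruction at the node `x_k`: the value
`w(v(x_k^-), v(x_k^+))`, except that Dirichlet data are imposed at the end points. -/
def nodeValue (bc : BoundaryCondition) (X : Partition M 0 1) (w : ℝ → ℝ → ℝ) (t : ℝ)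
    (v : Broken M (q + 1)) (k : Fin (M + 1)) : ℝ :=
  match bc with
  | .periodic =>
      w (BoundaryCondition.periodic.traceMinus X t v k)
        (BoundaryCondition.periodic.tracePlus X t v k)
  | .dirichlet gL gR =>
      if k = 0 then gL t else if k = Fin.last M then gR t else
      w ((BoundaryCondition.dirichlet gL gR).traceMinus X t v k)
        ((BoundaryCondition.dirichlet gL gR).tracePlus X t v k)

/-- `uts` is the space-time reconstruction obtained from `ut`. -/
def IsSpaceTimeReconstruction (bc : BoundaryCondition) (X : Partition M 0 1) (T : ℝ)
    (w : ℝ → ℝ → ℝ) (ut : ℝ → Broken M (q + 1)) (uts : ℝ → Broken M (q + 2)) : Prop :=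
  ∀ t ∈ Icc 0 T,
    (∀ ψ : Broken M q,
      ∫ x in Ioo (0 : ℝ) 1, (X.eval (uts t) x - X.eval (ut t) x) * X.eval ψ x = 0) ∧
    ∀ j : Fin M,
      X.leftVal (uts t) j = nodeValue bc X w t (ut t) j.castSucc ∧
      X.rightVal (uts t) j = nodeValue bc X w t (ut t) j.succ

end Scheme

/-! ### Entropy solutions -/

/-- `u ∈ L²(0,T; H¹(Ω))` with weak derivative `ux`, for almost all `t` given by its absolutely
continuous representative on `[0,1]`, which satisfies the boundary condition. -/
def IsL2H1 (bc : BoundaryCondition) (T : ℝ) (u ux : ℝ → ℝ → ℝ) : Prop :=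
  MemLp (fun p : ℝ × ℝ => u p.1 p.2) 2 (cylinderMeasure T) ∧
  MemLp (fun p : ℝ × ℝ => ux p.1 p.2) 2 (cylinderMeasure T) ∧
  ∀ᵐ t ∂(volume.restrict (Ioo 0 T)),
    (∀ x ∈ Icc (0 : ℝ) 1, u t x = u t 0 + ∫ y in (0 : ℝ)..x, ux t y) ∧ bc.Holds t (u t)

/-- `u ∈ C_w([0,T]; L²(Ω))`. -/
def IsWeaklyContinuous (T : ℝ) (u : ℝ → ℝ → ℝ) : Prop :=
  (∀ t ∈ Icc 0 T, MemLp (u t) 2 spaceMeasure) ∧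
  ∀ φ : ℝ → ℝ, MemLp φ 2 spaceMeasure →
    ContinuousOn (fun t => ∫ x in Ioo (0 : ℝ) 1, u t x * φ x) (Icc 0 T)

/-- `u` is a weak solution of `∂_t u + ∂_x f(u) = ε ∂_x (A(u) ∂_x u)` with initial datum `u₀`, where
`ux` stands for `∂_x u` and is immaterial if `ε = 0`. -/
def IsWeakSolution (bc : BoundaryCondition) (T ε : ℝ) (f A : ℝ → ℝ) (u₀ : ℝ → ℝ)
    (u ux : ℝ → ℝ → ℝ) : Prop :=
  ∀ φ : ℝ → ℝ → ℝ, bc.IsTest T φ →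
    (∫ p in Ioo 0 T ×ˢ Ioo (0 : ℝ) 1,
        (deriv (fun s => φ s p.2) p.1 * u p.1 p.2
          + deriv (φ p.1) p.2 * (f (u p.1 p.2) - ε * (A (u p.1 p.2) * ux p.1 p.2))))
      + ∫ x in Ioo (0 : ℝ) 1, u₀ x * φ 0 x = 0

/-- The entropy flux `q` that belongs to the entropy `η(u) = u² / 2`. -/
def entropyFlux (f : ℝ → ℝ) (u : ℝ) : ℝ := ∫ v in (0 : ℝ)..u, v * deriv f v

/-- The weak entropy inequality for the entropy `η(u) = u² / 2`. -/
def SatisfiesEntropyInequality (bc : BoundaryCondition) (T ε : ℝ) (f A : ℝ → ℝ) (u₀ : ℝ → ℝ)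
    (u ux : ℝ → ℝ → ℝ) : Prop :=
  ∀ Φ : ℝ → ℝ → ℝ, bc.IsTest T Φ → (∀ t x, 0 ≤ Φ t x) →
    0 ≤ (∫ p in Ioo 0 T ×ˢ Ioo (0 : ℝ) 1,
        (deriv (fun s => Φ s p.2) p.1 * (u p.1 p.2 ^ 2 / 2)
          + deriv (Φ p.1) p.2 * (entropyFlux f (u p.1 p.2)
              - ε * (u p.1 p.2 * A (u p.1 p.2) * ux p.1 p.2))
          - ε * (Φ p.1 p.2 * (ux p.1 p.2 * A (u p.1 p.2) * ux p.1 p.2))))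
      + ∫ x in Ioo (0 : ℝ) 1, Φ 0 x * (u₀ x ^ 2 / 2)

/-- Bounded entropy solutions with initial datum `u 0`, with `u ∈ L²(0,T; H¹(Ω))` if `ε > 0`, in
the representative that is weakly continuous in time, so that `u(t)` has a meaning for every `t`. -/
structure IsEntropySolution (bc : BoundaryCondition) (T ε : ℝ) (f A : ℝ → ℝ)
    (u ux : ℝ → ℝ → ℝ) : Prop where
  bounded : MemLp (fun p : ℝ × ℝ => u p.1 p.2) ⊤ (cylinderMeasure T)
  weaklyContinuous : IsWeaklyContinuous T u
  regular : 0 < ε → IsL2H1 bc T u ux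
  weak : IsWeakSolution bc T ε f A (u 0) u ux
  entropy : SatisfiesEntropyInequality bc T ε f A (u 0) u ux

/-! ### Norms, residuals and the stability constant -/

/-- The norm of `L²(Ω)`. -/
def normL2 (v : ℝ → ℝ) : ℝ≥0∞ := eLpNorm v 2 spaceMeasure

/-- The norm of `L¹(0,t; L²(Ω))`. -/
def normL1L2 (t : ℝ) (r : ℝ → ℝ → ℝ) : ℝ≥0∞ := ∫⁻ s in Ioo 0 t, normL2 (r s)

/-- The `H^{-1}` norm of the functional `φ ↦ ∫ G₀ φ + ∫ G₁ φ'`, dual to `‖φ'‖_{L²}`: the supremum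
over the `φ` in `H¹_0`, respectively in periodic `H¹`, with `‖φ'‖_{L²} ≤ 1`.  In the periodic case it
is infinite for functionals that do not vanish on constants. -/
def normHm1 (bc : BoundaryCondition) (G₀ G₁ : ℝ → ℝ) : ℝ≥0∞ :=
  ⨆ (φ : ℝ → ℝ) (φ' : ℝ → ℝ) (_ : MemLp φ' 2 spaceMeasure)
    (_ : ∀ x ∈ Icc (0 : ℝ) 1, φ x = φ 0 + ∫ y in (0 : ℝ)..x, φ' y)
    (_ : bc.Homogeneous φ) (_ : normL2 φ' ≤ 1),
    ENNReal.ofReal |∫ x in Ioo (0 : ℝ) 1, (G₀ x * φ x + G₁ x * φ' x)|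

section Norms

variable {M q : ℕ} [NeZero M]

/-- The limit of `v` from the left at the node `x_k`; beyond `x = 0` the function is continued
periodically, respectively by zero. -/
def limMinus (bc : BoundaryCondition) (X : Partition M 0 1) (v : ℝ → ℝ) (k : Fin (M + 1)) : ℝ :=
  if k = 0 then
    match bc with
    | .periodic => Function.leftLim v 1
    | .dirichlet _ _ => 0
  else Function.leftLim v (X.z k)

/-- The limit of `v` from the right at the node `x_k`; beyond `x = 1` the function is continued
periodically, respectively by zero. -/
def limPlus (bc : BoundaryCondition) (X : Partition M 0 1) (v : ℝ → ℝ) (k : Fin (M + 1)) : ℝ :=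
  if k = Fin.last M then
    match bc with
    | .periodic => Function.rightLim v 0
    | .dirichlet _ _ => 0
  else Function.rightLim v (X.z k)

/-- `h_k`, the mean of the lengths of the two elements at the node `x_k`; at an end point, the
element on the far side is the one at the other end in the periodic case, and the mirror image of
the adjacent element in the Dirichlet case. -/
def nodeSize (bc : BoundaryCondition) (X : Partition M 0 1) (k : Fin (M + 1)) : ℝ :=
  let far : ℝ × ℝ := match bc with
    | .periodic => (X.size (Fin.rev 0), X.size 0)
    | .dirichlet _ _ => (X.size 0, X.size (Fin.rev 0))
  let before : Fin (M + 1) → ℝ := Fin.cons far.1 X.size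
  let after : Fin (M + 1) → ℝ := Fin.snoc X.size far.2
  (before k + after k) / 2

/-- The nodes over which jumps are summed: `x_0, ..., x_{M-1}` in the periodic case, where `x_M` is
identified with `x_0`, and all nodes in the Dirichlet case. -/
def jumpNodes (bc : BoundaryCondition) (M : ℕ) : Finset (Fin (M + 1)) :=
  match bc with
  | .periodic => Finset.univ.erase (Fin.last M)
  | .dirichlet _ _ => Finset.univ

/-- The square of the dG energy norm on `(0,t)` of a function `v` with elementwise derivative
`vx`. -/
def dgEnergySq (bc : BoundaryCondition) (X : Partition M 0 1) (t : ℝ) (v vx : ℝ → ℝ → ℝ) : ℝ≥0∞ :=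
  ∫⁻ s in Ioo 0 t,
    ((∑ j : Fin M, eLpNorm (vx s) 2 (volume.restrict (Ioo (X.z j.castSucc) (X.z j.succ))) ^ 2)
      + ∑ k ∈ jumpNodes bc M, ENNReal.ofReal
          ((nodeSize bc X k)⁻¹ * |limMinus bc X (v s) k - limPlus bc X (v s) k| ^ 2))

/-- The hyperbolic residual `r₁ = ∂_t û^{ts} + ∂_x f(û^{ts}) - ε 𝔄_h(û_h^t)`. -/
def residual₁ (X : Partition M 0 1) (f : ℝ → ℝ) (ε : ℝ)
    (Ah : ℝ → Broken M (q + 1) → Broken M (q + 1))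
    (ut : ℝ → Broken M (q + 1)) (uts : ℝ → Broken M (q + 2)) (t x : ℝ) : ℝ :=
  X.eval (deriv uts t) x + deriv f (X.eval (uts t) x) * X.evalDeriv (uts t) x
    - ε * X.eval (Ah t (ut t)) x

/-- The norm in `L²(0,t; H^{-1})` of the parabolic residual
`r₂ = 𝔄_h(û_h^t) - ∂_x (A(û^{ts}) ∂_x û^{ts})`, squared. -/
def residual₂NormSq (bc : BoundaryCondition) (X : Partition M 0 1) (A : ℝ → ℝ)
    (Ah : ℝ → Broken M (q + 1) → Broken M (q + 1))
    (ut : ℝ → Broken M (q + 1)) (uts : ℝ → Broken M (q + 2)) (t : ℝ) : ℝ≥0∞ :=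
  ∫⁻ s in Ioo 0 t,
    normHm1 bc (fun x => X.eval (Ah s (ut s)) x)
      (fun x => A (X.eval (uts s) x) * X.evalDeriv (uts s) x) ^ 2

/-- `‖∂_x û‖_{L^∞((0,T) × Ω)}` for the space-time reconstruction `û`. -/
def gradientBound (X : Partition M 0 1) (T : ℝ) (uts : ℝ → Broken M (q + 2)) : ℝ :=
  (eLpNorm (fun p : ℝ × ℝ => X.evalDeriv (uts p.1) p.2) ⊤ (cylinderMeasure T)).toReal

/-- The constant `K[û]`. -/
def stabilityConstant (X : Partition M 0 1) (T ε : ℝ) (f A : ℝ → ℝ) (a b : ℝ)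
    (uts : ℝ → Broken M (q + 2)) : ℝ :=
  (ε * gradientBound X T uts * sSup ((fun v => |deriv A v| ^ 2) '' Icc a b)
    + sSup ((fun v => |deriv (deriv f) v|) '' Icc a b)) * gradientBound X T uts

end Norms

end RKdG

end

open RKdG

namespace RKdG

/-! ### Absolutely continuous functions -/

/-! Write `û` for `uts` and `e = u - û`. The reconstruction `û` is continuous in space, satisfies
the boundary conditions and is Lipschitz in time, so it solves the equation up to the computable
residuals. A relative energy argument bounds `e`; the squared triangle inequality, which costs the
outer factor 2, then passes from `û` to the discrete solution. Since `e` is continuous with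
homogeneous boundary values when `ε > 0`, replacing `u` by `û` does not change the jumps
(`Partition.jump_eq`).

The starting point is `‖e(t)‖² ≤ ‖e(0)‖² + 2 ∫∫ errorRate`. For `ε > 0` the error lies in `H¹` and
may serve as its own test function. As `u` is only weakly continuous in time, this is justified by
backward differences, convexity and the continuity of translations in `L²` (`energy_inequality`),
once the weak formulation has been extended to `H¹` test functions (`IsWeakSolution.isMild`). For `ε
= 0` the error is too rough to be tested with, and the square is expanded: `‖u‖²` does not grow by
the entropy inequality, `∫ u û` is differentiated with the weak formulation
(`IsMild.integral_mul_eval`), and `‖û‖²` is explicit (`energy_estimate_of_eq_zero`).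

In `errorRate` the time derivative of `û` is replaced by the residuals. The Taylor remainder of `f`
and the difference `A(u) - A(û)` give `K ‖e‖²`, and `A ≥ 1` gives `ε ‖∂ₓe‖²`. Young's inequality
spends one quarter of the latter on `A(u) - A(û)` and one quarter on `r₂`; the remaining half,
doubled, is the dissipation in the claim. These bounds need `u` in `[a, b]`. For `ε > 0` this is a
maximum principle (`IsEntropySolution.mem_Icc`), again from `energy_inequality`, with a convex
function that vanishes exactly on `[a, b]`.

`gronwall_sqrt` closes the argument, with the factors 2, 8, 4 in place of 4, 16, 8
(`error_estimate`). -/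

lemma absolutelyContinuousOnInterval_congr {f g : ℝ → ℝ} {a b : ℝ}
    (hf : AbsolutelyContinuousOnInterval f a b) (h : ∀ x ∈ uIcc a b, f x = g x) :
    AbsolutelyContinuousOnInterval g a b := by
  rw [absolutelyContinuousOnInterval_iff] at hf ⊢
  intro ε hε
  obtain ⟨δ, hδ, H⟩ := hf ε hε
  refine ⟨δ, hδ, fun E hE hE' => ?_⟩
  convert H E hE hE' using 1
  refine Finset.sum_congr rfl fun i hi => ?_
  have := hE.1 i hi
  rw [h _ this.1, h _ this.2]

lemma absolutelyContinuousOnInterval_lipschitz_comp {f G : ℝ → ℝ} {a b : ℝ} {K : ℝ≥0}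
    {s : Set ℝ} (hG : LipschitzOnWith K G s) (hf : AbsolutelyContinuousOnInterval f a b)
    (hs : ∀ x ∈ uIcc a b, f x ∈ s) : AbsolutelyContinuousOnInterval (fun x => G (f x)) a b := by
  rw [absolutelyContinuousOnInterval_iff] at hf ⊢
  intro ε hε
  obtain ⟨δ, hδ, H⟩ := hf (ε / (K + 1)) (by positivity)
  refine ⟨δ, hδ, fun E hE hE' => ?_⟩
  have h1 := H E hE hE'
  calc ∑ i ∈ Finset.range E.1, dist (G (f (E.2 i).1)) (G (f (E.2 i).2))
    _ ≤ ∑ i ∈ Finset.range E.1, (K : ℝ) * dist (f (E.2 i).1) (f (E.2 i).2) :=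
        Finset.sum_le_sum fun i hi =>
          hG.dist_le_mul _ (hs _ (hE.1 i hi).1) _ (hs _ (hE.1 i hi).2)
    _ = K * ∑ i ∈ Finset.range E.1, dist (f (E.2 i).1) (f (E.2 i).2) := by rw [Finset.mul_sum]
    _ ≤ (K + 1) * ∑ i ∈ Finset.range E.1, dist (f (E.2 i).1) (f (E.2 i).2) := by
        gcongr
        linarith
    _ < (K + 1) * (ε / (K + 1)) := by gcongr
    _ = ε := by field_simp

lemma integral_eq_sub_of_absolutelyContinuous {f f' : ℝ → ℝ} {a b : ℝ}
    (hab : a ≤ b) (hf : AbsolutelyContinuousOnInterval f a b)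
    (h : ∀ᵐ x, x ∈ Ioo a b → HasDerivAt f (f' x) x) :
    IntervalIntegrable f' volume a b ∧ ∫ x in a..b, f' x = f b - f a := by
  have hd : ∀ᵐ x, x ∈ uIoc a b → deriv f x = f' x := by
    have : ∀ᵐ x : ℝ, x ≠ b := by simp [ae_iff]
    filter_upwards [h, this] with x hx hxb hx'
    rw [uIoc_of_le hab] at hx'
    exact (hx ⟨hx'.1, lt_of_le_of_ne hx'.2 hxb⟩).deriv
  refine ⟨hf.intervalIntegrable_deriv.congr_ae ?_, ?_⟩
  · exact (ae_restrict_iff' measurableSet_uIoc).2 hd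
  · rw [← hf.integral_deriv_eq_sub]
    refine (intervalIntegral.integral_congr_ae hd).symm

/-- `φ` is a primitive of the integrable function `φ'` on `[a, b]`. -/
def IsPrimitive (a b : ℝ) (φ φ' : ℝ → ℝ) : Prop :=
  IntervalIntegrable φ' volume a b ∧ ∀ x ∈ Icc a b, φ x = φ a + ∫ y in a..x, φ' y

namespace IsPrimitive

variable {a b : ℝ} {φ φ' χ χ' : ℝ → ℝ}

lemma absolutelyContinuous (hab : a ≤ b) (h : IsPrimitive a b φ φ') :
    AbsolutelyContinuousOnInterval φ a b := by
  have h1 := h.1.absolutelyContinuousOnInterval_intervalIntegral (c := a) (by simp)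
  have h2 : AbsolutelyContinuousOnInterval (fun _ : ℝ => φ a) a b :=
    (LipschitzWith.const (φ a)).lipschitzOnWith.absolutelyContinuousOnInterval (K := 0)
  refine absolutelyContinuousOnInterval_congr (h2.fun_add h1) fun x hx => ?_
  rw [uIcc_of_le hab] at hx
  exact (h.2 x hx).symm

lemma continuousOn (hab : a ≤ b) (h : IsPrimitive a b φ φ') : ContinuousOn φ (Icc a b) := by
  have := (h.absolutelyContinuous hab).continuousOn
  rwa [uIcc_of_le hab] at this

lemma ae_hasDerivAt (hab : a ≤ b) (h : IsPrimitive a b φ φ') :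
    ∀ᵐ x, x ∈ Ioo a b → HasDerivAt φ (φ' x) x := by
  filter_upwards [h.1.ae_hasDerivAt_integral] with x hx hx'
  have h1 := hx (by rw [uIcc_of_le hab]; exact Ioo_subset_Icc_self hx') a (by simp)
  refine (h1.const_add (φ a)).congr_of_eventuallyEq ?_
  filter_upwards [Ioo_mem_nhds hx'.1 hx'.2] with y hy
  exact h.2 y (Ioo_subset_Icc_self hy)

lemma integral_eq (hab : a ≤ b) (h : IsPrimitive a b φ φ') :
    ∫ x in a..b, φ' x = φ b - φ a := by
  rw [h.2 b (right_mem_Icc.2 hab)]; ring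

lemma of_ac (hab : a ≤ b) (hf : AbsolutelyContinuousOnInterval φ a b)
    (h : ∀ᵐ x, x ∈ Ioo a b → HasDerivAt φ (φ' x) x) : IsPrimitive a b φ φ' := by
  refine ⟨(integral_eq_sub_of_absolutelyContinuous hab hf h).1,
    fun x hx => ?_⟩
  have hf' : AbsolutelyContinuousOnInterval φ a x := hf.mono (by
    rw [uIcc_of_le hx.1, uIcc_of_le hab]; exact Icc_subset_Icc_right hx.2)
  have := (integral_eq_sub_of_absolutelyContinuous hx.1 hf' (by
    filter_upwards [h] with y hy hy' using hy ⟨hy'.1, hy'.2.trans_le hx.2⟩)).2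
  linarith

lemma comp (hab : a ≤ b) (h : IsPrimitive a b φ φ') {G : ℝ → ℝ} (hG : ContDiff ℝ 1 G) :
    IsPrimitive a b (fun x => G (φ x)) (fun x => deriv G (φ x) * φ' x) := by
  -- `φ` is bounded, so the `C¹` function `G` is Lipschitz on its range, and the composition stays
  -- absolutely continuous.
  obtain ⟨C, hC⟩ := (h.absolutelyContinuous hab).exists_bound
  obtain ⟨K, hK⟩ := hG.contDiffOn.exists_lipschitzOnWith (s := Icc (-C) C) (by decide)
    (convex_Icc _ _) isCompact_Icc
  refine of_ac hab (absolutelyContinuousOnInterval_lipschitz_comp hK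
    (h.absolutelyContinuous hab) fun x hx => ?_) ?_
  · exact abs_le.1 (hC x hx)
  · filter_upwards [h.ae_hasDerivAt hab] with x hx hx'
    exact ((hG.differentiable (by norm_num)).differentiableAt.hasDerivAt).comp x (hx hx')

lemma mul (hab : a ≤ b) (h : IsPrimitive a b φ φ') (k : IsPrimitive a b χ χ') :
    IsPrimitive a b (fun x => φ x * χ x) (fun x => φ' x * χ x + φ x * χ' x) := by
  refine of_ac hab ((h.absolutelyContinuous hab).fun_mul (k.absolutelyContinuous hab)) ?_
  filter_upwards [h.ae_hasDerivAt hab, k.ae_hasDerivAt hab] with x hx hx' hx''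
  exact (hx hx'').mul (hx' hx'')

lemma add (h : IsPrimitive a b φ φ') (k : IsPrimitive a b χ χ') :
    IsPrimitive a b (fun x => φ x + χ x) (fun x => φ' x + χ' x) := by
  refine ⟨h.1.add k.1, fun x hx => ?_⟩
  have hs : uIcc a x ⊆ uIcc a b := by
    rw [uIcc_of_le hx.1, uIcc_of_le (hx.1.trans hx.2)]; exact Icc_subset_Icc_right hx.2
  rw [intervalIntegral.integral_add (h.1.mono_set hs) (k.1.mono_set hs)]
  simp only [h.2 x hx, k.2 x hx]
  ring

lemma const_mul (h : IsPrimitive a b φ φ') (c : ℝ) :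
    IsPrimitive a b (fun x => c * φ x) (fun x => c * φ' x) := by
  refine ⟨h.1.const_mul c, fun x hx => ?_⟩
  rw [intervalIntegral.integral_const_mul]
  simp only [h.2 x hx]
  ring

lemma sub (h : IsPrimitive a b φ φ') (k : IsPrimitive a b χ χ') :
    IsPrimitive a b (fun x => φ x - χ x) (fun x => φ' x - χ' x) := by
  have := h.add (k.const_mul (-1))
  simpa [sub_eq_add_neg] using this

lemma of_contDiff {G : ℝ → ℝ} (hab : a ≤ b) (hG : ContDiff ℝ 1 G) :
    IsPrimitive a b G (deriv G) :=
  of_ac hab hG.contDiffOn.absolutelyContinuousOnInterval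
    (.of_forall fun x _ => (hG.differentiable (by norm_num) x).hasDerivAt)

lemma const (a b c : ℝ) : IsPrimitive a b (fun _ => c) (fun _ => 0) := by
  refine ⟨by simp, fun x hx => by simp⟩

end IsPrimitive

/-- `φ` is an absolutely continuous function on `[0,1]` with the square-integrable derivative
`φ'`. -/
def HasL2Deriv (φ φ' : ℝ → ℝ) : Prop :=
  MemLp φ' 2 spaceMeasure ∧ ∀ x ∈ Icc (0 : ℝ) 1, φ x = φ 0 + ∫ y in (0 : ℝ)..x, φ' y

lemma intervalIntegrable_iff_spaceMeasure {g : ℝ → ℝ} :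
    IntervalIntegrable g volume 0 1 ↔ Integrable g spaceMeasure := by
  rw [intervalIntegrable_iff_integrableOn_Ioo_of_le zero_le_one]; rfl

lemma intervalIntegral_eq_spaceMeasure (g : ℝ → ℝ) :
    ∫ x in (0 : ℝ)..1, g x = ∫ x in Ioo (0 : ℝ) 1, g x := by
  rw [intervalIntegral.integral_of_le zero_le_one, integral_Ioc_eq_integral_Ioo]

namespace HasL2Deriv

variable {φ φ' χ χ' : ℝ → ℝ}

lemma isPrimitive (h : HasL2Deriv φ φ') : IsPrimitive 0 1 φ φ' :=
  ⟨intervalIntegrable_iff_spaceMeasure.2 (h.1.integrable (by norm_num)), h.2⟩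

lemma _root_.RKdG.IsPrimitive.hasL2Deriv (h : IsPrimitive 0 1 φ φ') (h' : MemLp φ' 2 spaceMeasure) :
    HasL2Deriv φ φ' := ⟨h', h.2⟩

lemma continuousOn (h : HasL2Deriv φ φ') : ContinuousOn φ (Icc 0 1) :=
  h.isPrimitive.continuousOn zero_le_one

lemma memLp_top (h : HasL2Deriv φ φ') : MemLp φ ∞ spaceMeasure := by
  obtain ⟨C, hC⟩ := isCompact_Icc.exists_bound_of_continuousOn h.continuousOn
  refine memLp_top_of_bound ((h.continuousOn.mono Ioo_subset_Icc_self).aestronglyMeasurable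
    measurableSet_Ioo) C ?_
  exact (ae_restrict_iff' measurableSet_Ioo).2
    (.of_forall fun x hx => hC x (Ioo_subset_Icc_self hx))

lemma memLp (h : HasL2Deriv φ φ') : MemLp φ 2 spaceMeasure := h.memLp_top.mono_exponent le_top

lemma integral_deriv (h : HasL2Deriv φ φ') : ∫ x in Ioo (0 : ℝ) 1, φ' x = φ 1 - φ 0 := by
  rw [← intervalIntegral_eq_spaceMeasure]; exact h.isPrimitive.integral_eq zero_le_one

lemma sub (h : HasL2Deriv φ φ') (k : HasL2Deriv χ χ') :
    HasL2Deriv (fun x => φ x - χ x) (fun x => φ' x - χ' x) :=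
  (h.isPrimitive.sub k.isPrimitive).hasL2Deriv (h.1.sub k.1)

lemma const_mul (h : HasL2Deriv φ φ') (c : ℝ) :
    HasL2Deriv (fun x => c * φ x) (fun x => c * φ' x) :=
  (h.isPrimitive.const_mul c).hasL2Deriv (h.1.const_mul c)

lemma comp (h : HasL2Deriv φ φ') {G : ℝ → ℝ} (hG : ContDiff ℝ 1 G) :
    HasL2Deriv (fun x => G (φ x)) (fun x => deriv G (φ x) * φ' x) := by
  refine (h.isPrimitive.comp zero_le_one hG).hasL2Deriv ?_
  have hc : ContinuousOn (fun x => deriv G (φ x)) (Icc 0 1) :=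
    (hG.continuous_deriv (by norm_num)).comp_continuousOn h.continuousOn
  obtain ⟨C, hC⟩ := isCompact_Icc.exists_bound_of_continuousOn hc
  have : MemLp (fun x => deriv G (φ x)) ∞ spaceMeasure :=
    memLp_top_of_bound ((hc.mono Ioo_subset_Icc_self).aestronglyMeasurable measurableSet_Ioo) C
      ((ae_restrict_iff' measurableSet_Ioo).2
        (.of_forall fun x hx => hC x (Ioo_subset_Icc_self hx)))
  exact h.1.mul this

lemma integral_mul_deriv (h : HasL2Deriv φ φ') (k : HasL2Deriv χ χ') :
    ∫ x in Ioo (0 : ℝ) 1, (φ' x * χ x + φ x * χ' x) = φ 1 * χ 1 - φ 0 * χ 0 := by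
  rw [← intervalIntegral_eq_spaceMeasure]
  exact (h.isPrimitive.mul zero_le_one k.isPrimitive).integral_eq zero_le_one

end HasL2Deriv

/-! ### Energy inequality for weakly continuous functions -/

lemma cylinderMeasure_eq_prod (T : ℝ) :
    cylinderMeasure T = (volume.restrict (Ioo 0 T)).prod spaceMeasure := by
  rw [cylinderMeasure, spaceMeasure, Measure.volume_eq_prod, Measure.prod_restrict]

lemma integrable_fun_mul {α : Type*} [MeasurableSpace α] {μ : Measure α} {f g : α → ℝ}
    (hf : MemLp f 2 μ) (hg : MemLp g 2 μ) : Integrable (fun x => f x * g x) μ :=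
  hf.integrable_mul hg

/-- Translations are strongly continuous on `L²`. Only the time variable is shifted; this is the
limit `h → 0` in the energy inequality. -/
lemma tendsto_integral_translate {f g : ℝ × ℝ → ℝ} (hf : MemLp f 2 volume)
    (hg : MemLp g 2 volume) :
    Tendsto (fun τ : ℝ => ∫ p, f (p.1 - τ, p.2) * g p) (𝓝 0) (𝓝 (∫ p, f p * g p)) := by
  let T : ℝ → C(ℝ × ℝ, ℝ × ℝ) := fun τ => ⟨fun p => p - (τ, 0), by fun_prop⟩
  have hmp : ∀ τ, MeasurePreserving (T τ) volume volume := fun τ =>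
    measurePreserving_sub_right volume ((τ, 0) : ℝ × ℝ)
  have hTc : Continuous T := by
    refine ContinuousMap.continuous_of_continuous_uncurry _ ?_
    exact continuous_snd.sub (continuous_fst.prodMk continuous_const)
  have hlim : Tendsto (fun τ => Lp.compMeasurePreserving (T τ) (hmp τ) hf.toLp) (𝓝 0)
      (𝓝 (Lp.compMeasurePreserving (T 0) (hmp 0) hf.toLp)) :=
    Filter.Tendsto.compMeasurePreservingLp tendsto_const_nhds (hTc.tendsto 0) hmp (hmp 0)
      (by norm_num)
  have hin := (hlim.inner (𝕜 := ℝ) (tendsto_const_nhds (x := hg.toLp)))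
  have key : ∀ τ, inner ℝ (Lp.compMeasurePreserving (T τ) (hmp τ) hf.toLp) hg.toLp
      = ∫ p, f (p.1 - τ, p.2) * g p := by
    intro τ
    rw [L2.inner_def]
    refine integral_congr_ae ?_
    have h1 := Lp.coeFn_compMeasurePreserving hf.toLp (hmp τ)
    have h2 := (hmp τ).quasiMeasurePreserving.ae_eq_comp hf.coeFn_toLp
    filter_upwards [h1, h2, hg.coeFn_toLp] with p h1 h2 h3
    rw [h1, h3]
    simp only [Function.comp_apply] at h2 ⊢
    rw [h2]
    have : T τ p = (p.1 - τ, p.2) := by simp [T, Prod.ext_iff]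
    simp [this, mul_comm]
  simp only [key] at hin
  simpa using hin

/-- The shear `(τ, p) ↦ (τ, p - (τ, 0))` preserves the product measure, so the shifted factor is
still square integrable in all variables. This is what Fubini in shift, time and space requires. -/
lemma integrable_translate_mul {f g : ℝ × ℝ → ℝ} (hf : MemLp f 2 volume)
    (hg : MemLp g 2 volume) (μ : Measure ℝ) [IsFiniteMeasure μ] :
    Integrable (fun z : ℝ × (ℝ × ℝ) => f (z.2.1 - z.1, z.2.2) * g z.2)
      (μ.prod volume) := by
  have hmp : MeasurePreserving (fun z : ℝ × (ℝ × ℝ) => (z.1, z.2 - (z.1, (0 : ℝ))))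
      (μ.prod volume) (μ.prod volume) := by
    refine (MeasurePreserving.id μ).skew_product (g := fun τ p => p - (τ, (0 : ℝ))) ?_ ?_
    · fun_prop
    · exact .of_forall fun τ => (measurePreserving_sub_right volume ((τ, 0) : ℝ × ℝ)).map_eq
  have hf2 : MemLp (fun z : ℝ × (ℝ × ℝ) => f z.2) 2 (μ.prod volume) := by
    have := hf.comp_snd (ν := volume) (μ := μ)
    exact this
  have hg2 : MemLp (fun z : ℝ × (ℝ × ℝ) => g z.2) 2 (μ.prod volume) := hg.comp_snd μ
  have hf3 := hf2.comp_measurePreserving hmp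
  have := hf3.integrable_mul hg2
  refine this.congr (.of_forall fun z => ?_)
  have : z.2 - (z.1, (0 : ℝ)) = (z.2.1 - z.1, z.2.2) := by simp [Prod.ext_iff]
  simp [this]

/-- Bounds on the cylinder hold on almost every slice. Tested with a nonnegative function they
become inequalities between continuous functions of time, hence hold at every time; the test
functions `(u(t) - b)⁺` and `(a - u(t))⁺` then recover the pointwise bounds. -/
lemma ae_mem_Icc_of_weaklyContinuous {T a b : ℝ} (hT : 0 < T) {u : ℝ → ℝ → ℝ}
    (hw : IsWeaklyContinuous T u)
    (h : ∀ᵐ p ∂cylinderMeasure T, u p.1 p.2 ∈ Icc a b) {t : ℝ} (ht : t ∈ Icc 0 T) :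
    ∀ᵐ x ∂spaceMeasure, u t x ∈ Icc a b := by
  rw [cylinderMeasure_eq_prod] at h
  have h' := Measure.ae_ae_of_ae_prod h
  have key : ∀ φ : ℝ → ℝ, MemLp φ 2 spaceMeasure → (∀ x, 0 ≤ φ x) → ∀ t ∈ Icc 0 T,
      a * (∫ x in Ioo (0 : ℝ) 1, φ x) ≤ ∫ x in Ioo (0 : ℝ) 1, u t x * φ x ∧
      ∫ x in Ioo (0 : ℝ) 1, u t x * φ x ≤ b * ∫ x in Ioo (0 : ℝ) 1, φ x := by
    intro φ hφ hφ0 t ht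
    have hφi : Integrable φ spaceMeasure := hφ.integrable (by norm_num)
    set I := ∫ x in Ioo (0 : ℝ) 1, φ x
    set F := fun t => ∫ x in Ioo (0 : ℝ) 1, u t x * φ x
    have hF : ContinuousOn F (Icc 0 T) := hw.2 φ hφ
    -- Both inequalities are encoded in one continuous function of time that vanishes almost
    -- everywhere, hence everywhere.
    have hcont : ContinuousOn (fun t => max (F t - b * I) 0 + max (a * I - F t) 0) (Icc 0 T) := by
      fun_prop
    have hae : (fun t => max (F t - b * I) 0 + max (a * I - F t) 0)
        =ᵐ[volume.restrict (Icc 0 T)] fun _ => 0 := by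
      rw [← restrict_Ioo_eq_restrict_Icc]
      have hm : ∀ᵐ t ∂(volume.restrict (Ioo 0 T)), t ∈ Ioo 0 T := ae_restrict_mem measurableSet_Ioo
      filter_upwards [h', hm] with s hs hsm
      have hi : Integrable (fun x => u s x * φ x) spaceMeasure :=
        (hw.1 s (Ioo_subset_Icc_self hsm)).integrable_mul hφ
      have h1 : F s ≤ b * I := by
        rw [← integral_const_mul]
        refine integral_mono_ae hi (hφi.const_mul _) ?_
        filter_upwards [hs] with x hx using mul_le_mul_of_nonneg_right hx.2 (hφ0 x)
      have h2 : a * I ≤ F s := by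
        rw [← integral_const_mul]
        refine integral_mono_ae (hφi.const_mul _) hi ?_
        filter_upwards [hs] with x hx using mul_le_mul_of_nonneg_right hx.1 (hφ0 x)
      simp [h1, h2]
    have := Measure.eqOn_Icc_of_ae_eq volume hT.ne hae hcont continuousOn_const ht
    simp only at this
    have h1 := le_max_left (F t - b * I) 0
    have h2 := le_max_left (a * I - F t) 0
    have h3 := le_max_right (F t - b * I) 0
    have h4 := le_max_right (a * I - F t) 0
    constructor <;> linarith
  have hut := hw.1 t ht
  have hb : ∀ᵐ x ∂spaceMeasure, u t x ≤ b := by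
    have hφ : MemLp (fun x => max (u t x - b) 0) 2 spaceMeasure :=
      (hut.sub (memLp_const b)).pos_part
    have h1 := (key _ hφ (fun x => le_max_right _ _) t ht).2
    have hi1 : Integrable (fun x => u t x * max (u t x - b) 0) spaceMeasure :=
      hut.integrable_mul hφ
    have hi2 : Integrable (fun x => b * max (u t x - b) 0) spaceMeasure :=
      (hφ.integrable (by norm_num)).const_mul b
    -- The square of `(u - b)⁺` equals `(u - b)(u - b)⁺`, whose integral is nonpositive by `key`.
    have h2 : ∫ x in Ioo (0 : ℝ) 1, (max (u t x - b) 0) ^ 2 = 0 := by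
      have h3 : ∫ x in Ioo (0 : ℝ) 1, (max (u t x - b) 0) ^ 2
          = (∫ x in Ioo (0 : ℝ) 1, u t x * max (u t x - b) 0)
            - b * ∫ x in Ioo (0 : ℝ) 1, max (u t x - b) 0 := by
        rw [← integral_const_mul, ← integral_sub hi1 hi2]
        refine integral_congr_ae (.of_forall fun x => ?_)
        rcases le_total (u t x - b) 0 with h | h
        · simp [h]
        · simp only [max_eq_left h]; ring
      refine le_antisymm (by rw [h3]; linarith) (integral_nonneg fun x => sq_nonneg _)
    rw [integral_eq_zero_iff_of_nonneg (fun x => sq_nonneg _) hφ.integrable_sq] at h2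
    filter_upwards [h2] with x hx
    have : max (u t x - b) 0 = 0 := by simpa using hx
    linarith [le_max_left (u t x - b) 0]
  have ha : ∀ᵐ x ∂spaceMeasure, a ≤ u t x := by
    have hφ : MemLp (fun x => max (a - u t x) 0) 2 spaceMeasure :=
      ((memLp_const a).sub hut).pos_part
    have h1 := (key _ hφ (fun x => le_max_right _ _) t ht).1
    have hi1 : Integrable (fun x => u t x * max (a - u t x) 0) spaceMeasure :=
      hut.integrable_mul hφ
    have hi2 : Integrable (fun x => a * max (a - u t x) 0) spaceMeasure :=
      (hφ.integrable (by norm_num)).const_mul a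
    have h2 : ∫ x in Ioo (0 : ℝ) 1, (max (a - u t x) 0) ^ 2 = 0 := by
      have h3 : ∫ x in Ioo (0 : ℝ) 1, (max (a - u t x) 0) ^ 2
          = a * (∫ x in Ioo (0 : ℝ) 1, max (a - u t x) 0)
            - ∫ x in Ioo (0 : ℝ) 1, u t x * max (a - u t x) 0 := by
        rw [← integral_const_mul, ← integral_sub hi2 hi1]
        refine integral_congr_ae (.of_forall fun x => ?_)
        rcases le_total (a - u t x) 0 with h | h
        · simp [h]
        · simp only [max_eq_left h]; ring
      refine le_antisymm (by rw [h3]; linarith) (integral_nonneg fun x => sq_nonneg _)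
    rw [integral_eq_zero_iff_of_nonneg (fun x => sq_nonneg _) hφ.integrable_sq] at h2
    filter_upwards [h2] with x hx
    have : max (a - u t x) 0 = 0 := by simpa using hx
    linarith [le_max_left (a - u t x) 0]
  filter_upwards [ha, hb] with x h1 h2 using ⟨h1, h2⟩

/-- `∂_t e + ∂_x P + Q = 0` weakly in space and integrated in time. -/
def IsMild (bc : BoundaryCondition) (T : ℝ) (e P Q : ℝ → ℝ → ℝ) : Prop :=
  ∀ s t, 0 ≤ s → s ≤ t → t ≤ T → ∀ φ φ' : ℝ → ℝ, HasL2Deriv φ φ' → bc.Homogeneous φ →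
    ∫ x in Ioo (0 : ℝ) 1, (e t x - e s x) * φ x
      = ∫ r in s..t, ∫ x in Ioo (0 : ℝ) 1, (P r x * φ' x - Q r x * φ x)

lemma memLp_two_of_ae_bound {α : Type*} [MeasurableSpace α] {μ : Measure α} [IsFiniteMeasure μ]
    {g : α → ℝ} (hg : AEStronglyMeasurable g μ) (C : ℝ) (h : ∀ᵐ x ∂μ, |g x| ≤ C) (p : ℝ≥0∞) :
    MemLp g p μ :=
  (memLp_top_of_bound hg C h).mono_exponent le_top

/-- A continuous function of a bounded function is bounded. -/
lemma memLp_comp_of_ae_bound {α : Type*} [MeasurableSpace α] {μ : Measure α} [IsFiniteMeasure μ]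
    {g : α → ℝ} (hg : AEStronglyMeasurable g μ) {C : ℝ} (h : ∀ᵐ x ∂μ, |g x| ≤ C) {S : ℝ → ℝ}
    (hS : Continuous S) (p : ℝ≥0∞) : MemLp (fun x => S (g x)) p μ := by
  obtain ⟨D, hD⟩ := (isCompact_Icc (a := -C) (b := C)).exists_bound_of_continuousOn
    hS.continuousOn
  refine memLp_two_of_ae_bound (hS.comp_aestronglyMeasurable hg) D ?_ p
  filter_upwards [h] with x hx using hD _ (abs_le.1 hx)

instance isFiniteMeasure_cylinder (T : ℝ) : IsFiniteMeasure (cylinderMeasure T) := by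
  rw [cylinderMeasure_eq_prod]; infer_instance

/-- Before time zero `σ` is frozen at `σ 0`, so the differences telescope to an average near `t`
minus the exact initial value; no continuity of `σ` at zero is needed. -/
lemma integral_backward_difference {σ : ℝ → ℝ} {t h : ℝ} (hh : 0 < h) (hht : h < t)
    (hσ : IntervalIntegrable σ volume 0 t) :
    IntervalIntegrable (fun s => σ s - σ (max (s - h) 0)) volume 0 t ∧
    ∫ s in (0 : ℝ)..t, (σ s - σ (max (s - h) 0)) = (∫ s in (t - h)..t, σ s) - h * σ 0 := by
  have hsub : ∀ c d, 0 ≤ c → c ≤ d → d ≤ t → IntervalIntegrable σ volume c d :=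
    fun c d h1 h2 h3 => hσ.mono_set (by
      rw [uIcc_of_le h2, uIcc_of_le (h1.trans (h2.trans h3))]; exact Icc_subset_Icc h1 h3)
  have e1 : EqOn (fun _ => σ 0) (fun s => σ (max (s - h) 0)) (uIcc 0 h) := fun s hs => by
    rw [uIcc_of_le hh.le] at hs
    simp only; rw [max_eq_right (by linarith [hs.2])]
  have e2 : EqOn (fun s => σ (s - h)) (fun s => σ (max (s - h) 0)) (uIcc h t) := fun s hs => by
    rw [uIcc_of_le hht.le] at hs
    simp only; rw [max_eq_left (by linarith [hs.1])]
  have i1 : IntervalIntegrable (fun s => σ (max (s - h) 0)) volume 0 h :=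
    (intervalIntegrable_const (c := σ 0)).congr (fun s hs => e1 (uIoc_subset_uIcc hs))
  have i2' : IntervalIntegrable (fun s => σ (s - h)) volume h t := by
    have := (hsub 0 (t - h) le_rfl (by linarith) (by linarith)).comp_sub_right h
    simpa using this
  have i2 : IntervalIntegrable (fun s => σ (max (s - h) 0)) volume h t :=
    i2'.congr (fun s hs => e2 (uIoc_subset_uIcc hs))
  refine ⟨hσ.sub (i1.trans i2), ?_⟩
  rw [intervalIntegral.integral_sub hσ (i1.trans i2),
    ← intervalIntegral.integral_add_adjacent_intervals i1 i2,
    ← intervalIntegral.integral_congr e1, ← intervalIntegral.integral_congr e2,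
    intervalIntegral.integral_comp_sub_right (fun s => σ s) h,
    ← intervalIntegral.integral_add_adjacent_intervals
      (hsub 0 (t - h) le_rfl (by linarith) (by linarith))
      (hsub (t - h) t (by linarith) (by linarith) le_rfl)]
  simp
  ring

section Energy

variable {bc : BoundaryCondition} {T C : ℝ} {e P Q Bx : ℝ → ℝ → ℝ} {S β : ℝ → ℝ}

/-- The tangent inequality at `e t` bounds `∫ S(e s)` below by an expression affine in `e s`, and
the slope `β (e t)` is a fixed `L²` test function, to which weak continuity applies. -/
lemma weak_lowerSemicontinuous (hw : IsWeaklyContinuous T e)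
    (hC : ∀ t ∈ Icc 0 T, ∀ᵐ x ∂spaceMeasure, |e t x| ≤ C)
    (hS : Continuous S) (hβ : Continuous β) (hconv : ∀ x y, S x + β x * (y - x) ≤ S y)
    {t : ℝ} (ht : t ∈ Icc 0 T) {η : ℝ} (hη : 0 < η) :
    ∃ δ > 0, ∀ s ∈ Icc 0 T, |s - t| < δ →
      (∫ x in Ioo (0 : ℝ) 1, S (e t x)) - η ≤ ∫ x in Ioo (0 : ℝ) 1, S (e s x) := by
  have hm : ∀ s ∈ Icc 0 T, AEStronglyMeasurable (e s) spaceMeasure := fun s hs => (hw.1 s hs).1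
  have hβm : MemLp (fun x => β (e t x)) 2 spaceMeasure :=
    memLp_comp_of_ae_bound (hm t ht) (hC t ht) hβ 2
  have hc := Metric.continuousOn_iff.1 (hw.2 _ hβm) t ht η hη
  obtain ⟨δ, hδ, H⟩ := hc
  refine ⟨δ, hδ, fun s hs hst => ?_⟩
  have h1 := H s hs hst
  have iS : ∀ s ∈ Icc 0 T, Integrable (fun x => S (e s x)) spaceMeasure := fun s hs =>
    memLp_one_iff_integrable.1 (memLp_comp_of_ae_bound (hm s hs) (hC s hs) hS 1)
  have iB : ∀ s ∈ Icc 0 T, Integrable (fun x => e s x * β (e t x)) spaceMeasure := fun s hs =>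
    integrable_fun_mul (hw.1 s hs) hβm
  have iD : Integrable (fun x => e s x * β (e t x) - e t x * β (e t x)) spaceMeasure :=
    (iB s hs).sub (iB t ht)
  have h2 : (∫ x in Ioo (0 : ℝ) 1, S (e t x)) + ((∫ x in Ioo (0 : ℝ) 1, e s x * β (e t x))
      - ∫ x in Ioo (0 : ℝ) 1, e t x * β (e t x)) ≤ ∫ x in Ioo (0 : ℝ) 1, S (e s x) := by
    rw [← integral_sub (iB s hs) (iB t ht), ← integral_add (iS t ht) iD]
    refine integral_mono ((iS t ht).add iD) (iS s hs) fun x => ?_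
    have := hconv (e t x) (e s x)
    simp only
    linarith
  rw [Real.dist_eq] at h1
  have := abs_lt.1 h1
  linarith [this.1]

/-- The backward differences of `∫ S(e)` are controlled by time averages of the right hand side. -/
lemma backward_difference_le (hw : IsWeaklyContinuous T e)
    (hC : ∀ t ∈ Icc 0 T, ∀ᵐ x ∂spaceMeasure, |e t x| ≤ C)
    (hmild : IsMild bc T e P Q)
    (hS : Continuous S) (hconv : ∀ x y, S x + β x * (y - x) ≤ S y)
    {s h : ℝ} (hs : s ∈ Ioo 0 T) (hh : 0 < h)
    (hB : HasL2Deriv (fun x => β (e s x)) (Bx s)) (hB' : bc.Homogeneous (fun x => β (e s x))) :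
    (∫ x in Ioo (0 : ℝ) 1, S (e s x)) - (∫ x in Ioo (0 : ℝ) 1, S (e (max (s - h) 0) x))
      ≤ ∫ τ in Ioo 0 h, ∫ x in Ioo (0 : ℝ) 1, (Ioi (0 : ℝ)).indicator
          (fun r => P r x * Bx s x - Q r x * β (e s x)) (s - τ) := by
  have hs' : s ∈ Icc 0 T := Ioo_subset_Icc_self hs
  have hr : max (s - h) 0 ∈ Icc 0 T :=
    ⟨le_max_right _ _, max_le (by linarith [hs.2]) (hs.1.trans hs.2).le⟩
  have hrs : max (s - h) 0 ≤ s := max_le (by linarith) hs.1.le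
  have iS : ∀ s ∈ Icc 0 T, Integrable (fun x => S (e s x)) spaceMeasure := fun s hs =>
    memLp_one_iff_integrable.1 (memLp_comp_of_ae_bound (hw.1 s hs).1 (hC s hs) hS 1)
  have h1 := hmild _ s hr.1 hrs hs'.2 _ _ hB hB'
  -- The tangent is taken at the later time `s`, so that the test function `β (e s)` does not depend
  -- on the time `r` of the flux.
  have h2 : (∫ x in Ioo (0 : ℝ) 1, S (e s x)) - (∫ x in Ioo (0 : ℝ) 1, S (e (max (s - h) 0) x))
      ≤ ∫ x in Ioo (0 : ℝ) 1, (e s x - e (max (s - h) 0) x) * β (e s x) := by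
    rw [← integral_sub (iS s hs') (iS _ hr)]
    refine integral_mono ((iS s hs').sub (iS _ hr))
      (((hw.1 s hs').sub (hw.1 _ hr)).integrable_mul hB.memLp) fun x => ?_
    have := hconv (e s x) (e (max (s - h) 0) x)
    simp only
    linarith
  refine h2.trans (le_of_eq ?_)
  rw [h1]
  -- Substituting `r = s - τ` turns the time integral over `(max (s - h) 0, s)` into one over `τ ∈
  -- (0, h)`, with the cut-off `r > 0` for times before zero.
  have h3 : ∀ τ, ∫ x in Ioo (0 : ℝ) 1, (Ioi (0 : ℝ)).indicator
        (fun r => P r x * Bx s x - Q r x * β (e s x)) (s - τ)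
      = (Ioi (0 : ℝ)).indicator (fun r => ∫ x in Ioo (0 : ℝ) 1,
        (P r x * Bx s x - Q r x * β (e s x))) (s - τ) := by
    intro τ
    by_cases h : s - τ ∈ Ioi (0 : ℝ)
    · simp only [indicator_of_mem h]
    · simp only [indicator_of_notMem h, integral_zero]
  simp only [h3]
  rw [← integral_Ioc_eq_integral_Ioo, ← intervalIntegral.integral_of_le hh.le,
    intervalIntegral.integral_comp_sub_left (fun r => (Ioi (0 : ℝ)).indicator (fun r =>
      ∫ x in Ioo (0 : ℝ) 1, (P r x * Bx s x - Q r x * β (e s x))) r) s, sub_zero,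
    intervalIntegral.integral_of_le (a := s - h) (b := s) (by linarith),
    setIntegral_indicator measurableSet_Ioi, Ioc_inter_Ioi, intervalIntegral.integral_of_le hrs]

/-- If `e` is bounded, `∂_t e + ∂_x P + Q = 0`, and `S` is convex with derivative `β`, then
`∫ S(e(t)) - ∫ S(e(0)) ≤ ∫∫ (P ∂_x β(e) - Q β(e))`. -/
theorem energy_inequality (hT : 0 < T)
    (he : AEStronglyMeasurable (fun p : ℝ × ℝ => e p.1 p.2) (cylinderMeasure T))
    (hw : IsWeaklyContinuous T e) (hC : ∀ᵐ p ∂cylinderMeasure T, |e p.1 p.2| ≤ C)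
    (hP : MemLp (fun p : ℝ × ℝ => P p.1 p.2) 2 (cylinderMeasure T))
    (hQ : MemLp (fun p : ℝ × ℝ => Q p.1 p.2) 2 (cylinderMeasure T))
    (hBx : MemLp (fun p : ℝ × ℝ => Bx p.1 p.2) 2 (cylinderMeasure T))
    (hmild : IsMild bc T e P Q)
    (hS : Continuous S) (hβ : Continuous β) (hconv : ∀ x y, S x + β x * (y - x) ≤ S y)
    (hB : ∀ᵐ s ∂volume.restrict (Ioo 0 T), HasL2Deriv (fun x => β (e s x)) (Bx s) ∧
      bc.Homogeneous (fun x => β (e s x))) {t : ℝ} (ht : t ∈ Icc 0 T) :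
    (∫ x in Ioo (0 : ℝ) 1, S (e t x)) - ∫ x in Ioo (0 : ℝ) 1, S (e 0 x)
      ≤ ∫ s in (0 : ℝ)..t, ∫ x in Ioo (0 : ℝ) 1, (P s x * Bx s x - Q s x * β (e s x)) := by
  have hCt : ∀ t ∈ Icc 0 T, ∀ᵐ x ∂spaceMeasure, |e t x| ≤ C := fun t ht => by
    have := ae_mem_Icc_of_weaklyContinuous hT hw (a := -C) (b := C)
      (by filter_upwards [hC] with p hp using abs_le.1 hp) ht
    filter_upwards [this] with x hx using abs_le.2 hx
  rcases ht.1.eq_or_lt with rfl | ht0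
  · simp
  set σ : ℝ → ℝ := fun s => ∫ x in Ioo (0 : ℝ) 1, S (e s x) with hσ
  have hσi : IntervalIntegrable σ volume 0 t := by
    have h1 : Integrable (fun p : ℝ × ℝ => S (e p.1 p.2)) (cylinderMeasure T) :=
      memLp_one_iff_integrable.1 (memLp_comp_of_ae_bound he hC hS 1)
    rw [cylinderMeasure_eq_prod] at h1
    have h2 := h1.integral_prod_left
    rw [intervalIntegrable_iff_integrableOn_Ioo_of_le ht0.le]
    exact IntegrableOn.mono_set h2 (Ioo_subset_Ioo_right ht.2)
  have hBm : MemLp (fun p : ℝ × ℝ => β (e p.1 p.2)) 2 (cylinderMeasure T) :=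
    memLp_comp_of_ae_bound he hC hβ 2
  have hmT : MeasurableSet (Ioo (0 : ℝ) T ×ˢ Ioo (0 : ℝ) 1) :=
    measurableSet_Ioo.prod measurableSet_Ioo
  have hmt : MeasurableSet (Ioo (0 : ℝ) t ×ˢ Ioo (0 : ℝ) 1) :=
    measurableSet_Ioo.prod measurableSet_Ioo
  have hsub : Ioo (0 : ℝ) t ×ˢ Ioo (0 : ℝ) 1 ⊆ Ioo (0 : ℝ) T ×ˢ Ioo (0 : ℝ) 1 :=
    prod_mono (Ioo_subset_Ioo_right ht.2) le_rfl
  -- Extension by zero makes the time shift act on the whole plane. The shifted factors are cut off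
  -- at `T`, the test factors already at `t`.
  set f₁ : ℝ × ℝ → ℝ := (Ioo (0 : ℝ) T ×ˢ Ioo (0 : ℝ) 1).indicator fun p => P p.1 p.2 with hf₁
  set f₂ : ℝ × ℝ → ℝ := (Ioo (0 : ℝ) T ×ˢ Ioo (0 : ℝ) 1).indicator fun p => Q p.1 p.2 with hf₂
  set g₁ : ℝ × ℝ → ℝ := (Ioo (0 : ℝ) t ×ˢ Ioo (0 : ℝ) 1).indicator fun p => Bx p.1 p.2 with hg₁
  set g₂ : ℝ × ℝ → ℝ :=
    (Ioo (0 : ℝ) t ×ˢ Ioo (0 : ℝ) 1).indicator fun p => β (e p.1 p.2) with hg₂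
  have mf₁ : MemLp f₁ 2 volume := (memLp_indicator_iff_restrict hmT).2 hP
  have mf₂ : MemLp f₂ 2 volume := (memLp_indicator_iff_restrict hmT).2 hQ
  have mg₁ : MemLp g₁ 2 volume :=
    (memLp_indicator_iff_restrict hmt).2 (hBx.mono_measure (Measure.restrict_mono hsub le_rfl))
  have mg₂ : MemLp g₂ 2 volume :=
    (memLp_indicator_iff_restrict hmt).2 (hBm.mono_measure (Measure.restrict_mono hsub le_rfl))
  set J : ℝ → ℝ := fun τ => (∫ p, f₁ (p.1 - τ, p.2) * g₁ p) - ∫ p, f₂ (p.1 - τ, p.2) * g₂ p with hJ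
  have hJlim : Tendsto J (𝓝 0) (𝓝 ((∫ p, f₁ p * g₁ p) - ∫ p, f₂ p * g₂ p)) :=
    (tendsto_integral_translate mf₁ mg₁).sub (tendsto_integral_translate mf₂ mg₂)
  have hJ0 : (∫ p, f₁ p * g₁ p) - ∫ p, f₂ p * g₂ p
      = ∫ s in (0 : ℝ)..t, ∫ x in Ioo (0 : ℝ) 1, (P s x * Bx s x - Q s x * β (e s x)) := by
    rw [← integral_sub (integrable_fun_mul mf₁ mg₁) (integrable_fun_mul mf₂ mg₂)]
    have h1 : (fun p => f₁ p * g₁ p - f₂ p * g₂ p) = (Ioo (0 : ℝ) t ×ˢ Ioo (0 : ℝ) 1).indicator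
        (fun p => P p.1 p.2 * Bx p.1 p.2 - Q p.1 p.2 * β (e p.1 p.2)) := by
      funext p
      by_cases hp : p ∈ Ioo (0 : ℝ) t ×ˢ Ioo (0 : ℝ) 1
      · simp only [hf₁, hf₂, hg₁, hg₂, indicator_of_mem hp, indicator_of_mem (hsub hp)]
      · simp only [hg₁, hg₂, indicator_of_notMem hp, mul_zero, sub_zero]
    rw [h1, integral_indicator hmt, Measure.volume_eq_prod, ← Measure.prod_restrict,
      integral_prod, intervalIntegral.integral_of_le ht0.le, integral_Ioc_eq_integral_Ioo]
    rw [Measure.prod_restrict, ← Measure.volume_eq_prod]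
    have := (mf₁.integrable_mul mg₁).sub (mf₂.integrable_mul mg₂)
    refine (integrable_indicator_iff hmt).1 ?_
    rw [← h1]; exact this
  -- Integrating the backward differences over `(0, t)` and exchanging the integrals in `s` and `τ`
  -- bounds them by the integral of `J` over `(0, h)`.
  have key : ∀ h, 0 < h → h < t → IntegrableOn J (Ioo 0 h) ∧
      (∫ s in (t - h)..t, σ s) - h * σ 0 ≤ ∫ τ in Ioo 0 h, J τ := by
    intro h hh hht
    set μ : Measure ℝ := volume.restrict (Ioo 0 h) with hμ
    set K : ℝ × (ℝ × ℝ) → ℝ := fun z =>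
      f₁ (z.2.1 - z.1, z.2.2) * g₁ z.2 - f₂ (z.2.1 - z.1, z.2.2) * g₂ z.2 with hKdef
    have hK₁ := integrable_translate_mul mf₁ mg₁ μ
    have hK₂ := integrable_translate_mul mf₂ mg₂ μ
    have hK : Integrable K (μ.prod volume) := hK₁.sub hK₂
    have hK' : Integrable (fun z : (ℝ × ℝ) × ℝ => K (z.1.1, (z.1.2, z.2)))
        ((μ.prod volume).prod volume) :=
      (measurePreserving_prodAssoc μ volume volume).integrable_comp_of_integrable hK
    set k : ℝ → ℝ → ℝ := fun τ s => ∫ x, K (τ, (s, x)) with hk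
    have hki : Integrable (Function.uncurry k) (μ.prod volume) := hK'.integral_prod_left
    have hJK : ∀ᵐ τ ∂μ, ∫ p, K (τ, p) = J τ := by
      filter_upwards [hK₁.prod_right_ae, hK₂.prod_right_ae] with τ h1 h2
      exact integral_sub h1 h2
    refine ⟨hK.integral_prod_left.congr hJK, ?_⟩
    have hJk : ∫ τ in Ioo 0 h, J τ = ∫ s, ∫ τ in Ioo 0 h, k τ s := by
      rw [← integral_integral_swap hki]
      refine integral_congr_ae ?_
      filter_upwards [hJK, hK.prod_right_ae] with τ h1 h2
      rw [← h1]
      rw [Measure.volume_eq_prod] at h2 ⊢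
      exact integral_prod _ h2
    have hk0 : ∀ s ∉ Ioo 0 t, ∫ τ in Ioo 0 h, k τ s = 0 := by
      intro s hs
      have : ∀ τ x, K (τ, (s, x)) = 0 := fun τ x => by
        have hn : (s, x) ∉ Ioo (0 : ℝ) t ×ˢ Ioo (0 : ℝ) 1 := fun h => hs h.1
        simp only [hKdef, hg₁, hg₂, indicator_of_notMem hn, mul_zero, sub_zero]
      simp [hk, this]
    rw [hJk, ← setIntegral_eq_integral_of_forall_compl_eq_zero hk0,
      ← (integral_backward_difference hh hht hσi).2, intervalIntegral.integral_of_le ht0.le,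
      integral_Ioc_eq_integral_Ioo]
    refine integral_mono_ae ?_ hki.integral_prod_right.integrableOn ?_
    · have := (integral_backward_difference hh hht hσi).1
      exact (intervalIntegrable_iff_integrableOn_Ioo_of_le ht0.le).1 this
    have hB' : ∀ᵐ s ∂volume.restrict (Ioo 0 t), HasL2Deriv (fun x => β (e s x)) (Bx s) ∧
        bc.Homogeneous (fun x => β (e s x)) :=
      ae_mono (Measure.restrict_mono (Ioo_subset_Ioo_right ht.2) le_rfl) hB
    filter_upwards [hB', ae_restrict_mem measurableSet_Ioo] with s hsB hs
    refine (backward_difference_le hw hCt hmild hS hconv ⟨hs.1, hs.2.trans_le ht.2⟩ hh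
      hsB.1 hsB.2).trans (le_of_eq ?_)
    refine setIntegral_congr_fun measurableSet_Ioo fun τ hτ => ?_
    simp only [hk]
    rw [← integral_indicator measurableSet_Ioo]
    congr 1
    funext x
    by_cases hx : x ∈ Ioo (0 : ℝ) 1
    · have m1 : (s, x) ∈ Ioo (0 : ℝ) t ×ˢ Ioo (0 : ℝ) 1 := ⟨hs, hx⟩
      by_cases hr : s - τ ∈ Ioi (0 : ℝ)
      · have m2 : (s - τ, x) ∈ Ioo (0 : ℝ) T ×ˢ Ioo (0 : ℝ) 1 :=
          ⟨⟨hr, by linarith [hτ.1, hs.2, ht.2]⟩, hx⟩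
        simp only [hKdef, hf₁, hf₂, hg₁, hg₂, indicator_of_mem hx, indicator_of_mem m1,
          indicator_of_mem m2, indicator_of_mem hr]
      · have m2 : (s - τ, x) ∉ Ioo (0 : ℝ) T ×ˢ Ioo (0 : ℝ) 1 := fun h => hr h.1.1
        simp only [hKdef, hf₁, hf₂, indicator_of_mem hx,
          indicator_of_notMem m2, indicator_of_notMem hr, zero_mul, sub_zero]
    · have m1 : (s, x) ∉ Ioo (0 : ℝ) t ×ˢ Ioo (0 : ℝ) 1 := fun h => hx h.2
      simp only [hKdef, hg₁, hg₂, indicator_of_notMem hx, indicator_of_notMem m1, mul_zero,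
        sub_zero]
  rw [← hJ0]
  -- After division by `h`, the average of `σ` before `t` is at least `σ t - η / 2` by lower
  -- semicontinuity, and the average of `J` is at most `J 0 + η / 2` by continuity of translations.
  refine le_of_forall_pos_le_add fun η hη => ?_
  obtain ⟨δ₁, hδ₁, H₁⟩ := weak_lowerSemicontinuous hw hCt hS hβ hconv ht (half_pos hη)
  obtain ⟨δ₂, hδ₂, H₂⟩ := Metric.tendsto_nhds_nhds.1 hJlim (η / 2) (half_pos hη)
  set J₀ := (∫ p, f₁ p * g₁ p) - ∫ p, f₂ p * g₂ p
  set h := min (min (δ₁ / 2) (δ₂ / 2)) (t / 2)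
  have hh : 0 < h := by positivity
  have h₁ : h < δ₁ := by
    have : h ≤ δ₁ / 2 := (min_le_left _ _).trans (min_le_left _ _)
    linarith
  have h₂ : h < δ₂ := by
    have : h ≤ δ₂ / 2 := (min_le_left _ _).trans (min_le_right _ _)
    linarith
  have h₃ : h < t := by
    have : h ≤ t / 2 := min_le_right _ _
    linarith
  have hlow : h * (σ t - η / 2) ≤ ∫ s in (t - h)..t, σ s := by
    have hi : IntervalIntegrable σ volume (t - h) t := hσi.mono_set (by
      rw [uIcc_of_le (by linarith), uIcc_of_le ht0.le]
      exact Icc_subset_Icc_left (by linarith))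
    have := intervalIntegral.integral_mono_on (a := t - h) (b := t) (by linarith)
      (intervalIntegrable_const (c := σ t - η / 2)) hi fun s hs =>
        H₁ s ⟨by linarith [hs.1], hs.2.trans ht.2⟩
          (abs_lt.2 ⟨by linarith [hs.1], by linarith [hs.2]⟩)
    rw [intervalIntegral.integral_const, smul_eq_mul] at this
    linarith
  have hup : ∫ τ in Ioo 0 h, J τ ≤ h * (J₀ + η / 2) := by
    have hb : ∀ τ ∈ Ioo 0 h, J τ ≤ J₀ + η / 2 := fun τ hτ => by
      have := H₂ (x := τ) (by rw [Real.dist_eq, sub_zero, abs_of_pos hτ.1]; linarith [hτ.2])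
      rw [Real.dist_eq] at this
      linarith [(abs_lt.1 this).2]
    have := setIntegral_mono_on (key h hh h₃).1 (integrableOn_const (by simp))
      measurableSet_Ioo hb
    simpa [hh.le] using this
  have hfin := (sub_le_sub_right hlow (h * σ 0)).trans ((key h hh h₃).2.trans hup)
  have : h * (σ t - σ 0) ≤ h * (J₀ + η) := by linarith
  exact le_of_mul_le_mul_left this hh

end Energy

/-! ### From the weak formulation to the mild form -/

lemma contDiff_primitive {ρ : ℝ → ℝ} (hρ : ContDiff ℝ ∞ ρ) (a : ℝ) :
    ContDiff ℝ ∞ (fun x => ∫ y in a..x, ρ y) ∧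
      ∀ x, HasDerivAt (fun x => ∫ y in a..x, ρ y) (ρ x) x := by
  have hd : ∀ x, HasDerivAt (fun x => ∫ y in a..x, ρ y) (ρ x) x := fun x =>
    intervalIntegral.integral_hasDerivAt_right (hρ.continuous.intervalIntegrable _ _)
      (hρ.continuous.stronglyMeasurableAtFilter _ _) hρ.continuous.continuousAt
  refine ⟨contDiff_infty_iff_deriv.2 ⟨fun x => (hd x).differentiableAt, ?_⟩, hd⟩
  rwa [show deriv (fun x => ∫ y in a..x, ρ y) = ρ from funext fun x => (hd x).deriv]

/-- `ψ` is a smooth function with compact support in `(a, b)`. -/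
def IsBump (a b : ℝ) (ψ : ℝ → ℝ) : Prop :=
  ContDiff ℝ ∞ ψ ∧ ∃ a' b', a < a' ∧ a' ≤ b' ∧ b' < b ∧ ∀ x, x ∉ Icc a' b' → ψ x = 0

namespace IsBump

variable {a b : ℝ} {ψ χ : ℝ → ℝ}

lemma of_tsupport (hab : a < b) (h : ContDiff ℝ ∞ ψ) (hc : HasCompactSupport ψ)
    (hs : tsupport ψ ⊆ Ioo a b) : IsBump a b ψ := by
  -- The midpoint only makes the set nonempty, so that it has a least and a greatest element even if
  -- `ψ = 0`.
  have hK : IsCompact (insert ((a + b) / 2) (tsupport ψ)) := IsCompact.insert hc _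
  have hne : (insert ((a + b) / 2) (tsupport ψ)).Nonempty := insert_nonempty _ _
  have hsub : insert ((a + b) / 2) (tsupport ψ) ⊆ Ioo a b :=
    insert_subset ⟨by linarith, by linarith⟩ hs
  obtain ⟨a', ha'⟩ := hK.exists_isLeast hne
  obtain ⟨b', hb'⟩ := hK.exists_isGreatest hne
  refine ⟨h, a', b', (hsub ha'.1).1, ha'.2 hb'.1, (hsub hb'.1).2, fun x hx => ?_⟩
  refine image_eq_zero_of_notMem_tsupport fun hx' => hx ?_
  exact ⟨ha'.2 (mem_insert_of_mem _ hx'), hb'.2 (mem_insert_of_mem _ hx')⟩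

lemma tsupport_subset_Icc {a' b' : ℝ} (h : ∀ x, x ∉ Icc a' b' → ψ x = 0) :
    tsupport ψ ⊆ Icc a' b' :=
  closure_minimal (fun x hx => by_contra fun h' => hx (h x h')) isClosed_Icc

lemma hasCompactSupport (h : IsBump a b ψ) : HasCompactSupport ψ := by
  obtain ⟨-, a', b', h1, h2, h3, h4⟩ := h
  exact isCompact_Icc.of_isClosed_subset (isClosed_tsupport _) (tsupport_subset_Icc h4)

lemma tsupport_subset (h : IsBump a b ψ) : tsupport ψ ⊆ Ioo a b := by
  obtain ⟨-, a', b', h1, h2, h3, h4⟩ := h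
  exact (tsupport_subset_Icc h4).trans fun x hx => ⟨h1.trans_le hx.1, hx.2.trans_lt h3⟩

lemma eq_zero (h : IsBump a b ψ) {x : ℝ} (hx : x ∉ Ioo a b) : ψ x = 0 := by
  obtain ⟨-, a', b', h1, h2, h3, h4⟩ := h
  exact h4 x fun h' => hx ⟨h1.trans_le h'.1, h'.2.trans_lt h3⟩

lemma sub_const_mul (h : IsBump a b ψ) (k : IsBump a b χ) (m : ℝ) :
    IsBump a b (fun x => ψ x - m * χ x) := by
  refine of_tsupport ?_ (h.1.sub (contDiff_const.mul k.1))
    (h.hasCompactSupport.sub (k.hasCompactSupport.mul_left (f := fun _ => m))) ?_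
  · obtain ⟨-, a', b', h1, h2, h3, h4⟩ := h
    linarith
  · refine (tsupport_sub ψ (fun x => m * χ x)).trans (union_subset h.tsupport_subset ?_)
    exact (tsupport_mul_subset_right (f := fun _ => m) (g := χ)).trans k.tsupport_subset

lemma integral_Ioo (h : IsBump a b ψ) : ∫ x in Ioo a b, ψ x = ∫ x, ψ x :=
  setIntegral_eq_integral_of_forall_compl_eq_zero fun _ hx => h.eq_zero hx

/-- The primitive of a bump function with mean zero is a bump function. -/
lemma primitive (h : IsBump a b ψ) (h0 : ∫ x in Ioo a b, ψ x = 0) :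
    IsBump a b (fun x => ∫ y in a..x, ψ y) := by
  have hz := h.integral_Ioo
  have hc := h.1.continuous
  obtain ⟨hd, a', b', h1, h2, h3, h4⟩ := h
  refine ⟨(contDiff_primitive hd a).1, a', b', h1, h2, h3, fun x hx => ?_⟩
  rcases lt_or_ge x a' with hxa | hxa
  · simp only
    rw [intervalIntegral.integral_congr (g := fun _ => (0 : ℝ))]
    · simp
    · intro y hy
      refine h4 y fun hy' => ?_
      rcases le_total a x with hax | hax
      · rw [uIcc_of_le hax] at hy; linarith [hy.2, hy'.1]
      · rw [uIcc_of_ge hax] at hy; linarith [hy.2, hy'.1]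
  · have hxb : b' < x := by
      by_contra hcon
      exact hx ⟨hxa, not_lt.1 hcon⟩
    have e1 : ∫ y in a..x, ψ y = ∫ y, ψ y := by
      rw [intervalIntegral.integral_of_le (by linarith)]
      refine setIntegral_eq_integral_of_forall_compl_eq_zero fun y hy => h4 y fun hy' => hy ?_
      exact ⟨h1.trans_le hy'.1, hy'.2.trans hxb.le⟩
    simp only [e1, ← hz, h0]

lemma exists_integral_eq_one (hab : a < b) :
    ∃ ρ, IsBump a b ρ ∧ ∫ x in Ioo a b, ρ x = 1 ∧ ∀ x, 0 ≤ ρ x := by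
  let φ : ContDiffBump ((a + b) / 2) :=
    ⟨(b - a) / 8, (b - a) / 4, by linarith, by linarith⟩
  have hs : tsupport (φ.normed volume) ⊆ Ioo a b := by
    rw [φ.tsupport_normed_eq, Real.closedBall_eq_Icc]
    intro x hx
    have h1 : φ.rOut = (b - a) / 4 := rfl
    rw [h1] at hx
    exact ⟨by linarith [hx.1], by linarith [hx.2]⟩
  have hb := of_tsupport hab (φ.contDiff_normed (μ := volume)) φ.hasCompactSupport_normed hs
  exact ⟨_, hb, by rw [hb.integral_Ioo, φ.integral_normed], φ.nonneg_normed⟩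

lemma hasL2Deriv (h : IsBump a b ψ) : HasL2Deriv ψ (deriv ψ) := by
  refine (IsPrimitive.of_contDiff zero_le_one (h.1.of_le (by simp))).hasL2Deriv ?_
  have hc : Continuous (deriv ψ) := h.1.continuous_deriv (by simp)
  obtain ⟨C, hC⟩ := (isCompact_Icc (a := (0 : ℝ)) (b := 1)).exists_bound_of_continuousOn
    hc.continuousOn
  exact memLp_two_of_ae_bound hc.aestronglyMeasurable C ((ae_restrict_iff' measurableSet_Ioo).2
    (.of_forall fun x hx => hC x (Ioo_subset_Icc_self hx))) 2

end IsBump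

/-- The lemma of du Bois-Reymond. -/
lemma ae_eq_const_of_integral_mul_deriv_eq_zero {a b : ℝ} (hab : a < b) {H : ℝ → ℝ}
    (hH : IntegrableOn H (Ioo a b))
    (h : ∀ ψ : ℝ → ℝ, IsBump a b ψ → ∫ x in Ioo a b, H x * deriv ψ x = 0) :
    ∃ c, ∀ᵐ x ∂volume.restrict (Ioo a b), H x = c := by
  obtain ⟨ρ₀, hρ₀, hρ₀1, -⟩ := IsBump.exists_integral_eq_one hab
  have him : ∀ ρ, IsBump a b ρ → IntegrableOn (fun x => H x * ρ x) (Ioo a b) := fun ρ hρ => by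
    obtain ⟨C, hC⟩ := hρ.hasCompactSupport.exists_bound_of_continuous hρ.1.continuous
    exact Integrable.mul_bdd hH hρ.1.continuous.aestronglyMeasurable (.of_forall hC)
  have hi : ∀ ρ, IsBump a b ρ → IntegrableOn ρ (Ioo a b) := fun ρ hρ =>
    (hρ.1.continuous.integrable_of_hasCompactSupport hρ.hasCompactSupport).integrableOn
  refine ⟨∫ x in Ioo a b, H x * ρ₀ x, ?_⟩
  set c := ∫ x in Ioo a b, H x * ρ₀ x
  have hl : LocallyIntegrableOn (fun x => H x - c) (Ioo a b) :=
    (hH.sub (integrableOn_const (by simp))).locallyIntegrableOn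
  have := isOpen_Ioo.ae_eq_zero_of_integral_contDiff_smul_eq_zero hl fun ρ h1 h2 h3 => ?_
  · refine (ae_restrict_iff' measurableSet_Ioo).2 ?_
    filter_upwards [this] with x hx hx'
    linarith [hx hx']
  have hρ := IsBump.of_tsupport hab h1 h2 h3
  set m := ∫ x in Ioo a b, ρ x
  -- Subtracting `m ρ₀` makes the mean zero, so that the primitive is again a bump and the
  -- hypothesis applies to it.
  have hd := hρ.sub_const_mul hρ₀ m
  have hd0 : ∫ x in Ioo a b, (ρ x - m * ρ₀ x) = 0 := by
    rw [integral_sub (hi _ hρ) ((hi _ hρ₀).const_mul m), integral_const_mul, hρ₀1]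
    simp [m]
  have h4 := h _ (hd.primitive hd0)
  simp only [((contDiff_primitive hd.1 a).2 _).deriv] at h4
  have h5 : ∫ x in Ioo a b, H x * (ρ x - m * ρ₀ x) = (∫ x in Ioo a b, H x * ρ x) - m * c := by
    rw [← integral_const_mul, ← integral_sub (him _ hρ) ((him _ hρ₀).const_mul m)]
    congr 1; funext x; ring
  have h6 : ∫ x in Ioo a b, ρ x • (H x - c) = (∫ x in Ioo a b, H x * ρ x) - c * m := by
    rw [← integral_const_mul, ← integral_sub (him _ hρ) ((hi _ hρ).const_mul c)]
    congr 1; funext x; simp only [smul_eq_mul]; ring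
  rw [← setIntegral_eq_integral_of_forall_compl_eq_zero (s := Ioo a b)
    (fun x hx => by rw [hρ.eq_zero hx, zero_smul]), h6]
  linarith

/-- `U` minus the primitive of `F` has zero weak derivative and is constant by du Bois-Reymond. Test
functions that vanish near `t = 0` suffice because `U` is continuous up to zero, which fixes the
constant. -/
lemma eq_primitive_of_weak {T : ℝ} (hT : 0 < T) {U F : ℝ → ℝ} (hU : ContinuousOn U (Icc 0 T))
    (hF : IntegrableOn F (Ioo 0 T))
    (h : ∀ θ : ℝ → ℝ, IsBump 0 T θ →
      ∫ t in Ioo 0 T, (deriv θ t * U t + θ t * F t) = 0) :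
    ∀ t ∈ Icc 0 T, U t = U 0 + ∫ s in (0 : ℝ)..t, F s := by
  set W : ℝ → ℝ := fun t => U 0 + ∫ s in (0 : ℝ)..t, F s with hW
  have hWp : IsPrimitive 0 T W F :=
    ⟨(intervalIntegrable_iff_integrableOn_Ioo_of_le hT.le).2 hF, fun x _ => by simp [hW]⟩
  have hWc : ContinuousOn W (Icc 0 T) := hWp.continuousOn hT.le
  have hiC : ∀ g : ℝ → ℝ, ContinuousOn g (Icc 0 T) → IntegrableOn g (Ioo 0 T) := fun g hg =>
    (hg.integrableOn_compact isCompact_Icc).mono_set Ioo_subset_Icc_self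
  have key : ∀ θ : ℝ → ℝ, IsBump 0 T θ →
      ∫ t in Ioo 0 T, (U t - W t) * deriv θ t = 0 := by
    intro θ hθ
    have hθ' : Continuous (deriv θ) := hθ.1.continuous_deriv (by simp)
    have hθp : IsPrimitive 0 T θ (deriv θ) := IsPrimitive.of_contDiff hT.le (hθ.1.of_le (by simp))
    have h1 := (hθp.mul hT.le hWp).integral_eq hT.le
    have hi1 := (hθp.mul hT.le hWp).1
    rw [intervalIntegral.integral_of_le hT.le, integral_Ioc_eq_integral_Ioo,
      hθ.eq_zero (x := T) (by simp), hθ.eq_zero (x := 0) (by simp)] at h1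
    rw [intervalIntegrable_iff_integrableOn_Ioo_of_le hT.le] at hi1
    have hi2 : IntegrableOn (fun t => (U t - W t) * deriv θ t) (Ioo 0 T) :=
      hiC _ ((hU.sub hWc).mul hθ'.continuousOn)
    have h2 := h θ hθ
    have h3 : ∫ t in Ioo 0 T, (deriv θ t * U t + θ t * F t)
        = (∫ t in Ioo 0 T, (U t - W t) * deriv θ t)
          + ∫ t in Ioo 0 T, (deriv θ t * W t + θ t * F t) := by
      rw [← integral_add hi2 hi1]
      congr 1; funext t; ring
    rw [h3, h1] at h2
    linarith
  obtain ⟨c, hc⟩ := ae_eq_const_of_integral_mul_deriv_eq_zero hT (hiC _ (hU.sub hWc))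
    key
  have hall : EqOn (fun t => U t - W t) (fun _ => c) (Icc 0 T) := by
    refine Measure.eqOn_Icc_of_ae_eq volume hT.ne ?_ (hU.sub hWc) continuousOn_const
    rw [← restrict_Ioo_eq_restrict_Icc]
    exact hc
  have hc0 : c = 0 := by
    have := hall (left_mem_Icc.2 hT.le)
    simp only [hW, intervalIntegral.integral_same, add_zero, sub_self] at this
    exact this.symm
  intro t ht
  have := hall ht
  simp only [hc0] at this
  linarith

/-- The 1-periodic extension of a bump function. -/
lemma IsBump.contDiff_fract {ψ : ℝ → ℝ} (h : IsBump 0 1 ψ) :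
    ContDiff ℝ ∞ (fun x => ψ (Int.fract x)) := by
  refine contDiff_iff_contDiffAt.2 fun x₀ => ?_
  -- Near `x₀` at most two translates of `ψ` are visible, one on each side of the integer `⌊x₀⌋`,
  -- and at each point one of them vanishes.
  have h1 : ContDiffAt ℝ ∞ (fun y => ψ (y - ⌊x₀⌋) + ψ (y - ⌊x₀⌋ + 1)) x₀ := by
    have := h.1
    fun_prop
  refine h1.congr_of_eventuallyEq ?_
  have hm : Ioo ((⌊x₀⌋ : ℝ) - 1) (⌊x₀⌋ + 1) ∈ 𝓝 x₀ :=
    Ioo_mem_nhds (by linarith [Int.floor_le x₀]) (Int.lt_floor_add_one x₀)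
  filter_upwards [hm] with y hy
  rcases le_or_gt (⌊x₀⌋ : ℝ) y with hy' | hy'
  · have : ⌊y⌋ = ⌊x₀⌋ := Int.floor_eq_iff.2 ⟨hy', hy.2⟩
    rw [Int.fract, this, h.eq_zero (x := y - ⌊x₀⌋ + 1) (fun hx => by linarith [hx.2]), add_zero]
  · have : ⌊y⌋ = ⌊x₀⌋ - 1 :=
      Int.floor_eq_iff.2 ⟨by push_cast; linarith [hy.1], by push_cast; linarith⟩
    rw [Int.fract, this, h.eq_zero (x := y - ⌊x₀⌋) (fun hx => by linarith [hx.1]), zero_add]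
    congr 1; push_cast; ring

lemma IsBump.isTest_periodic {T : ℝ} {θ ψ : ℝ → ℝ} (hθ : IsBump 0 T θ) (hψ : ContDiff ℝ ∞ ψ)
    (hp : ∀ x, ψ (x + 1) = ψ x) :
    BoundaryCondition.periodic.IsTest T (fun t x => θ t * ψ x) := by
  refine ⟨?_, fun t x => by simp only [hp], ?_⟩
  · have := hθ.1
    fun_prop
  · obtain ⟨-, a', b', h1, h2, h3, h4⟩ := hθ
    refine ⟨(b' + T) / 2, by linarith, fun t ht x => ?_⟩
    simp only [h4 t fun h => by linarith [h.2], zero_mul]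

lemma IsBump.isTest_dirichlet {T : ℝ} {gL gR : ℝ → ℝ} {θ ψ : ℝ → ℝ} (hθ : IsBump 0 T θ)
    (hψ : IsBump 0 1 ψ) :
    (BoundaryCondition.dirichlet gL gR).IsTest T (fun t x => θ t * ψ x) := by
  have hsub : Function.support (fun p : ℝ × ℝ => θ p.1 * ψ p.2) ⊆ tsupport θ ×ˢ tsupport ψ := by
    intro p hp
    have hp' : θ p.1 * ψ p.2 ≠ 0 := hp
    exact ⟨subset_tsupport _ (left_ne_zero_of_mul hp'),
      subset_tsupport _ (right_ne_zero_of_mul hp')⟩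
  refine ⟨?_, ?_, ?_⟩
  · have := hθ.1
    have := hψ.1
    fun_prop
  · exact HasCompactSupport.of_support_subset_isCompact
      (hθ.hasCompactSupport.isCompact.prod hψ.hasCompactSupport.isCompact) hsub
  · refine (closure_minimal hsub ((isClosed_tsupport _).prod (isClosed_tsupport _))).trans ?_
    exact prod_mono (fun t ht => (hθ.tsupport_subset ht).2) hψ.tsupport_subset

lemma integral_cylinder {T : ℝ} {g : ℝ × ℝ → ℝ} (hg : Integrable g (cylinderMeasure T)) :
    ∫ p in Ioo 0 T ×ˢ Ioo (0 : ℝ) 1, g p = ∫ t in Ioo 0 T, ∫ x in Ioo (0 : ℝ) 1, g (t, x) := by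
  change ∫ p, g p ∂cylinderMeasure T = _
  rw [cylinderMeasure_eq_prod] at hg ⊢
  exact integral_prod _ hg

section Mild

variable {bc : BoundaryCondition} {T ε : ℝ} {f A : ℝ → ℝ} {u ux : ℝ → ℝ → ℝ}

/-- The flux `f(u) - ε A(u) ∂_x u`. -/
def totalFlux (ε : ℝ) (f A : ℝ → ℝ) (u ux : ℝ → ℝ → ℝ) (t x : ℝ) : ℝ :=
  f (u t x) - ε * (A (u t x) * ux t x)

/-- The weak formulation for a fixed test function in space. -/
lemma IsWeakSolution.integral_eq_of_isTest (hT : 0 < T) (hw : IsWeaklyContinuous T u)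
    (hub : MemLp (fun p : ℝ × ℝ => u p.1 p.2) 2 (cylinderMeasure T))
    (hFl : MemLp (fun p : ℝ × ℝ => totalFlux ε f A u ux p.1 p.2) 2 (cylinderMeasure T))
    (h : IsWeakSolution bc T ε f A (u 0) u ux) {ψ : ℝ → ℝ} (hψ : ContDiff ℝ ∞ ψ)
    (htest : ∀ θ, IsBump 0 T θ → bc.IsTest T (fun t x => θ t * ψ x)) {t : ℝ} (ht : t ∈ Icc 0 T) :
    ∫ x in Ioo (0 : ℝ) 1, u t x * ψ x = (∫ x in Ioo (0 : ℝ) 1, u 0 x * ψ x)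
      + ∫ s in (0 : ℝ)..t, ∫ x in Ioo (0 : ℝ) 1, totalFlux ε f A u ux s x * deriv ψ x := by
  have hL2 : ∀ g : ℝ → ℝ, Continuous g → MemLp g 2 spaceMeasure := fun g hg => by
    obtain ⟨C, hC⟩ := (isCompact_Icc (a := (0 : ℝ)) (b := 1)).exists_bound_of_continuousOn
      hg.continuousOn
    exact memLp_two_of_ae_bound hg.aestronglyMeasurable C
      ((ae_restrict_iff' measurableSet_Ioo).2
        (.of_forall fun x hx => hC x (Ioo_subset_Icc_self hx))) 2
  have hψ' : Continuous (deriv ψ) := hψ.continuous_deriv (by simp)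
  have hsnd : ∀ g : ℝ → ℝ, Continuous g → MemLp (fun p : ℝ × ℝ => g p.2) 2 (cylinderMeasure T) :=
    fun g hg => by
      rw [cylinderMeasure_eq_prod]; exact (hL2 g hg).comp_snd _
  have i1 : Integrable (fun p : ℝ × ℝ => u p.1 p.2 * ψ p.2) (cylinderMeasure T) :=
    integrable_fun_mul hub (hsnd ψ hψ.continuous)
  have i2 : Integrable (fun p : ℝ × ℝ => totalFlux ε f A u ux p.1 p.2 * deriv ψ p.2)
      (cylinderMeasure T) := integrable_fun_mul hFl (hsnd _ hψ')
  have i2' := i2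
  rw [cylinderMeasure_eq_prod] at i2'
  refine eq_primitive_of_weak hT (hw.2 ψ (hL2 ψ hψ.continuous)) i2'.integral_prod_left ?_ t ht
  intro θ hθ
  have h1 := h _ (htest θ hθ)
  have hbd : ∀ g : ℝ → ℝ, Continuous g → HasCompactSupport g → ∀ k : ℝ × ℝ → ℝ,
      Integrable k (cylinderMeasure T) →
      Integrable (fun p : ℝ × ℝ => g p.1 * k p) (cylinderMeasure T) := fun g hg hgc k hk => by
    obtain ⟨C, hC⟩ := hgc.exists_bound_of_continuous hg
    exact hk.bdd_mul (hg.comp continuous_fst).aestronglyMeasurable (.of_forall fun p => hC p.1)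
  have j1 := hbd _ (hθ.1.continuous_deriv (by simp)) hθ.hasCompactSupport.deriv _ i1
  have j2 := hbd _ hθ.1.continuous hθ.hasCompactSupport _ i2
  have e : (fun p : ℝ × ℝ => deriv (fun s => θ s * ψ p.2) p.1 * u p.1 p.2
          + deriv (fun x => θ p.1 * ψ x) p.2
            * (f (u p.1 p.2) - ε * (A (u p.1 p.2) * ux p.1 p.2)))
      = fun p => deriv θ p.1 * (u p.1 p.2 * ψ p.2)
        + θ p.1 * (totalFlux ε f A u ux p.1 p.2 * deriv ψ p.2) := by
    funext p
    rw [deriv_mul_const ((hθ.1.differentiable (by simp)) _), deriv_const_mul_field]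
    simp only [totalFlux]; ring
  have j12 : Integrable (fun p : ℝ × ℝ => deriv θ p.1 * (u p.1 p.2 * ψ p.2)
      + θ p.1 * (totalFlux ε f A u ux p.1 p.2 * deriv ψ p.2)) (cylinderMeasure T) := j1.add j2
  rw [e, integral_cylinder j12] at h1
  -- The initial term drops out since `θ 0 = 0`; the initial datum re-enters through the weak
  -- continuity of `u`.
  simp only [hθ.eq_zero (x := 0) (by simp), zero_mul, mul_zero, integral_zero, add_zero] at h1
  refine Eq.trans (integral_congr_ae ?_) h1
  rw [cylinderMeasure_eq_prod] at j1 j2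
  filter_upwards [j1.prod_right_ae, j2.prod_right_ae] with s h2 h3
  rw [integral_add h2 h3, integral_const_mul, integral_const_mul]

/-- No density of smooth functions in `H¹` is needed. Let `D = u t - u s`, `Y` its primitive and `G`
the time integral of the flux. Testing with bumps shows that `G + Y` has zero weak derivative, so it
is constant, and this identity between functions can be integrated against any `φ'` in `L²`. -/
theorem IsWeakSolution.isMild (hT : 0 < T) (hw : IsWeaklyContinuous T u)
    (hub : MemLp (fun p : ℝ × ℝ => u p.1 p.2) 2 (cylinderMeasure T))
    (hFl : MemLp (fun p : ℝ × ℝ => totalFlux ε f A u ux p.1 p.2) 2 (cylinderMeasure T))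
    (h : IsWeakSolution bc T ε f A (u 0) u ux) :
    IsMild bc T u (totalFlux ε f A u ux) (fun _ _ => 0) := by
  intro s t hs hst htT φ φ' hφ hφbc
  have ht : t ∈ Icc 0 T := ⟨hs.trans hst, htT⟩
  have hs' : s ∈ Icc 0 T := ⟨hs, hst.trans htT⟩
  simp only [zero_mul, sub_zero]
  set Fl := totalFlux ε f A u ux with hFldef
  have hsubm : (volume.restrict (Ioo s t)).prod spaceMeasure ≤ cylinderMeasure T := by
    rw [cylinderMeasure_eq_prod, spaceMeasure, Measure.prod_restrict, Measure.prod_restrict]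
    exact Measure.restrict_mono (prod_mono (Ioo_subset_Ioo hs htT) le_rfl) le_rfl
  have hFl' := hFl.mono_measure hsubm
  have hFli := hFl'.integrable (by norm_num)
  have hprod : ∀ g : ℝ → ℝ, MemLp g 2 spaceMeasure →
      Integrable (fun p : ℝ × ℝ => Fl p.1 p.2 * g p.2)
      ((volume.restrict (Ioo s t)).prod spaceMeasure) := fun g hg =>
    integrable_fun_mul hFl' (hg.comp_snd _)
  set G : ℝ → ℝ := fun x => ∫ r in Ioo s t, Fl r x with hG
  have hGi : Integrable G spaceMeasure := hFli.integral_prod_right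
  have hGmul : ∀ g : ℝ → ℝ, MemLp g 2 spaceMeasure →
      ∫ r in s..t, ∫ x in Ioo (0 : ℝ) 1, Fl r x * g x = ∫ x in Ioo (0 : ℝ) 1, G x * g x := by
    intro g hg
    rw [intervalIntegral.integral_of_le hst, integral_Ioc_eq_integral_Ioo,
      integral_integral_swap (hprod g hg)]
    simp only [hG, integral_mul_const]
  have hDm : MemLp (fun x => u t x - u s x) 2 spaceMeasure := (hw.1 t ht).sub (hw.1 s hs')
  have hDi := hDm.integrable (by norm_num)
  set D : ℝ → ℝ := fun x => u t x - u s x with hD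
  set Y : ℝ → ℝ := fun x => ∫ y in (0 : ℝ)..x, D y with hY
  have hYd : HasL2Deriv Y D := ⟨hDm, fun x _ => by simp [hY]⟩
  have hdiff : ∀ ψ : ℝ → ℝ, ContDiff ℝ ∞ ψ → MemLp ψ 2 spaceMeasure →
      MemLp (deriv ψ) 2 spaceMeasure →
      (∀ θ, IsBump 0 T θ → bc.IsTest T (fun t x => θ t * ψ x)) →
      ∫ x in Ioo (0 : ℝ) 1, D x * ψ x = ∫ x in Ioo (0 : ℝ) 1, G x * deriv ψ x := by
    intro ψ hψ hψ2 hψ2' htest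
    have h1 := h.integral_eq_of_isTest hT hw hub hFl hψ htest ht
    have h2 := h.integral_eq_of_isTest hT hw hub hFl hψ htest hs'
    rw [← hGmul _ hψ2']
    simp only [hD, sub_mul]
    rw [integral_sub (integrable_fun_mul (hw.1 t ht) hψ2) (integrable_fun_mul (hw.1 s hs') hψ2),
      h1, h2]
    have hi : ∀ r ∈ Icc 0 T, IntervalIntegrable
        (fun s => ∫ x in Ioo (0 : ℝ) 1, Fl s x * deriv ψ x) volume 0 r := by
      intro r hr
      rw [intervalIntegrable_iff_integrableOn_Ioo_of_le hr.1]
      have h3 : Integrable (fun p : ℝ × ℝ => Fl p.1 p.2 * deriv ψ p.2)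
          ((volume.restrict (Ioo 0 T)).prod spaceMeasure) := by
        rw [cylinderMeasure_eq_prod] at hFl
        exact integrable_fun_mul hFl (hψ2'.comp_snd _)
      exact IntegrableOn.mono_set h3.integral_prod_left (Ioo_subset_Ioo_right hr.2)
    rw [← intervalIntegral.integral_interval_sub_left (hi t ht) (hi s hs')]
    ring
  have hbump : ∀ ψ : ℝ → ℝ, IsBump 0 1 ψ →
      ∫ x in Ioo (0 : ℝ) 1, D x * ψ x = ∫ x in Ioo (0 : ℝ) 1, G x * deriv ψ x := by
    intro ψ hψ
    cases bc with
    | dirichlet gL gR =>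
      exact hdiff ψ hψ.1 hψ.hasL2Deriv.memLp hψ.hasL2Deriv.1 fun θ hθ => hθ.isTest_dirichlet hψ
    -- The bump is not periodic, but its 1-periodic extension is admissible and agrees with it on
    -- `(0, 1)`.
    | periodic =>
      have hfr : ∀ x ∈ Ioo (0 : ℝ) 1, Int.fract x = x := fun x hx =>
        Int.fract_eq_self.2 ⟨hx.1.le, hx.2⟩
      have e1 : ∀ x ∈ Ioo (0 : ℝ) 1, ψ (Int.fract x) = ψ x := fun x hx => by rw [hfr x hx]
      have e2 : ∀ x ∈ Ioo (0 : ℝ) 1, deriv (fun x => ψ (Int.fract x)) x = deriv ψ x := fun x hx =>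
        Filter.EventuallyEq.deriv_eq (by
          filter_upwards [Ioo_mem_nhds hx.1 hx.2] with y hy using e1 y hy)
      have a1 : ψ =ᵐ[spaceMeasure] fun x => ψ (Int.fract x) :=
        (ae_restrict_iff' measurableSet_Ioo).2 (.of_forall fun x hx => (e1 x hx).symm)
      have a2 : deriv ψ =ᵐ[spaceMeasure] deriv (fun x => ψ (Int.fract x)) :=
        (ae_restrict_iff' measurableSet_Ioo).2 (.of_forall fun x hx => (e2 x hx).symm)
      have := hdiff _ hψ.contDiff_fract ((memLp_congr_ae a1).1 hψ.hasL2Deriv.memLp)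
        ((memLp_congr_ae a2).1 hψ.hasL2Deriv.1)
        fun θ hθ => hθ.isTest_periodic hψ.contDiff_fract fun x => by simp
      have b1 : ∫ x in Ioo (0 : ℝ) 1, D x * ψ (Int.fract x) = ∫ x in Ioo (0 : ℝ) 1, D x * ψ x :=
        setIntegral_congr_fun measurableSet_Ioo fun x hx => by simp only [e1 x hx]
      have b2 : ∫ x in Ioo (0 : ℝ) 1, G x * deriv (fun x => ψ (Int.fract x)) x
          = ∫ x in Ioo (0 : ℝ) 1, G x * deriv ψ x :=
        setIntegral_congr_fun measurableSet_Ioo fun x hx => by simp only [e2 x hx]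
      rw [← b1, ← b2, this]
  have hYi : Integrable Y spaceMeasure := hYd.memLp.integrable (by norm_num)
  -- Integration by parts moves `D` to `-Y` without boundary terms, as bumps vanish at both ends.
  obtain ⟨c, hc⟩ := ae_eq_const_of_integral_mul_deriv_eq_zero (H := fun x => G x + Y x)
    zero_lt_one (hGi.add hYi) fun ψ hψ => by
      have h1 := hYd.integral_mul_deriv hψ.hasL2Deriv
      rw [hψ.eq_zero (x := 1) (by simp), hψ.eq_zero (x := 0) (by simp), mul_zero, mul_zero,
        integral_add (integrable_fun_mul hDm hψ.hasL2Deriv.memLp)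
          (integrable_fun_mul hYd.memLp hψ.hasL2Deriv.1), hbump ψ hψ] at h1
      simp only [add_mul]
      rw [integral_add ?_ (integrable_fun_mul hYd.memLp hψ.hasL2Deriv.1)]
      · linarith
      · obtain ⟨C, hC⟩ := hψ.hasCompactSupport.deriv.exists_bound_of_continuous
          (hψ.1.continuous_deriv (by simp))
        exact hGi.mul_bdd (hψ.1.continuous_deriv (by simp)).aestronglyMeasurable (.of_forall hC)
  have h1 := hYd.integral_mul_deriv hφ
  have hYφ := integrable_fun_mul hYd.memLp hφ.1
  have hφi := hφ.1.integrable (by norm_num)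
  have h2 : ∫ x in Ioo (0 : ℝ) 1, G x * φ' x
      = c * (φ 1 - φ 0) - ∫ x in Ioo (0 : ℝ) 1, Y x * φ' x := by
    rw [← hφ.integral_deriv, ← integral_const_mul, ← integral_sub (hφi.const_mul c) hYφ]
    refine integral_congr_ae ?_
    filter_upwards [hc] with x hx
    have : G x = c - Y x := by linarith
    rw [this]; ring
  have hY0 : Y 0 = 0 := by simp [hY]
  -- Boundary terms vanish with `φ` in the Dirichlet case. In the periodic case the constant test
  -- function shows that mass is conserved, that is `Y 1 = 0`.
  have h3 : Y 1 * φ 1 = 0 ∧ φ 1 - φ 0 = 0 := by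
    cases bc with
    | dirichlet gL gR => rw [hφbc.1, hφbc.2]; simp
    | periodic =>
      have hφ01 : φ 0 = φ 1 := hφbc
      have := hdiff (fun _ => 1) contDiff_const (memLp_const _) (by simp)
        fun θ hθ => hθ.isTest_periodic contDiff_const fun _ => rfl
      simp only [mul_one, deriv_const', mul_zero, integral_zero] at this
      rw [hY]
      simp only
      rw [intervalIntegral_eq_spaceMeasure, this, hφ01]
      simp
  rw [hGmul _ hφ.1, h2, h3.2, ← sub_eq_zero]
  rw [integral_add (integrable_fun_mul hDm hφ.memLp) hYφ, hY0, h3.1] at h1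
  linarith

end Mild

/-! ### Broken polynomials -/

lemma hasDerivAt_polyEval {n : ℕ} (c : Fin n → ℝ) (x : ℝ) :
    HasDerivAt (polyEval c) (polyDeriv c x) x := by
  have : HasDerivAt (fun x => ∑ k : Fin n, c k * x ^ (k : ℕ))
      (∑ k : Fin n, c k * (((k : ℕ) : ℝ) * x ^ ((k : ℕ) - 1))) x :=
    HasDerivAt.fun_sum fun k _ => (hasDerivAt_pow (k : ℕ) x).const_mul (c k)
  have e : polyDeriv c x = ∑ k : Fin n, c k * (((k : ℕ) : ℝ) * x ^ ((k : ℕ) - 1)) := by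
    simp only [polyDeriv, mul_assoc]
  rw [e]; exact this

lemma continuous_polyEval {n : ℕ} (c : Fin n → ℝ) : Continuous (polyEval c) := by
  unfold polyEval; fun_prop

lemma continuous_polyDeriv {n : ℕ} (c : Fin n → ℝ) : Continuous (polyDeriv c) := by
  unfold polyDeriv; fun_prop

namespace Partition

lemma exists_mem_Ico {n : ℕ} {a b : ℝ} (X : Partition n a b) {x : ℝ} (hx : x ∈ Ico a b) :
    ∃ j : Fin n, x ∈ Ico (X.z j.castSucc) (X.z j.succ) := by
  have h : ∀ k : Fin (n + 1), x < X.z k → ∃ j : Fin n, x ∈ Ico (X.z j.castSucc) (X.z j.succ) := by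
    intro k
    induction k using Fin.induction with
    | zero => intro h; rw [X.first] at h; exact absurd hx.1 (not_le.2 h)
    | succ j ih =>
      intro h
      rcases lt_or_ge x (X.z j.castSucc) with h' | h'
      · exact ih h'
      · exact ⟨j, h', h⟩
  exact h (Fin.last n) (by rw [X.final]; exact hx.2)

lemma mem_Icc {n : ℕ} {a b : ℝ} (X : Partition n a b) (k : Fin (n + 1)) : X.z k ∈ Icc a b := by
  constructor
  · exact X.first.symm.trans_le (X.strictMono.monotone (Fin.zero_le k))
  · exact (X.strictMono.monotone (Fin.le_last k)).trans X.final.le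

lemma z_lt {n : ℕ} {a b : ℝ} (X : Partition n a b) (j : Fin n) :
    X.z j.castSucc < X.z j.succ := X.strictMono Fin.castSucc_lt_succ

lemma index_unique {n : ℕ} {a b : ℝ} (X : Partition n a b) {x : ℝ} {i j : Fin n}
    (hi : x ∈ Ico (X.z i.castSucc) (X.z i.succ)) (hj : x ∈ Ico (X.z j.castSucc) (X.z j.succ)) :
    i = j := by
  by_contra hne
  rcases lt_or_gt_of_ne hne with h | h
  · have := X.strictMono.monotone (Fin.succ_le_castSucc_iff.2 h)
    linarith [hi.2, hj.1]
  · have := X.strictMono.monotone (Fin.succ_le_castSucc_iff.2 h)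
    linarith [hj.2, hi.1]

variable {M n : ℕ} (X : Partition M 0 1)

lemma eval_of_mem (v : Broken M n) {j : Fin M} {x : ℝ}
    (hx : x ∈ Ico (X.z j.castSucc) (X.z j.succ)) : X.eval v x = polyEval (v j) x := by
  rw [eval, Finset.sum_eq_single j, indicator_of_mem hx]
  · intro i _ hij
    exact indicator_of_notMem (fun hi => hij (X.index_unique hi hx)) _
  · simp

lemma evalDeriv_of_mem (v : Broken M n) {j : Fin M} {x : ℝ}
    (hx : x ∈ Ico (X.z j.castSucc) (X.z j.succ)) : X.evalDeriv v x = polyDeriv (v j) x := by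
  rw [evalDeriv, Finset.sum_eq_single j, indicator_of_mem hx]
  · intro i _ hij
    exact indicator_of_notMem (fun hi => hij (X.index_unique hi hx)) _
  · simp

/-- The function `x ^ k` on the `j`-th element, continued by zero. -/
noncomputable def mono (j : Fin M) (k : Fin n) (x : ℝ) : ℝ :=
  (Ico (X.z j.castSucc) (X.z j.succ)).indicator (fun x => x ^ (k : ℕ)) x

/-- The elementwise derivative of `mono`. -/
noncomputable def monoDeriv (j : Fin M) (k : Fin n) (x : ℝ) : ℝ :=
  (Ico (X.z j.castSucc) (X.z j.succ)).indicator (fun x => ((k : ℕ) : ℝ) * x ^ ((k : ℕ) - 1)) x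

/-- Splitting into coefficients times fixed functions of `x` reduces measurability, bounds and
linearity in space-time to statements about the coefficients. -/
lemma eval_eq_sum (v : Broken M n) (x : ℝ) : X.eval v x = ∑ j, ∑ k, v j k * X.mono j k x := by
  refine Finset.sum_congr rfl fun j _ => ?_
  by_cases hx : x ∈ Ico (X.z j.castSucc) (X.z j.succ)
  · simp [mono, polyEval, indicator_of_mem hx]
  · simp [mono, indicator_of_notMem hx]

lemma evalDeriv_eq_sum (v : Broken M n) (x : ℝ) :
    X.evalDeriv v x = ∑ j, ∑ k, v j k * X.monoDeriv j k x := by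
  refine Finset.sum_congr rfl fun j _ => ?_
  by_cases hx : x ∈ Ico (X.z j.castSucc) (X.z j.succ)
  · simp [monoDeriv, polyDeriv, indicator_of_mem hx, mul_assoc]
  · simp [monoDeriv, indicator_of_notMem hx]

lemma measurable_mono (j : Fin M) (k : Fin n) : Measurable (X.mono j k) :=
  Measurable.indicator (by fun_prop) measurableSet_Ico

lemma measurable_monoDeriv (j : Fin M) (k : Fin n) : Measurable (X.monoDeriv j k) :=
  Measurable.indicator (by fun_prop) measurableSet_Ico

lemma abs_mono_le (j : Fin M) (k : Fin n) (x : ℝ) : |X.mono j k x| ≤ 1 := by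
  by_cases hx : x ∈ Ico (X.z j.castSucc) (X.z j.succ)
  · have h0 := (X.mem_Icc j.castSucc).1.trans hx.1
    have h1 := hx.2.le.trans (X.mem_Icc j.succ).2
    rw [mono, indicator_of_mem hx, abs_of_nonneg (by positivity)]
    exact pow_le_one₀ h0 h1
  · simp [mono, indicator_of_notMem hx]

lemma abs_monoDeriv_le (j : Fin M) (k : Fin n) (x : ℝ) : |X.monoDeriv j k x| ≤ n := by
  by_cases hx : x ∈ Ico (X.z j.castSucc) (X.z j.succ)
  · have h0 := (X.mem_Icc j.castSucc).1.trans hx.1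
    have h1 := hx.2.le.trans (X.mem_Icc j.succ).2
    rw [monoDeriv, indicator_of_mem hx, abs_of_nonneg (by positivity)]
    have hk : ((k : ℕ) : ℝ) ≤ n := by exact_mod_cast k.2.le
    calc ((k : ℕ) : ℝ) * x ^ ((k : ℕ) - 1) ≤ n * 1 := by
          gcongr
          exact pow_le_one₀ h0 h1
      _ = n := mul_one _
  · simp [monoDeriv, indicator_of_notMem hx]

lemma abs_coeff_le (v : Broken M n) (j : Fin M) (k : Fin n) : |v j k| ≤ ‖v‖ := by
  have h1 := norm_le_pi_norm v j
  have h2 := norm_le_pi_norm (v j) k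
  rw [Real.norm_eq_abs] at h2
  exact h2.trans h1

lemma abs_eval_le (v : Broken M n) (x : ℝ) : |X.eval v x| ≤ M * (n * ‖v‖) := by
  rw [eval_eq_sum]
  calc |∑ j, ∑ k, v j k * X.mono j k x| ≤ ∑ j : Fin M, ∑ k : Fin n, ‖v‖ := by
        refine (Finset.abs_sum_le_sum_abs _ _).trans (Finset.sum_le_sum fun j _ =>
          (Finset.abs_sum_le_sum_abs _ _).trans (Finset.sum_le_sum fun k _ => ?_))
        rw [abs_mul]
        exact (mul_le_mul (abs_coeff_le v j k) (X.abs_mono_le j k x) (abs_nonneg _)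
          (norm_nonneg _)).trans (mul_one _).le
    _ = M * (n * ‖v‖) := by simp

lemma abs_evalDeriv_le (v : Broken M n) (x : ℝ) :
    |X.evalDeriv v x| ≤ M * (n * (‖v‖ * n)) := by
  rw [evalDeriv_eq_sum]
  calc |∑ j, ∑ k, v j k * X.monoDeriv j k x| ≤ ∑ j : Fin M, ∑ k : Fin n, ‖v‖ * n := by
        refine (Finset.abs_sum_le_sum_abs _ _).trans (Finset.sum_le_sum fun j _ =>
          (Finset.abs_sum_le_sum_abs _ _).trans (Finset.sum_le_sum fun k _ => ?_))
        rw [abs_mul]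
        exact mul_le_mul (abs_coeff_le v j k) (X.abs_monoDeriv_le j k x) (abs_nonneg _)
          (norm_nonneg _)
    _ = M * (n * (‖v‖ * n)) := by simp

lemma measurable_eval (v : Broken M n) : Measurable (X.eval v) := by
  rw [show X.eval v = fun x => ∑ j, ∑ k, v j k * X.mono j k x from funext (X.eval_eq_sum v)]
  exact Finset.measurable_fun_sum _ fun j _ => Finset.measurable_fun_sum _ fun k _ =>
    (X.measurable_mono j k).const_mul _

lemma measurable_evalDeriv (v : Broken M n) : Measurable (X.evalDeriv v) := by
  rw [show X.evalDeriv v = fun x => ∑ j, ∑ k, v j k * X.monoDeriv j k x from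
    funext (X.evalDeriv_eq_sum v)]
  exact Finset.measurable_fun_sum _ fun j _ => Finset.measurable_fun_sum _ fun k _ =>
    (X.measurable_monoDeriv j k).const_mul _

lemma memLp_eval (v : Broken M n) (p : ℝ≥0∞) : MemLp (X.eval v) p spaceMeasure :=
  memLp_two_of_ae_bound (X.measurable_eval v).aestronglyMeasurable _
    (.of_forall (X.abs_eval_le v)) p

lemma memLp_evalDeriv (v : Broken M n) (p : ℝ≥0∞) : MemLp (X.evalDeriv v) p spaceMeasure :=
  memLp_two_of_ae_bound (X.measurable_evalDeriv v).aestronglyMeasurable _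
    (.of_forall (X.abs_evalDeriv_le v)) p

/-- `v` is continuous with the values `g k` at the nodes. -/
def HasNodeValues (v : Broken M n) (g : Fin (M + 1) → ℝ) : Prop :=
  ∀ j : Fin M, X.leftVal v j = g j.castSucc ∧ X.rightVal v j = g j.succ

lemma intervalIntegrable_evalDeriv (v : Broken M n) (a b : ℝ) :
    IntervalIntegrable (X.evalDeriv v) volume a b := by
  refine (intervalIntegrable_const (c := (M * (n * (‖v‖ * n)) : ℝ))).mono_fun
    (X.measurable_evalDeriv v).aestronglyMeasurable (.of_forall fun x => ?_)
  rw [Real.norm_eq_abs]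
  exact (X.abs_evalDeriv_le v x).trans (le_abs_self _)

lemma integral_evalDeriv (v : Broken M n) (j : Fin M) {x : ℝ}
    (hx : x ∈ Icc (X.z j.castSucc) (X.z j.succ)) :
    ∫ y in (X.z j.castSucc)..x, X.evalDeriv v y
      = polyEval (v j) x - polyEval (v j) (X.z j.castSucc) := by
  rw [← intervalIntegral.integral_eq_sub_of_hasDerivAt (f := polyEval (v j))
    (f' := polyDeriv (v j)) (fun y _ => hasDerivAt_polyEval (v j) y)
    ((continuous_polyDeriv (v j)).intervalIntegrable _ _)]
  rw [intervalIntegral.integral_of_le hx.1, intervalIntegral.integral_of_le hx.1,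
    integral_Ioc_eq_integral_Ioo, integral_Ioc_eq_integral_Ioo]
  exact setIntegral_congr_fun measurableSet_Ioo fun y hy =>
    X.evalDeriv_of_mem v ⟨hy.1.le, hy.2.trans_le hx.2⟩

/-- The primitive of the elementwise derivative of `v`; if `v` is continuous, this is its continuous
representative on `[0,1]`. -/
noncomputable def contRep [NeZero M] (v : Broken M n) (x : ℝ) : ℝ :=
  X.leftVal v 0 + ∫ y in (0 : ℝ)..x, X.evalDeriv v y

variable [NeZero M]

lemma hasL2Deriv_contRep (v : Broken M n) : HasL2Deriv (X.contRep v) (X.evalDeriv v) :=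
  ⟨X.memLp_evalDeriv v 2, fun x _ => by simp [contRep]⟩

/-- One element at a time: `hj` is the induction hypothesis with which `contRep_node` proceeds from
the left end of an element to its right end. -/
lemma contRep_of_mem {v : Broken M n} {g : Fin (M + 1) → ℝ} (hv : X.HasNodeValues v g)
    (j : Fin M) {x : ℝ} (hx : x ∈ Icc (X.z j.castSucc) (X.z j.succ))
    (hj : X.contRep v (X.z j.castSucc) = g j.castSucc) :
    X.contRep v x = polyEval (v j) x := by
  have h1 := X.integral_evalDeriv v j hx
  have h2 : X.contRep v x = X.contRep v (X.z j.castSucc)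
      + ∫ y in (X.z j.castSucc)..x, X.evalDeriv v y := by
    rw [contRep, contRep, add_assoc, intervalIntegral.integral_add_adjacent_intervals
      (X.intervalIntegrable_evalDeriv v _ _) (X.intervalIntegrable_evalDeriv v _ _)]
  rw [h2, h1, hj, ← (hv j).1, leftVal]
  ring

lemma contRep_node {v : Broken M n} {g : Fin (M + 1) → ℝ} (hv : X.HasNodeValues v g)
    (k : Fin (M + 1)) : X.contRep v (X.z k) = g k := by
  induction k using Fin.induction with
  | zero =>
    rw [X.first, contRep, intervalIntegral.integral_same, add_zero, (hv 0).1]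
    congr 1
  | succ j ih =>
    rw [X.contRep_of_mem hv j (right_mem_Icc.2 (X.z_lt j).le) ih]
    exact (hv j).2

lemma contRep_zero {v : Broken M n} {g : Fin (M + 1) → ℝ} (hv : X.HasNodeValues v g) :
    X.contRep v 0 = g 0 := by
  rw [← X.contRep_node hv 0, X.first]

lemma contRep_one {v : Broken M n} {g : Fin (M + 1) → ℝ} (hv : X.HasNodeValues v g) :
    X.contRep v 1 = g (Fin.last M) := by
  rw [← X.contRep_node hv, X.final]

lemma contRep_eq_eval {v : Broken M n} {g : Fin (M + 1) → ℝ} (hv : X.HasNodeValues v g)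
    {x : ℝ} (hx : x ∈ Ico (0 : ℝ) 1) : X.contRep v x = X.eval v x := by
  obtain ⟨j, hj⟩ := X.exists_mem_Ico hx
  rw [X.contRep_of_mem hv j (Ico_subset_Icc_self hj) (X.contRep_node hv _), X.eval_of_mem v hj]

end Partition

/-! ### Lipschitz continuity of the reconstruction in time -/

lemma lipschitzOnWith_Icc_union {E : Type*} [PseudoMetricSpace E] {g : ℝ → E} {a b c : ℝ}
    {K L : ℝ≥0} (hg : LipschitzOnWith K g (Icc a b)) (hg' : LipschitzOnWith L g (Icc b c)) :
    LipschitzOnWith (max K L) g (Icc a c) := by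
  have key : ∀ x ∈ Icc a c, ∀ y ∈ Icc a c, x ≤ y → dist (g x) (g y) ≤ max K L * dist x y := by
    intro x hx y hy hxy
    rcases le_total y b with h | h
    · exact (hg.weaken (le_max_left K L)).dist_le_mul x ⟨hx.1, hxy.trans h⟩ y ⟨hy.1, h⟩
    rcases le_total b x with h' | h'
    · exact (hg'.weaken (le_max_right K L)).dist_le_mul x ⟨h', hx.2⟩ y ⟨h, hy.2⟩
    · have h1 := (hg.weaken (le_max_left K L)).dist_le_mul x ⟨hx.1, h'⟩ b ⟨hx.1.trans h', le_rfl⟩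
      have h2 := (hg'.weaken (le_max_right K L)).dist_le_mul b ⟨le_rfl, h.trans hy.2⟩ y ⟨h, hy.2⟩
      refine (dist_triangle _ (g b) _).trans ((add_le_add h1 h2).trans (le_of_eq ?_))
      rw [← mul_add, Real.dist_eq, Real.dist_eq, Real.dist_eq, abs_of_nonpos (by linarith),
        abs_of_nonpos (by linarith), abs_of_nonpos (by linarith)]
      ring
  refine LipschitzOnWith.of_dist_le_mul fun x hx y hy => ?_
  rcases le_total x y with h | h
  · exact key x hx y hy h
  · rw [dist_comm, dist_comm x]; exact key y hy x hx h

lemma Partition.exists_lipschitzOnWith {N : ℕ} {a b : ℝ} (τ : Partition N a b) {E : Type*}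
    [PseudoMetricSpace E] {g : ℝ → E}
    (h : ∀ n : Fin N, ∃ K, LipschitzOnWith K g (Icc (τ.z n.castSucc) (τ.z n.succ))) :
    ∃ K, LipschitzOnWith K g (Icc a b) := by
  have key : ∀ k : Fin (N + 1), ∃ K, LipschitzOnWith K g (Icc a (τ.z k)) := by
    intro k
    induction k using Fin.induction with
    | zero =>
      rw [τ.first, Icc_self]
      exact ⟨0, LipschitzOnWith.of_dist_le_mul fun x hx y hy => by simp_all⟩
    | succ n ih =>
      obtain ⟨K, hK⟩ := ih
      obtain ⟨L, hL⟩ := h n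
      exact ⟨_, lipschitzOnWith_Icc_union hK hL⟩
  have := key (Fin.last N)
  rwa [τ.final] at this

/-- `g` is Lipschitz continuous on `[0,T]`. -/
def LipOn {E : Type*} [PseudoMetricSpace E] (T : ℝ) (g : ℝ → E) : Prop :=
  ∃ K, LipschitzOnWith K g (Icc 0 T)

namespace LipOn

variable {T : ℝ}

lemma continuousOn {E : Type*} [PseudoMetricSpace E] {g : ℝ → E} (h : LipOn T g) :
    ContinuousOn g (Icc 0 T) := h.choose_spec.continuousOn

lemma clm {E : Type*} [NormedAddCommGroup E] [NormedSpace ℝ E] [FiniteDimensional ℝ E]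
    {F : Type*} [NormedAddCommGroup F] [NormedSpace ℝ F]
    {g : ℝ → E} (h : LipOn T g) (L : E →ₗ[ℝ] F) : LipOn T (fun t => L (g t)) := by
  obtain ⟨K, hK⟩ := h
  exact ⟨_, (LinearMap.toContinuousLinearMap L).lipschitz.comp_lipschitzOnWith hK⟩

lemma comp_locallyLipschitz {w : ℝ → ℝ → ℝ} (hw : LocallyLipschitz fun p : ℝ × ℝ => w p.1 p.2)
    {g k : ℝ → ℝ} (hg : LipOn T g) (hk : LipOn T k) : LipOn T (fun t => w (g t) (k t)) := by
  obtain ⟨K, hK⟩ := hg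
  obtain ⟨L, hL⟩ := hk
  have hp : LipschitzOnWith (max K L) (fun t => (g t, k t)) (Icc 0 T) := hK.prodMk hL
  have hc : IsCompact ((fun t => (g t, k t)) '' Icc 0 T) :=
    isCompact_Icc.image_of_continuousOn hp.continuousOn
  obtain ⟨D, hD⟩ := LocallyLipschitzOn.exists_lipschitzOnWith_of_compact hc hw.locallyLipschitzOn
  exact ⟨_, hD.comp hp (mapsTo_image _ _)⟩

lemma pi {ι : Type*} [Fintype ι] {E : ι → Type*} [∀ i, PseudoMetricSpace (E i)]
    {g : ℝ → ∀ i, E i} (h : ∀ i, LipOn T (fun t => g t i)) : LipOn T g := by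
  choose K hK using h
  refine ⟨∑ i, K i, LipschitzOnWith.of_dist_le_mul fun x hx y hy => ?_⟩
  rw [dist_pi_le_iff (by positivity)]
  intro i
  refine ((hK i).dist_le_mul x hx y hy).trans ?_
  gcongr
  exact Finset.single_le_sum (f := K) (fun _ _ => bot_le) (Finset.mem_univ i)

lemma prodMk {E F : Type*} [PseudoMetricSpace E] [PseudoMetricSpace F] {g : ℝ → E} {k : ℝ → F}
    (h : LipOn T g) (h' : LipOn T k) : LipOn T (fun t => (g t, k t)) :=
  ⟨_, h.choose_spec.prodMk h'.choose_spec⟩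

lemma congr {E : Type*} [PseudoMetricSpace E] {g k : ℝ → E} (h : LipOn T g)
    (hgk : ∀ t ∈ Icc 0 T, g t = k t) : LipOn T k := by
  obtain ⟨K, hK⟩ := h
  exact ⟨K, LipschitzOnWith.of_dist_le_mul fun x hx y hy => by
    rw [← hgk x hx, ← hgk y hy]; exact hK.dist_le_mul x hx y hy⟩

end LipOn

/-- The value of a polynomial at a point, as a linear functional of its coefficients. -/
noncomputable def polyEvalLin (n : ℕ) (x : ℝ) : (Fin n → ℝ) →ₗ[ℝ] ℝ where
  toFun c := polyEval c x
  map_add' c d := by simp [polyEval, add_mul, Finset.sum_add_distrib]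
  map_smul' m c := by simp [polyEval, mul_assoc, Finset.mul_sum]

lemma LipOn.polyEval {T : ℝ} {M n : ℕ} {g : ℝ → Broken M n} (h : LipOn T g) (j : Fin M) (x : ℝ) :
    LipOn T (fun t => polyEval (g t j) x) :=
  h.clm ((polyEvalLin n x).comp (LinearMap.proj j))

section Reconstruction

variable {M N q : ℕ} [NeZero M] {T ε : ℝ} {bc : BoundaryCondition} {X : Partition M 0 1}
  {τ : Partition N 0 T} {w : ℝ → ℝ → ℝ} {f : ℝ → ℝ} {F : ℝ → ℝ → ℝ → ℝ}
  {Ah : ℝ → Broken M (q + 1) → Broken M (q + 1)}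
  {uh : Fin (N + 1) → Broken M (q + 1)} {ut : ℝ → Broken M (q + 1)} {uts : ℝ → Broken M (q + 2)}

/-- Cubics are Lipschitz on each closed time step, and the closed steps share their end points, so
the pieces can be glued. -/
lemma IsTemporalReconstruction.lipOn
    (h : IsTemporalReconstruction bc X τ f F ε Ah uh ut) : LipOn T ut := by
  refine τ.exists_lipschitzOnWith fun n => ?_
  obtain ⟨c, hc⟩ := (h n).1
  have hd : ContDiff ℝ 1 (fun t : ℝ => ∑ k : Fin 4, (t ^ (k : ℕ)) • c k) := by fun_prop
  obtain ⟨K, hK⟩ := hd.contDiffOn.exists_lipschitzOnWith (by decide)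
    (convex_Icc (τ.z n.castSucc) (τ.z n.succ)) isCompact_Icc
  exact ⟨K, LipschitzOnWith.of_dist_le_mul fun x hx y hy => by
    rw [hc x hx, hc y hy]; exact hK.dist_le_mul x hx y hy⟩

lemma LipOn.traceMinus (hbc : bc.LipschitzData T) (h : LipOn T ut) (k : Fin (M + 1)) :
    LipOn T (fun t => bc.traceMinus X t (ut t) k) := by
  induction k using Fin.cases with
  | zero =>
    cases bc with
    | periodic => exact h.polyEval _ _
    | dirichlet gL gR => exact hbc.1
  | succ j =>
    simp only [BoundaryCondition.traceMinus, Fin.cons_succ]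
    exact h.polyEval _ _

lemma LipOn.tracePlus (hbc : bc.LipschitzData T) (h : LipOn T ut) (k : Fin (M + 1)) :
    LipOn T (fun t => bc.tracePlus X t (ut t) k) := by
  induction k using Fin.lastCases with
  | last =>
    simp only [BoundaryCondition.tracePlus, Fin.snoc_last]
    cases bc with
    | periodic => exact h.polyEval _ _
    | dirichlet gL gR => exact hbc.2
  | cast j =>
    simp only [BoundaryCondition.tracePlus, Fin.snoc_castSucc]
    exact h.polyEval _ _

lemma LipOn.nodeValue (hw : LocallyLipschitz fun p : ℝ × ℝ => w p.1 p.2)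
    (hbc : bc.LipschitzData T) (h : LipOn T ut) (k : Fin (M + 1)) :
    LipOn T (fun t => nodeValue bc X w t (ut t) k) := by
  cases bc with
  | periodic =>
    exact (h.traceMinus hbc k).comp_locallyLipschitz hw (h.tracePlus hbc k)
  | dirichlet gL gR =>
    simp only [RKdG.nodeValue]
    split_ifs
    · exact hbc.1
    · exact hbc.2
    · exact (h.traceMinus hbc k).comp_locallyLipschitz hw (h.tracePlus hbc k)

end Reconstruction

/-! ### Unisolvence of moments and end point values; Lipschitz continuity of the space-time
reconstruction. -/

section Moments

variable {M : ℕ} {T : ℝ} (X : Partition M 0 1)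

lemma Partition.memLp_mono {n : ℕ} (j : Fin M) (k : Fin n) (p : ℝ≥0∞) :
    MemLp (X.mono j k) p spaceMeasure :=
  memLp_two_of_ae_bound (X.measurable_mono j k).aestronglyMeasurable _
    (.of_forall (X.abs_mono_le j k)) p

/-- The linear functional `v ↦ ∫ v φ` on broken polynomials. -/
noncomputable def evalInner {n : ℕ} {φ : ℝ → ℝ} (hφ : MemLp φ 2 spaceMeasure) :
    Broken M n →ₗ[ℝ] ℝ where
  toFun v := ∫ x in Ioo (0 : ℝ) 1, X.eval v x * φ x
  map_add' v v' := by
    rw [← integral_add (integrable_fun_mul (X.memLp_eval v 2) hφ)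
      (integrable_fun_mul (X.memLp_eval v' 2) hφ)]
    congr 1; funext x
    simp only [Partition.eval_eq_sum, Pi.add_apply, add_mul, Finset.sum_add_distrib]
  map_smul' m v := by
    simp only [RingHom.id_apply, smul_eq_mul]
    rw [← integral_const_mul]
    congr 1; funext x
    simp only [Partition.eval_eq_sum, Pi.smul_apply, smul_eq_mul, Finset.mul_sum,
      Finset.sum_mul, mul_assoc]

/-- The moments of a broken polynomial against the monomials of degree less than `m`. -/
noncomputable def moments (m n : ℕ) : Broken M n →ₗ[ℝ] Broken M m :=
  LinearMap.pi fun j => LinearMap.pi fun k => evalInner X (X.memLp_mono (n := m) j k 2)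

/-- On an element a polynomial that vanishes at both ends is `(x - a)(x - b) r` with `deg r < q`.
Then `r` is an admissible test polynomial, and `∫ (x - a)(b - x) r² = 0` forces `r = 0`. -/
lemma eq_zero_of_moments_eq_zero {q : ℕ} {v : Broken M (q + 2)} (hm : moments X q (q + 2) v = 0)
    (hl : ∀ j, X.leftVal v j = 0) (hr : ∀ j, X.rightVal v j = 0) : v = 0 := by
  open Polynomial in
  funext j
  set a := X.z j.castSucc with ha
  set b := X.z j.succ with hb
  have hab : a < b := X.z_lt j
  set p : ℝ[X] := ∑ k : Fin (q + 2), C (v j k) * Polynomial.X ^ (k : ℕ) with hp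
  have hpe : ∀ x, p.eval x = polyEval (v j) x := fun x => by
    simp [hp, polyEval, eval_finsetSum]
  have hdeg : p.degree < ((q + 2 : ℕ) : WithBot ℕ) := degree_sum_fin_lt _
  suffices hp0 : p = 0 by
    funext k
    have hc : p.coeff (k : ℕ) = v j k := by
      simp only [hp, finsetSum_coeff, coeff_C_mul, coeff_X_pow]
      rw [Finset.sum_eq_single k]
      · simp
      · intro i _ hik
        rw [if_neg (fun h => hik (Fin.ext h.symm)), mul_zero]
      · simp
    rw [← hc, hp0]; simp
  obtain ⟨p₁, hp₁⟩ := dvd_iff_isRoot.2 (show p.IsRoot a by rw [IsRoot, hpe]; exact hl j)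
  have hroot : p₁.IsRoot b := by
    have h1 : p.eval b = 0 := by rw [hpe]; exact hr j
    rw [hp₁, eval_mul, eval_sub, eval_X, eval_C] at h1
    exact (mul_eq_zero.1 h1).resolve_left (by linarith)
  obtain ⟨r, hr'⟩ := dvd_iff_isRoot.2 hroot
  by_contra hp0
  have hr0 : r ≠ 0 := fun h => hp0 (by rw [hp₁, hr', h]; simp)
  have hnat : r.natDegree < q := by
    have h1 : p.natDegree < q + 2 := (natDegree_lt_iff_degree_lt hp0).2 hdeg
    rw [hp₁, hr', natDegree_mul (X_sub_C_ne_zero a) (mul_ne_zero (X_sub_C_ne_zero b) hr0),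
      natDegree_mul (X_sub_C_ne_zero b) hr0, natDegree_X_sub_C, natDegree_X_sub_C] at h1
    omega
  have hpr : ∀ x, polyEval (v j) x = (x - a) * ((x - b) * r.eval x) := fun x => by
    rw [← hpe, hp₁, hr']; simp
  -- The moments of `v` on this element, combined with the coefficients of `r`, give the integral of
  -- `v r`.
  have hint : ∫ x in a..b, (x - a) * (b - x) * r.eval x ^ 2 = 0 := by
    have h1 : ∑ k : Fin q, r.coeff k * moments X q (q + 2) v j k = 0 := by simp [hm]
    have h2 : ∑ k : Fin q, r.coeff k * moments X q (q + 2) v j k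
        = ∫ x in Ioo (0 : ℝ) 1, ∑ k : Fin q, r.coeff k * (X.eval v x * X.mono j k x) := by
      rw [integral_finsetSum _ fun k _ =>
        (integrable_fun_mul (X.memLp_eval v 2) (X.memLp_mono j k 2)).const_mul _]
      refine Finset.sum_congr rfl fun k _ => ?_
      rw [integral_const_mul]; rfl
    have h3 : ∀ x, ∑ k : Fin q, r.coeff k * (X.eval v x * X.mono j k x)
        = (Ico a b).indicator (fun x => -((x - a) * (b - x) * r.eval x ^ 2)) x := by
      intro x
      by_cases hx : x ∈ Ico a b
      · rw [indicator_of_mem hx, X.eval_of_mem v hx, hpr, eval_eq_sum_range' hnat,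
          Finset.sum_range]
        simp only [Partition.mono, ← ha, ← hb, indicator_of_mem hx]
        have : ∀ k : Fin q, r.coeff k * ((x - a) * ((x - b) *
            ∑ i : Fin q, r.coeff i * x ^ (i : ℕ)) * x ^ (k : ℕ))
            = ((x - a) * ((x - b) * ∑ i : Fin q, r.coeff i * x ^ (i : ℕ)))
              * (r.coeff k * x ^ (k : ℕ)) := fun k => by ring
        simp only [this]
        rw [← Finset.mul_sum]
        ring
      · simp [Partition.mono, ← ha, ← hb, indicator_of_notMem hx]
    rw [h2] at h1
    simp only [h3] at h1
    have hsub : Ioo a b ⊆ Ioo 0 1 :=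
      Ioo_subset_Ioo (X.mem_Icc j.castSucc).1 (X.mem_Icc j.succ).2
    rw [setIntegral_indicator measurableSet_Ico] at h1
    have hset : (Ioo 0 1 ∩ Ico a b : Set ℝ) =ᵐ[volume] Ioo a b := by
      have h4 : (Ico a b : Set ℝ) =ᵐ[volume] Ioo a b := Ioo_ae_eq_Ico.symm
      have h5 := (ae_eq_refl (Ioo (0 : ℝ) 1)).inter h4
      rwa [inter_eq_self_of_subset_right hsub] at h5
    rw [setIntegral_congr_set hset, integral_neg, neg_eq_zero] at h1
    rw [intervalIntegral.integral_of_le hab.le, integral_Ioc_eq_integral_Ioo, h1]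
  obtain ⟨c, hc, hc0⟩ : ∃ c ∈ Ioo a b, r.eval c ≠ 0 := by
    by_contra hcon
    push Not at hcon
    exact hr0 (eq_zero_of_infinite_isRoot r ((Ioo_infinite hab).mono fun c hc => hcon c hc))
  -- A nonzero polynomial has only finitely many roots, so the nonnegative integrand is positive at
  -- some interior point `c`.
  have hpos := intervalIntegral.integral_pos (f := fun x => (x - a) * (b - x) * r.eval x ^ 2) hab
    (by fun_prop) (fun x hx => mul_nonneg (mul_nonneg (by linarith [hx.1]) (by linarith [hx.2]))
      (sq_nonneg _)) ⟨c, Ioo_subset_Icc_self hc, mul_pos (mul_pos (by linarith [hc.1])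
        (by linarith [hc.2])) (by positivity)⟩
  linarith

/-- Moments and end point values, as a linear map. -/
noncomputable def momentsAndValues (q : ℕ) :
    Broken M (q + 2) →ₗ[ℝ] Broken M q × (Fin M → ℝ) × (Fin M → ℝ) :=
  (moments X q (q + 2)).prod
    ((LinearMap.pi fun j => (polyEvalLin _ (X.z j.castSucc)).comp (LinearMap.proj j)).prod
      (LinearMap.pi fun j => (polyEvalLin _ (X.z j.succ)).comp (LinearMap.proj j)))

lemma ker_momentsAndValues (q : ℕ) : LinearMap.ker (momentsAndValues X q) = ⊥ := by
  refine LinearMap.ker_eq_bot'.2 fun v hv => ?_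
  have h1 : moments X q (q + 2) v = 0 := congrArg Prod.fst hv
  have h2 := congrArg (fun p => p.2.1) hv
  have h3 := congrArg (fun p => p.2.2) hv
  exact eq_zero_of_moments_eq_zero X h1 (fun j => congrFun h2 j) (fun j => congrFun h3 j)

lemma Partition.eval_single (X : Partition M 0 1) {n : ℕ} (j : Fin M) (k : Fin n) :
    X.eval (Pi.single j (Pi.single k 1) : Broken M n) = X.mono j k := by
  funext x
  rw [X.eval_eq_sum, Finset.sum_eq_single j, Finset.sum_eq_single k]
  · simp
  · intro i _ hi; simp [hi]
  · simp
  · intro i _ hi; simp [hi]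
  · simp

variable {X} {q : ℕ} [NeZero M] {bc : BoundaryCondition} {w : ℝ → ℝ → ℝ}
  {ut : ℝ → Broken M (q + 1)} {uts : ℝ → Broken M (q + 2)}

/-- An injective linear map on a finite-dimensional space is antilipschitz, so it is enough that
moments and node values are Lipschitz. The moments are those of `ut`, and the node values come from
`w` and the boundary data. -/
theorem IsSpaceTimeReconstruction.lipOn (h : IsSpaceTimeReconstruction bc X T w ut uts)
    (hut : LipOn T ut) (hw : LocallyLipschitz fun p : ℝ × ℝ => w p.1 p.2)
    (hbc : bc.LipschitzData T) : LipOn T uts := by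
  obtain ⟨C, hC, hanti⟩ :=
    (momentsAndValues X q).exists_antilipschitzWith (ker_momentsAndValues X q)
  have h1 : LipOn T (fun t => momentsAndValues X q (uts t)) := by
    refine LipOn.prodMk (LipOn.congr (hut.clm (moments X q (q + 1))) fun t ht => ?_)
      (LipOn.prodMk (LipOn.pi fun j => ?_) (LipOn.pi fun j => ?_))
    · funext j k
      -- A basis vector as test function turns the orthogonality relation into the equality of one
      -- moment.
      have := (h t ht).1 (Pi.single j (Pi.single k 1))
      rw [X.eval_single] at this
      simp only [sub_mul] at this
      rw [integral_sub (integrable_fun_mul (X.memLp_eval _ 2) (X.memLp_mono j k 2))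
        (integrable_fun_mul (X.memLp_eval _ 2) (X.memLp_mono j k 2)), sub_eq_zero] at this
      exact this.symm
    · exact (hut.nodeValue (X := X) hw hbc j.castSucc).congr fun t ht => ((h t ht).2 j).1.symm
    · exact (hut.nodeValue (X := X) hw hbc j.succ).congr fun t ht => ((h t ht).2 j).2.symm
  obtain ⟨K, hK⟩ := h1
  refine ⟨C * K, LipschitzOnWith.of_dist_le_mul fun x hx y hy => ?_⟩
  have h2 := hanti.le_mul_dist (uts x) (uts y)
  have h3 := hK.dist_le_mul x hx y hy
  calc dist (uts x) (uts y) ≤ C * dist (momentsAndValues X q (uts x))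
        (momentsAndValues X q (uts y)) := h2
    _ ≤ C * (K * dist x y) := by gcongr
    _ = _ := by push_cast; ring

end Moments

/-! ### Space-time functions with values in a space of broken polynomials -/

section SpaceTime

variable {M n : ℕ} {T : ℝ} (X : Partition M 0 1) {g : ℝ → Broken M n}

lemma memLp_top_coeff_mul {c m : ℝ → ℝ} {C D : ℝ}
    (hc : AEStronglyMeasurable c (volume.restrict (Ioo 0 T)))
    (hcb : ∀ᵐ t ∂volume.restrict (Ioo 0 T), |c t| ≤ C) (hm : Measurable m) (hmb : ∀ x, |m x| ≤ D) :
    MemLp (fun p : ℝ × ℝ => c p.1 * m p.2) ∞ (cylinderMeasure T) := by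
  rw [cylinderMeasure_eq_prod]
  have h1 : MemLp (fun p : ℝ × ℝ => c p.1) ∞ ((volume.restrict (Ioo 0 T)).prod spaceMeasure) :=
    (memLp_top_of_bound hc C hcb).comp_fst _
  have h2 : MemLp (fun p : ℝ × ℝ => m p.2) ∞ ((volume.restrict (Ioo 0 T)).prod spaceMeasure) :=
    (memLp_top_of_bound hm.aestronglyMeasurable D (.of_forall hmb)).comp_snd _
  exact h2.mul h1

/-- `g` is measurable and bounded on `(0,T)`. -/
def BddMeas (T : ℝ) (g : ℝ → Broken M n) : Prop :=
  AEStronglyMeasurable g (volume.restrict (Ioo 0 T)) ∧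
    ∃ C, ∀ᵐ t ∂volume.restrict (Ioo 0 T), ‖g t‖ ≤ C

lemma BddMeas.coeff (hg : BddMeas T g) (j : Fin M) (k : Fin n) :
    AEStronglyMeasurable (fun t => g t j k) (volume.restrict (Ioo 0 T)) :=
  (show Continuous fun v : Broken M n => v j k by fun_prop).comp_aestronglyMeasurable hg.1

lemma BddMeas.memLp_eval (hg : BddMeas T g) :
    MemLp (fun p : ℝ × ℝ => X.eval (g p.1) p.2) ∞ (cylinderMeasure T) := by
  obtain ⟨C, hC⟩ := hg.2
  simp only [Partition.eval_eq_sum]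
  refine memLp_finsetSum _ fun j _ => memLp_finsetSum _ fun k _ => ?_
  refine memLp_top_coeff_mul (C := C) (hg.coeff j k) ?_ (X.measurable_mono j k)
    (X.abs_mono_le j k)
  filter_upwards [hC] with t ht using (Partition.abs_coeff_le _ _ _).trans ht

lemma BddMeas.memLp_evalDeriv (hg : BddMeas T g) :
    MemLp (fun p : ℝ × ℝ => X.evalDeriv (g p.1) p.2) ∞ (cylinderMeasure T) := by
  obtain ⟨C, hC⟩ := hg.2
  simp only [Partition.evalDeriv_eq_sum]
  refine memLp_finsetSum _ fun j _ => memLp_finsetSum _ fun k _ => ?_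
  refine memLp_top_coeff_mul (C := C) (hg.coeff j k) ?_ (X.measurable_monoDeriv j k)
    (X.abs_monoDeriv_le j k)
  filter_upwards [hC] with t ht using (Partition.abs_coeff_le _ _ _).trans ht

lemma bddMeas_of_continuousOn (hg : ContinuousOn g (Icc 0 T)) : BddMeas T g := by
  refine ⟨(hg.mono Ioo_subset_Icc_self).aestronglyMeasurable measurableSet_Ioo, ?_⟩
  obtain ⟨C, hC⟩ := isCompact_Icc.exists_bound_of_continuousOn hg
  exact ⟨C, (ae_restrict_iff' measurableSet_Ioo).2
    (.of_forall fun t ht => hC t (Ioo_subset_Icc_self ht))⟩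

lemma LipOn.bddMeas_deriv (hg : LipOn T g) : BddMeas T (deriv g) := by
  obtain ⟨K, hK⟩ := hg
  refine ⟨(stronglyMeasurable_deriv g).aestronglyMeasurable, K, ?_⟩
  exact (ae_restrict_iff' measurableSet_Ioo).2 (.of_forall fun t ht =>
    norm_deriv_le_of_lipschitzOn (Icc_mem_nhds ht.1 ht.2) hK)

/-- Each of the finitely many coefficients is absolutely continuous, so one null set of times serves
them all. -/
lemma LipOn.ae_hasDerivAt (hg : LipOn T g) : ∀ᵐ t, t ∈ Ioo 0 T → HasDerivAt g (deriv g t) t := by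
  have h : ∀ j k, ∀ᵐ t, t ∈ Ioo 0 T → DifferentiableAt ℝ (fun t => g t j k) t := by
    intro j k
    rcases le_or_gt T 0 with hT | hT
    · exact .of_forall fun t ht => absurd (ht.1.trans ht.2) (not_lt.2 hT)
    obtain ⟨K, hK⟩ :=
      hg.clm ((LinearMap.proj k).comp (LinearMap.proj j : Broken M n →ₗ[ℝ] (Fin n → ℝ)))
    rw [← uIcc_of_le hT.le] at hK
    filter_upwards [hK.absolutelyContinuousOnInterval.ae_differentiableAt] with t ht ht'
    refine ht ?_
    rw [uIcc_of_le hT.le]; exact Ioo_subset_Icc_self ht'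
  have h' : ∀ᵐ t, ∀ j k, t ∈ Ioo 0 T → DifferentiableAt ℝ (fun t => g t j k) t :=
    ae_all_iff.2 fun j => ae_all_iff.2 fun k => h j k
  filter_upwards [h'] with t ht ht'
  exact (differentiableAt_pi.2 fun j => differentiableAt_pi.2 fun k => ht j k ht').hasDerivAt

lemma LipOn.integral_eval_sub (hg : LipOn T g) {φ : ℝ → ℝ} (hφ : MemLp φ 2 spaceMeasure)
    {s t : ℝ} (hs : 0 ≤ s) (hst : s ≤ t) (ht : t ≤ T) :
    ∫ x in Ioo (0 : ℝ) 1, (X.eval (g t) x - X.eval (g s) x) * φ x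
      = ∫ r in s..t, ∫ x in Ioo (0 : ℝ) 1, X.eval (deriv g r) x * φ x := by
  obtain ⟨K, hK⟩ := hg.clm (evalInner X hφ)
  have hac : AbsolutelyContinuousOnInterval (fun t => evalInner X hφ (g t)) s t :=
    (hK.mono (by rw [uIcc_of_le hst]; exact Icc_subset_Icc hs ht)).absolutelyContinuousOnInterval
  have h1 := (integral_eq_sub_of_absolutelyContinuous hst hac
    (f' := fun r => evalInner X hφ (deriv g r)) (by
      filter_upwards [hg.ae_hasDerivAt] with r hr hr'
      exact (LinearMap.toContinuousLinearMap (evalInner X hφ)).hasFDerivAt.comp_hasDerivAt r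
        (hr ⟨hs.trans_lt hr'.1, hr'.2.trans_le ht⟩))).2
  simp only [sub_mul]
  rw [integral_sub (integrable_fun_mul (X.memLp_eval _ 2) hφ)
    (integrable_fun_mul (X.memLp_eval _ 2) hφ)]
  exact h1.symm

lemma LipOn.eval_weaklyContinuous (hg : LipOn T g) :
    IsWeaklyContinuous T (fun t => X.eval (g t)) :=
  ⟨fun _ _ => X.memLp_eval _ 2, fun _ hφ => (hg.clm (evalInner X hφ)).continuousOn⟩

/-- The difference of a mild solution and a Lipschitz continuous broken polynomial. -/
lemma IsMild.sub_eval {bc : BoundaryCondition} {u P : ℝ → ℝ → ℝ} (hw : IsWeaklyContinuous T u)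
    (hP : MemLp (fun p : ℝ × ℝ => P p.1 p.2) 2 (cylinderMeasure T))
    (h : IsMild bc T u P (fun _ _ => 0)) (hg : LipOn T g) :
    IsMild bc T (fun t x => u t x - X.eval (g t) x) P (fun t x => X.eval (deriv g t) x) := by
  intro s t hs hst ht φ φ' hφ hφbc
  have h1 := h s t hs hst ht φ φ' hφ hφbc
  have h2 := hg.integral_eval_sub X hφ.memLp hs hst ht
  have hu : MemLp (fun x => u t x - u s x) 2 spaceMeasure :=
    (hw.1 t ⟨hs.trans hst, ht⟩).sub (hw.1 s ⟨hs, hst.trans ht⟩)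
  have hv : MemLp (fun x => X.eval (g t) x - X.eval (g s) x) 2 spaceMeasure :=
    (X.memLp_eval (g t) 2).sub (X.memLp_eval (g s) 2)
  have e : ∀ x, (u t x - X.eval (g t) x - (u s x - X.eval (g s) x)) * φ x
      = (u t x - u s x) * φ x - (X.eval (g t) x - X.eval (g s) x) * φ x := fun x => by ring
  simp only [e]
  rw [integral_sub (integrable_fun_mul hu hφ.memLp) (integrable_fun_mul hv hφ.memLp), h1, h2]
  simp only [zero_mul, sub_zero]
  have hsubm : (volume.restrict (Ioo s t)).prod spaceMeasure ≤ cylinderMeasure T := by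
    rw [cylinderMeasure_eq_prod, spaceMeasure, Measure.prod_restrict, Measure.prod_restrict]
    exact Measure.restrict_mono (prod_mono (Ioo_subset_Ioo hs ht) le_rfl) le_rfl
  have i1 := integrable_fun_mul (hP.mono_measure hsubm)
    (hφ.1.comp_snd (μ := volume.restrict (Ioo s t)))
  have i2 := integrable_fun_mul (((hg.bddMeas_deriv.memLp_eval X).mono_exponent
    (p := 2) le_top).mono_measure hsubm) (hφ.memLp.comp_snd (μ := volume.restrict (Ioo s t)))
  rw [← intervalIntegral.integral_sub
    ((intervalIntegrable_iff_integrableOn_Ioo_of_le hst).2 i1.integral_prod_left)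
    ((intervalIntegrable_iff_integrableOn_Ioo_of_le hst).2 i2.integral_prod_left)]
  rw [intervalIntegral.integral_of_le hst, intervalIntegral.integral_of_le hst,
    integral_Ioc_eq_integral_Ioo, integral_Ioc_eq_integral_Ioo]
  refine integral_congr_ae ?_
  filter_upwards [i1.prod_right_ae, i2.prod_right_ae] with r h3 h4
  exact (integral_sub h3 h4).symm

end SpaceTime

/-! ### The maximum principle -/

lemma exists_ae_bound {α : Type*} [MeasurableSpace α] {μ : Measure α} {g : α → ℝ}
    (hg : MemLp g ⊤ μ) : ∃ C, ∀ᵐ x ∂μ, |g x| ≤ C := by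
  refine ⟨(eLpNormEssSup g μ).toReal, ?_⟩
  have hfin : eLpNormEssSup g μ ≠ ⊤ := by
    have := hg.2.ne
    rwa [eLpNorm_exponent_top] at this
  filter_upwards [ae_le_eLpNormEssSup (f := g) (μ := μ)] with x hx
  have := ENNReal.toReal_mono hfin hx
  simpa using this

lemma MemLp.ae_section {T : ℝ} {g : ℝ → ℝ → ℝ}
    (hg : MemLp (fun p : ℝ × ℝ => g p.1 p.2) 2 (cylinderMeasure T)) :
    ∀ᵐ s ∂volume.restrict (Ioo 0 T), MemLp (g s) 2 spaceMeasure := by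
  rw [cylinderMeasure_eq_prod] at hg
  filter_upwards [hg.integrable_sq.prod_right_ae, hg.1.prodMk_left] with s h1 h2
  exact (memLp_two_iff_integrable_sq h2).2 h1

lemma MemLp.bdd_mul_of_top {α : Type*} [MeasurableSpace α] {μ : Measure α} {g k : α → ℝ}
    (hk : MemLp k ∞ μ) (hg : MemLp g 2 μ) : MemLp (fun x => k x * g x) 2 μ := hg.mul hk

/-- A nonnegative continuous function that vanishes exactly on `[a, b]`. -/
def excess (a b y : ℝ) : ℝ := max (y - b) 0 + max (a - y) 0

/-- The primitive of `excess a b`. -/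
noncomputable def excessPrim (a b y : ℝ) : ℝ := ∫ s in a..y, excess a b s

/-- A convex function that vanishes exactly on `[a, b]`. -/
noncomputable def excessEnergy (a b y : ℝ) : ℝ := ∫ s in a..y, excessPrim a b s

section Excess

variable {a b : ℝ}

lemma continuous_excess : Continuous (excess a b) := by unfold excess; fun_prop

lemma excess_nonneg (y : ℝ) : 0 ≤ excess a b y := add_nonneg (le_max_right _ _) (le_max_right _ _)

lemma excess_eq_zero {y : ℝ} (hy : y ∈ Icc a b) : excess a b y = 0 := by
  rw [excess, max_eq_right (by linarith [hy.2]), max_eq_right (by linarith [hy.1]), add_zero]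

lemma contDiff_one_primitive {g : ℝ → ℝ} (hg : Continuous g) (a : ℝ) :
    ContDiff ℝ 1 (fun y => ∫ s in a..y, g s) ∧ deriv (fun y => ∫ s in a..y, g s) = g := by
  have hd : deriv (fun y => ∫ s in a..y, g s) = g := funext fun y => hg.deriv_integral g a y
  refine ⟨contDiff_one_iff_deriv.2 ⟨fun y => ?_, by rwa [hd]⟩, hd⟩
  exact (intervalIntegral.integral_hasDerivAt_right (hg.intervalIntegrable _ _)
      (hg.stronglyMeasurableAtFilter _ _) hg.continuousAt).differentiableAt

lemma contDiff_excessPrim : ContDiff ℝ 1 (excessPrim a b) :=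
  (contDiff_one_primitive continuous_excess a).1

lemma deriv_excessPrim : deriv (excessPrim a b) = excess a b :=
  (contDiff_one_primitive continuous_excess a).2

lemma continuous_excessEnergy : Continuous (excessEnergy a b) :=
  (contDiff_one_primitive contDiff_excessPrim.continuous a).1.continuous

lemma integral_eq_zero_of_mem_Icc {g : ℝ → ℝ} (hg : ∀ y ∈ Icc a b, g y = 0) {y : ℝ}
    (hy : y ∈ Icc a b) : ∫ s in a..y, g s = 0 := by
  rw [intervalIntegral.integral_congr (g := fun _ => (0 : ℝ))]
  · simp
  · intro s hs
    rw [uIcc_of_le hy.1] at hs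
    exact hg s ⟨hs.1, hs.2.trans hy.2⟩

lemma excessPrim_eq_zero {y : ℝ} (hy : y ∈ Icc a b) : excessPrim a b y = 0 :=
  integral_eq_zero_of_mem_Icc (fun _ => excess_eq_zero) hy

lemma excessEnergy_eq_zero {y : ℝ} (hy : y ∈ Icc a b) : excessEnergy a b y = 0 :=
  integral_eq_zero_of_mem_Icc (fun _ => excessPrim_eq_zero) hy

lemma monotone_excessPrim : Monotone (excessPrim a b) :=
  monotone_of_deriv_nonneg (contDiff_excessPrim.differentiable (by norm_num))
    (by rw [deriv_excessPrim]; exact excess_nonneg)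

/-- The derivative `excessPrim` is monotone, so its integral from `x` to `y` lies above the tangent
value, on either side of `x`. -/
lemma excessEnergy_convex (x y : ℝ) :
    excessEnergy a b x + excessPrim a b x * (y - x) ≤ excessEnergy a b y := by
  have hc : Continuous (excessPrim a b) := contDiff_excessPrim.continuous
  have hi : ∀ c d, IntervalIntegrable (excessPrim a b) volume c d :=
    fun c d => hc.intervalIntegrable _ _
  have h1 : excessEnergy a b y - excessEnergy a b x = ∫ s in x..y, excessPrim a b s :=
    intervalIntegral.integral_interval_sub_left (hi _ _) (hi _ _)
  rcases le_total x y with h | h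
  · have := intervalIntegral.integral_mono_on h (intervalIntegrable_const (c := excessPrim a b x))
      (hi x y) fun s hs => monotone_excessPrim hs.1
    rw [intervalIntegral.integral_const, smul_eq_mul] at this
    linarith
  · have := intervalIntegral.integral_mono_on h (hi y x)
      (intervalIntegrable_const (c := excessPrim a b x)) fun s hs => monotone_excessPrim hs.2
    rw [intervalIntegral.integral_const, smul_eq_mul] at this
    rw [intervalIntegral.integral_symm] at h1
    linarith

lemma excessEnergy_nonneg (hab : a ≤ b) (y : ℝ) : 0 ≤ excessEnergy a b y := by
  have := excessEnergy_convex (a := a) (b := b) a y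
  rwa [excessEnergy_eq_zero (left_mem_Icc.2 hab), excessPrim_eq_zero (left_mem_Icc.2 hab), zero_mul,
    zero_add] at this

lemma mem_Icc_of_excessEnergy_eq_zero (hab : a ≤ b) {y : ℝ} (h : excessEnergy a b y = 0) :
    y ∈ Icc a b := by
  have hc := continuous_excess (a := a) (b := b)
  have hi : ∀ c d, IntervalIntegrable (excess a b) volume c d :=
    fun c d => hc.intervalIntegrable _ _
  by_contra hy
  rw [mem_Icc, not_and_or, not_le, not_le] at hy
  rcases hy with hy | hy
  -- The tangent is taken halfway between `y` and the interval: its slope is already strictly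
  -- negative there and `y` still lies strictly beyond, so the energy at `y` would be positive.
  · have h1 := excessEnergy_convex (a := a) (b := b) ((y + a) / 2) y
    have h2 := excessEnergy_nonneg hab ((y + a) / 2)
    have h3 : 0 < ∫ s in ((y + a) / 2)..a, excess a b s :=
      intervalIntegral.integral_pos (by linarith) hc.continuousOn (fun s _ => excess_nonneg s)
        ⟨(y + a) / 2, left_mem_Icc.2 (by linarith), by
          rw [excess]
          have := le_max_left (a - (y + a) / 2) 0
          have := le_max_right ((y + a) / 2 - b) 0
          linarith⟩
    have h4 : excessPrim a b ((y + a) / 2) = -∫ s in ((y + a) / 2)..a, excess a b s := by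
      rw [excessPrim, intervalIntegral.integral_symm]
    have h5 : 0 < excessPrim a b ((y + a) / 2) * (y - (y + a) / 2) :=
      mul_pos_of_neg_of_neg (by linarith) (by linarith)
    linarith
  · have h1 := excessEnergy_convex (a := a) (b := b) ((y + b) / 2) y
    have h2 := excessEnergy_nonneg hab ((y + b) / 2)
    have h3 : 0 < excessPrim a b ((y + b) / 2) :=
      intervalIntegral.integral_pos (by linarith) hc.continuousOn (fun s _ => excess_nonneg s)
        ⟨(y + b) / 2, right_mem_Icc.2 (by linarith), by
          rw [excess]
          have := le_max_left ((y + b) / 2 - b) 0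
          have := le_max_right (a - (y + b) / 2) 0
          linarith⟩
    have h5 : 0 < excessPrim a b ((y + b) / 2) * (y - (y + b) / 2) := mul_pos h3 (by linarith)
    linarith

end Excess

section MaxPrinciple

variable {bc : BoundaryCondition} {T ε a b : ℝ} {f A : ℝ → ℝ} {u ux : ℝ → ℝ → ℝ}

lemma memLp_top_comp {u : ℝ → ℝ → ℝ}
    (hu : MemLp (fun p : ℝ × ℝ => u p.1 p.2) ∞ (cylinderMeasure T)) {S : ℝ → ℝ}
    (hS : Continuous S) : MemLp (fun p : ℝ × ℝ => S (u p.1 p.2)) ∞ (cylinderMeasure T) := by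
  obtain ⟨C, hC⟩ := exists_ae_bound hu
  exact memLp_comp_of_ae_bound hu.1 hC hS ∞

lemma memLp_totalFlux (hf : Continuous f) (hA : Continuous A)
    (hu : MemLp (fun p : ℝ × ℝ => u p.1 p.2) ∞ (cylinderMeasure T))
    (hux : ε = 0 ∨ MemLp (fun p : ℝ × ℝ => ux p.1 p.2) 2 (cylinderMeasure T)) :
    MemLp (fun p : ℝ × ℝ => totalFlux ε f A u ux p.1 p.2) 2 (cylinderMeasure T) := by
  have h1 : MemLp (fun p : ℝ × ℝ => f (u p.1 p.2)) 2 (cylinderMeasure T) :=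
    (memLp_top_comp hu hf).mono_exponent le_top
  rcases hux with rfl | hux
  · simpa [totalFlux] using h1
  · exact h1.sub ((MemLp.bdd_mul_of_top (memLp_top_comp hu hA) hux).const_mul ε)

lemma IsL2H1.ae_hasL2Deriv (h : IsL2H1 bc T u ux) :
    ∀ᵐ s ∂volume.restrict (Ioo 0 T), HasL2Deriv (u s) (ux s) ∧ bc.Holds s (u s) := by
  filter_upwards [MemLp.ae_section h.2.1, h.2.2] with s h1 h2
  exact ⟨⟨h1, h2.1⟩, h2.2⟩

lemma IsEntropySolution.isMild (hT : 0 < T) (hε : 0 ≤ ε) (hf : Continuous f) (hA : Continuous A)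
    (hu : IsEntropySolution bc T ε f A u ux) :
    IsMild bc T u (totalFlux ε f A u ux) (fun _ _ => 0) :=
  hu.weak.isMild hT hu.weaklyContinuous (hu.bounded.mono_exponent le_top)
    (memLp_totalFlux hf hA hu.bounded (hε.eq_or_lt.imp Eq.symm fun h => (hu.regular h).2.1))

/-- The energy inequality with `S = excessEnergy a b`, which vanishes initially. In the resulting
rate the convective part is an exact derivative, whose boundary values cancel, and the diffusive
part has a sign; hence the energy stays zero. `S'(u)` satisfies the homogeneous boundary condition
because Dirichlet data take values in `[a, b]`. -/
theorem IsEntropySolution.mem_Icc (hT : 0 < T) (hε : 0 < ε) (hf : Continuous f)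
    (hA : Continuous A) (hA0 : ∀ y, 0 ≤ A y) (hu : IsEntropySolution bc T ε f A u ux)
    (hab : a ≤ b) (h0 : ∀ᵐ x ∂spaceMeasure, u 0 x ∈ Icc a b)
    (hbd : ∀ gL gR, bc = .dirichlet gL gR → ∀ t ∈ Icc 0 T, gL t ∈ Icc a b ∧ gR t ∈ Icc a b)
    {t : ℝ} (ht : t ∈ Icc 0 T) : ∀ᵐ x ∂spaceMeasure, u t x ∈ Icc a b := by
  have hux := (hu.regular hε).2.1
  have hFl := memLp_totalFlux hf hA hu.bounded (.inr hux) (ε := ε)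
  obtain ⟨C, hC⟩ := exists_ae_bound hu.bounded
  have hreg := (hu.regular hε).ae_hasL2Deriv
  have hexu := MemLp.bdd_mul_of_top
    (memLp_top_comp hu.bounded (continuous_excess (a := a) (b := b)))
    hux
  have key := energy_inequality hT (S := excessEnergy a b) (β := excessPrim a b)
    (Bx := fun s x => excess a b (u s x) * ux s x) (Q := fun _ _ => 0) hu.bounded.1
    hu.weaklyContinuous hC hFl (by simp) hexu (hu.isMild hT hε.le hf hA)
    continuous_excessEnergy contDiff_excessPrim.continuous excessEnergy_convex ?_ ht
  · simp only [zero_mul, sub_zero] at key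
    have hS0 : ∫ x in Ioo (0 : ℝ) 1, excessEnergy a b (u 0 x) = 0 := by
      rw [integral_eq_zero_of_ae]
      filter_upwards [h0] with x hx using excessEnergy_eq_zero hx
    have hR : ∫ s in (0 : ℝ)..t, ∫ x in Ioo (0 : ℝ) 1,
        totalFlux ε f A u ux s x * (excess a b (u s x) * ux s x) ≤ 0 := by
      rw [intervalIntegral.integral_of_le ht.1, integral_Ioc_eq_integral_Ioo]
      refine integral_nonpos_of_ae ?_
      have hreg' := ae_mono (Measure.restrict_mono (Ioo_subset_Ioo_right ht.2) le_rfl) hreg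
      have hFl' := ae_mono (Measure.restrict_mono (Ioo_subset_Ioo_right ht.2) le_rfl)
        (MemLp.ae_section hFl)
      have hex' := ae_mono (Measure.restrict_mono (Ioo_subset_Ioo_right ht.2) le_rfl)
        (MemLp.ae_section (g := fun s x => excess a b (u s x) * ux s x) hexu)
      filter_upwards [hreg', hFl', hex', ae_restrict_mem measurableSet_Ioo] with s hs hsF hsx hst
      -- The convective term `f(u) S''(u) ∂ₓu` is the derivative of `H(u)`, where `H` is the
      -- primitive of `f` times `excess a b`.
      have hcH : Continuous (fun y => f y * excess a b y) := hf.mul continuous_excess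
      obtain ⟨hH, hH'⟩ := contDiff_one_primitive hcH a
      have h1 := (hs.1.comp hH)
      have h2 := h1.integral_deriv
      rw [hH'] at h1 h2
      have h3 : (∫ y in a..u s 1, f y * excess a b y) - ∫ y in a..u s 0, f y * excess a b y
          = 0 := by
        cases bc with
        | periodic => rw [show u s 0 = u s 1 from hs.2, sub_self]
        | dirichlet gL gR =>
          have hst' : s ∈ Icc 0 T := ⟨hst.1.le, hst.2.le.trans ht.2⟩
          have hz : ∀ y ∈ Icc a b, f y * excess a b y = 0 := fun y hy => by
            rw [excess_eq_zero hy, mul_zero]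
          have h4 := hbd gL gR rfl s hst'
          rw [show u s 0 = gL s from hs.2.1, show u s 1 = gR s from hs.2.2,
            integral_eq_zero_of_mem_Icc hz h4.1, integral_eq_zero_of_mem_Icc hz h4.2, sub_self]
      rw [h3] at h2
      rw [Pi.zero_apply]
      refine le_of_le_of_eq (integral_mono (integrable_fun_mul hsF hsx)
        (h1.1.integrable (by norm_num)) fun x => ?_) h2
      have h5 : 0 ≤ ε * (A (u s x) * excess a b (u s x) * ux s x ^ 2) :=
        mul_nonneg hε.le (mul_nonneg (mul_nonneg (hA0 _) (excess_nonneg _)) (sq_nonneg _))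
      simp only [totalFlux]
      nlinarith
    rw [hS0, sub_zero] at key
    have hSi : Integrable (fun x => excessEnergy a b (u t x)) spaceMeasure := by
      have hCt := ae_mem_Icc_of_weaklyContinuous hT hu.weaklyContinuous (a := -C) (b := C)
        (by filter_upwards [hC] with p hp using abs_le.1 hp) ht
      exact memLp_one_iff_integrable.1 (memLp_comp_of_ae_bound (hu.weaklyContinuous.1 t ht).1
        (by filter_upwards [hCt] with x hx using abs_le.2 hx) continuous_excessEnergy 1)
    have h1 := (integral_eq_zero_iff_of_nonneg (fun x => excessEnergy_nonneg hab (u t x)) hSi).1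
      (le_antisymm (key.trans hR) (integral_nonneg fun x => excessEnergy_nonneg hab _))
    filter_upwards [h1] with x hx using mem_Icc_of_excessEnergy_eq_zero hab hx
  · filter_upwards [hreg, ae_restrict_mem measurableSet_Ioo] with s hs hsT
    have h1 := hs.1.comp (contDiff_excessPrim (a := a) (b := b))
    rw [deriv_excessPrim] at h1
    refine ⟨h1, ?_⟩
    cases bc with
    | periodic =>
      have : u s 0 = u s 1 := hs.2
      simp only [BoundaryCondition.Homogeneous, this]
    | dirichlet gL gR =>
      have h4 := hbd gL gR rfl s (Ioo_subset_Icc_self hsT)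
      refine ⟨?_, ?_⟩
      · simp only [show u s 0 = gL s from hs.2.1, excessPrim_eq_zero h4.1]
      · simp only [show u s 1 = gR s from hs.2.2, excessPrim_eq_zero h4.2]

end MaxPrinciple

/-! ### Rate of change of the error -/

namespace BoundaryCondition

variable {bc : BoundaryCondition} {t : ℝ} {φ χ : ℝ → ℝ}

lemma Holds.sub (h : bc.Holds t φ) (k : bc.Holds t χ) :
    bc.Homogeneous (fun x => φ x - χ x) := by
  cases bc with
  | periodic =>
    simp only [Holds, Homogeneous] at *
    rw [h, k]
  | dirichlet gL gR =>
    simp only [Holds, Homogeneous] at *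
    simp [h, k]

/-- For Dirichlet data both functions have the same end values; for periodic conditions both
differences vanish. Thus the primitives of `f(u) ∂ₓu` and `f(û) ∂ₓû` contribute the same boundary
terms. -/
lemma Holds.comp_sub_eq (h : bc.Holds t φ) (k : bc.Holds t χ) (G : ℝ → ℝ) :
    G (φ 1) - G (φ 0) = G (χ 1) - G (χ 0) := by
  cases bc with
  | periodic =>
    simp only [Holds] at *
    rw [h, k]; ring
  | dirichlet gL gR =>
    simp only [Holds] at *
    rw [h.1, h.2, k.1, k.2]

end BoundaryCondition

section Nodes

variable {M q : ℕ} [NeZero M] {X : Partition M 0 1} {bc : BoundaryCondition} {w : ℝ → ℝ → ℝ}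
  {T t : ℝ} {ut : ℝ → Broken M (q + 1)} {uts : ℝ → Broken M (q + 2)}

lemma traceMinus_last (t : ℝ) (v : Broken M (q + 1)) :
    bc.traceMinus X t v (Fin.last M) = X.rightVal v (Fin.rev 0) := by
  have : Fin.last M = Fin.succ (Fin.rev 0) := by
    ext
    simp only [Fin.val_last, Fin.val_succ, Fin.val_rev, Fin.coe_ofNat_eq_mod, Nat.zero_mod]
    have := NeZero.pos M
    omega
  rw [this, BoundaryCondition.traceMinus, Fin.cons_succ]

lemma tracePlus_zero (t : ℝ) (v : Broken M (q + 1)) :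
    bc.tracePlus X t v 0 = X.leftVal v 0 := by
  have : (0 : Fin (M + 1)) = Fin.castSucc (0 : Fin M) := rfl
  rw [this, BoundaryCondition.tracePlus, Fin.snoc_castSucc]

/-- In the periodic case the prescribed values at the first and the last node are `w` of the same
pair of traces. -/
lemma holds_contRep {v : Broken M (q + 2)} {v' : Broken M (q + 1)}
    (h : X.HasNodeValues v (nodeValue bc X w t v')) : bc.Holds t (X.contRep v) := by
  have h0 := X.contRep_zero h
  have h1 := X.contRep_one h
  cases bc with
  | periodic =>
    simp only [BoundaryCondition.Holds]
    rw [h0, h1]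
    simp only [nodeValue, traceMinus_last, tracePlus_zero]
    simp only [BoundaryCondition.traceMinus, BoundaryCondition.tracePlus, Fin.cons_zero,
      Fin.snoc_last, BoundaryCondition.exteriorLeft, BoundaryCondition.exteriorRight]
  | dirichlet gL gR =>
    refine ⟨?_, ?_⟩
    · rw [h0]; simp [nodeValue]
    · rw [h1]
      have : Fin.last M ≠ 0 := by
        have := NeZero.ne M
        simpa [Fin.ext_iff] using this
      simp [nodeValue, this]

end Nodes

section ErrorRate

variable {M n : ℕ} [NeZero M] {X : Partition M 0 1} {bc : BoundaryCondition} {T ε : ℝ}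
  {f A : ℝ → ℝ} {u ux : ℝ → ℝ → ℝ} {v : ℝ → Broken M n}

/-- The density of the time derivative of `‖u - v‖² / 2`. -/
noncomputable def errorRate (X : Partition M 0 1) (ε : ℝ) (f A : ℝ → ℝ) (u ux : ℝ → ℝ → ℝ)
    (v : ℝ → Broken M n) (s x : ℝ) : ℝ :=
  -((f (u s x) - f (X.eval (v s) x)) * X.evalDeriv (v s) x)
    - ε * (A (u s x) * ux s x * (ux s x - X.evalDeriv (v s) x))
    - X.eval (deriv v s) x * (u s x - X.eval (v s) x)

/-- `v(t)` is continuous on `[0,1]` and satisfies the boundary conditions, for all `t`. -/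
def IsConforming (X : Partition M 0 1) (bc : BoundaryCondition) (T : ℝ) (v : ℝ → Broken M n) :
    Prop :=
  ∀ t ∈ Icc 0 T, (∃ g, X.HasNodeValues (v t) g) ∧ bc.Holds t (X.contRep (v t))

lemma ae_cylinder_of_forall {T : ℝ} {p : ℝ × ℝ → Prop}
    (h : ∀ t ∈ Ioo 0 T, ∀ x ∈ Ioo (0 : ℝ) 1, p (t, x)) : ∀ᵐ z ∂cylinderMeasure T, p z :=
  (ae_restrict_iff' (measurableSet_Ioo.prod measurableSet_Ioo)).2
    (.of_forall fun z hz => h z.1 hz.1 z.2 hz.2)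

lemma IsMild.congr {e e' P Q : ℝ → ℝ → ℝ} (h : IsMild bc T e P Q)
    (he : ∀ t ∈ Icc 0 T, ∀ x ∈ Ioo (0 : ℝ) 1, e t x = e' t x) : IsMild bc T e' P Q := by
  intro s t hs hst ht φ φ' hφ hb
  rw [← h s t hs hst ht φ φ' hφ hb]
  exact setIntegral_congr_fun measurableSet_Ioo fun x hx => by
    simp only [he t ⟨hs.trans hst, ht⟩ x hx, he s ⟨hs, hst.trans ht⟩ x hx]

lemma IsWeaklyContinuous.congr {e e' : ℝ → ℝ → ℝ} (h : IsWeaklyContinuous T e)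
    (he : ∀ t ∈ Icc 0 T, ∀ x ∈ Ioo (0 : ℝ) 1, e t x = e' t x) : IsWeaklyContinuous T e' := by
  refine ⟨fun t ht => (memLp_congr_ae ?_).1 (h.1 t ht), fun φ hφ => (h.2 φ hφ).congr fun t ht => ?_⟩
  · exact (ae_restrict_iff' measurableSet_Ioo).2 (.of_forall fun x hx => he t ht x hx)
  · exact setIntegral_congr_fun measurableSet_Ioo fun x hx => by simp only [he t ht x hx]

lemma IsWeaklyContinuous.sub {e e' : ℝ → ℝ → ℝ} (h : IsWeaklyContinuous T e)
    (h' : IsWeaklyContinuous T e') : IsWeaklyContinuous T (fun t x => e t x - e' t x) := by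
  refine ⟨fun t ht => (h.1 t ht).sub (h'.1 t ht), fun φ hφ =>
    ((h.2 φ hφ).sub (h'.2 φ hφ)).congr fun t ht => ?_⟩
  simp only [sub_mul, Pi.sub_apply]
  exact integral_sub (integrable_fun_mul (h.1 t ht) hφ) (integrable_fun_mul (h'.1 t ht) hφ)

/-- The energy inequality for `u - v` with `S = y² / 2`. The rate that it gives exceeds `errorRate`
by `f(u) ∂ₓu - f(v) ∂ₓv`, which integrates to zero because `u` and `v` satisfy the same boundary
conditions. -/
theorem energy_estimate_of_pos (hT : 0 < T) (hε : 0 < ε) (hf : Continuous f) (hA : Continuous A)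
    (hu : IsEntropySolution bc T ε f A u ux) (hv : LipOn T v) (hvc : IsConforming X bc T v)
    {t : ℝ} (ht : t ∈ Icc 0 T) :
    (∫ x in Ioo (0 : ℝ) 1, (u t x - X.eval (v t) x) ^ 2)
      ≤ (∫ x in Ioo (0 : ℝ) 1, (u 0 x - X.eval (v 0) x) ^ 2)
        + 2 * ∫ s in (0 : ℝ)..t, ∫ x in Ioo (0 : ℝ) 1, errorRate X ε f A u ux v s x := by
  have hux := (hu.regular hε).2.1
  have hFl := memLp_totalFlux hf hA hu.bounded (.inr hux) (ε := ε)
  have hvB := bddMeas_of_continuousOn hv.continuousOn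
  -- `X.eval` vanishes at `x = 1`, outside the half-open elements. The continuous representative is
  -- required for absolute continuity on `[0, 1]` and the boundary condition there.
  set e : ℝ → ℝ → ℝ := fun t x => u t x - X.contRep (v t) x with he
  have hcr : ∀ t ∈ Icc 0 T, ∀ x ∈ Ioo (0 : ℝ) 1, X.contRep (v t) x = X.eval (v t) x :=
    fun t ht x hx => by
      obtain ⟨⟨g, hg⟩, -⟩ := hvc t ht
      exact X.contRep_eq_eval hg ⟨hx.1.le, hx.2⟩
  have hee : ∀ t ∈ Icc 0 T, ∀ x ∈ Ioo (0 : ℝ) 1, u t x - X.eval (v t) x = e t x :=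
    fun t ht x hx => by simp only [he, hcr t ht x hx]
  have heT : MemLp (fun p : ℝ × ℝ => e p.1 p.2) ⊤ (cylinderMeasure T) :=
    (memLp_congr_ae (ae_cylinder_of_forall fun t ht x hx =>
      hee t (Ioo_subset_Icc_self ht) x hx)).1 (hu.bounded.sub (hvB.memLp_eval X))
  obtain ⟨C, hC⟩ := exists_ae_bound heT
  have hmild : IsMild bc T e (totalFlux ε f A u ux) (fun t x => X.eval (deriv v t) x) :=
    ((hu.isMild hT hε.le hf hA).sub_eval X hu.weaklyContinuous hFl hv).congr hee
  have hwe : IsWeaklyContinuous T e :=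
    (hu.weaklyContinuous.sub (hv.eval_weaklyContinuous X)).congr hee
  have hreg : ∀ᵐ s ∂volume.restrict (Ioo 0 T),
      HasL2Deriv (e s) (fun x => ux s x - X.evalDeriv (v s) x) ∧ bc.Homogeneous (e s) := by
    filter_upwards [(hu.regular hε).ae_hasL2Deriv, ae_restrict_mem measurableSet_Ioo] with s hs hsT
    exact ⟨hs.1.sub (X.hasL2Deriv_contRep _), hs.2.sub (hvc s (Ioo_subset_Icc_self hsT)).2⟩
  have key := energy_inequality hT (S := fun y => y ^ 2 / 2) (β := fun y => y)
    (Bx := fun s x => ux s x - X.evalDeriv (v s) x) heT.1 hwe hC hFl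
    ((hv.bddMeas_deriv.memLp_eval X).mono_exponent le_top)
    (hux.sub ((hvB.memLp_evalDeriv X).mono_exponent le_top)) hmild (by fun_prop) (by fun_prop)
    (fun x y => by nlinarith [sq_nonneg (y - x)]) hreg ht
  have h1 : ∀ t ∈ Icc 0 T, ∫ x in Ioo (0 : ℝ) 1, (u t x - X.eval (v t) x) ^ 2
      = 2 * ∫ x in Ioo (0 : ℝ) 1, e t x ^ 2 / 2 := fun t ht => by
    rw [← integral_const_mul]
    refine setIntegral_congr_fun measurableSet_Ioo fun x hx => ?_
    simp only [hee t ht x hx]; ring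
  have h2 : ∫ s in (0 : ℝ)..t, ∫ x in Ioo (0 : ℝ) 1, (totalFlux ε f A u ux s x
        * (ux s x - X.evalDeriv (v s) x) - X.eval (deriv v s) x * e s x)
      = ∫ s in (0 : ℝ)..t, ∫ x in Ioo (0 : ℝ) 1, errorRate X ε f A u ux v s x := by
    rw [intervalIntegral.integral_of_le ht.1, intervalIntegral.integral_of_le ht.1,
      integral_Ioc_eq_integral_Ioo, integral_Ioc_eq_integral_Ioo]
    refine integral_congr_ae ?_
    have hm := Measure.restrict_mono (μ := volume) (ν := volume)
      (Ioo_subset_Ioo_right ht.2 : Ioo 0 t ⊆ Ioo 0 T) le_rfl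
    filter_upwards [ae_mono hm (hu.regular hε).ae_hasL2Deriv, ae_mono hm (MemLp.ae_section hFl),
      ae_mono hm hreg, ae_restrict_mem measurableSet_Ioo] with s hs hsF hse hst
    have hsT : s ∈ Icc 0 T := ⟨hst.1.le, hst.2.le.trans ht.2⟩
    obtain ⟨hG, hG'⟩ := contDiff_one_primitive hf 0
    have k1 := hs.1.comp hG
    have k2 := (X.hasL2Deriv_contRep (v s)).comp hG
    rw [hG'] at k1 k2
    -- Both terms are exact derivatives, of the primitive of `f` composed with `u` and with `v`.
    have k3 : ∫ x in Ioo (0 : ℝ) 1, (f (u s x) * ux s x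
        - f (X.contRep (v s) x) * X.evalDeriv (v s) x) = 0 := by
      rw [integral_sub (k1.1.integrable (by norm_num)) (k2.1.integrable (by norm_num)),
        k1.integral_deriv, k2.integral_deriv]
      have := hs.2.comp_sub_eq (hvc s hsT).2 (fun y => ∫ s in (0 : ℝ)..y, f s)
      linarith
    have i1 : Integrable (fun x => totalFlux ε f A u ux s x
        * (ux s x - X.evalDeriv (v s) x) - X.eval (deriv v s) x * e s x) spaceMeasure :=
      (integrable_fun_mul hsF hse.1.1).sub (integrable_fun_mul (X.memLp_eval _ 2) hse.1.memLp)
    have i2 : Integrable (fun x => f (u s x) * ux s x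
        - f (X.contRep (v s) x) * X.evalDeriv (v s) x) spaceMeasure :=
      (k1.1.integrable (by norm_num)).sub (k2.1.integrable (by norm_num))
    have k4 := integral_sub i1 i2
    rw [k3, sub_zero] at k4
    rw [← k4]
    refine setIntegral_congr_fun measurableSet_Ioo fun x hx => ?_
    simp only [errorRate, totalFlux, ← hee s hsT x hx, hcr s hsT x hx]
    ring
  rw [h1 t ht, h1 0 (left_mem_Icc.2 hT.le)]
  rw [h2] at key
  linarith

end ErrorRate

/-! ### The inviscid case -/

section Inviscid

variable {T : ℝ} {f A : ℝ → ℝ} {u ux : ℝ → ℝ → ℝ}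

/-- The entropy inequality is tested with a smooth decreasing cut-off in time that falls from 1 to 0
just before `t`. It bounds an average of the energy there, which by weak lower semicontinuity is
almost as large as the energy at `t`. -/
theorem IsEntropySolution.integral_sq_le (hT : 0 < T)
    (hu : IsEntropySolution .periodic T 0 f A u ux) {t : ℝ} (ht : t ∈ Icc 0 T) :
    ∫ x in Ioo (0 : ℝ) 1, u t x ^ 2 / 2 ≤ ∫ x in Ioo (0 : ℝ) 1, u 0 x ^ 2 / 2 := by
  rcases ht.1.eq_or_lt with rfl | ht0
  · exact le_rfl
  obtain ⟨C, hC⟩ := exists_ae_bound hu.bounded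
  have hCt : ∀ t ∈ Icc 0 T, ∀ᵐ x ∂spaceMeasure, |u t x| ≤ C := fun t ht => by
    have := ae_mem_Icc_of_weaklyContinuous hT hu.weaklyContinuous (a := -C) (b := C)
      (by filter_upwards [hC] with p hp using abs_le.1 hp) ht
    filter_upwards [this] with x hx using abs_le.2 hx
  refine le_of_forall_pos_le_add fun η hη => ?_
  obtain ⟨δ, hδ, H⟩ := weak_lowerSemicontinuous (S := fun y => y ^ 2 / 2) (β := fun y => y)
    hu.weaklyContinuous hCt (by fun_prop) (by fun_prop)
    (fun x y => by nlinarith [sq_nonneg (y - x)]) ht hη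
  -- The weight `ρ` lives on `(max 0 (t - δ), t)`, where the lower semicontinuity estimate is
  -- available.
  have hct : max 0 (t - δ) < t := max_lt ht0 (by linarith)
  set c := max 0 (t - δ) with hc
  obtain ⟨ρ, hρ, hρ1, hρ0⟩ := IsBump.exists_integral_eq_one hct
  obtain ⟨hP, hPd⟩ := contDiff_primitive hρ.1 c
  have hρi : ∀ a b, IntervalIntegrable ρ volume a b := fun _ _ =>
    hρ.1.continuous.intervalIntegrable _ _
  have htot : ∫ x, ρ x = 1 := by rw [← hρ.integral_Ioo, hρ1]
  have hρI : Integrable ρ := hρ.1.continuous.integrable_of_hasCompactSupport hρ.hasCompactSupport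
  have hle1 : ∀ s, ∫ y in c..s, ρ y ≤ 1 := fun s => by
    rcases le_total c s with h | h
    · rw [intervalIntegral.integral_of_le h, ← htot]
      exact setIntegral_le_integral hρI (.of_forall hρ0)
    · have := intervalIntegral.integral_nonneg h (fun y _ => hρ0 y) (μ := volume)
      rw [intervalIntegral.integral_symm]
      linarith
  obtain ⟨a', d', h1, h2, h3, h4⟩ := hρ.2
  have hd' : ∀ s, d' ≤ s → ∫ y in c..s, ρ y = 1 := fun s hs => by
    rw [intervalIntegral.integral_of_le (by linarith), ← htot]
    refine setIntegral_eq_integral_of_forall_compl_eq_zero fun y hy => h4 y fun hy' => hy ?_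
    exact ⟨h1.trans_le hy'.1, hy'.2.trans hs⟩
  have h0 : ∫ y in c..0, ρ y = 0 := by
    rw [intervalIntegral.integral_congr (g := fun _ => (0 : ℝ))]
    · simp
    · intro y hy
      rw [uIcc_of_ge (le_max_left _ _)] at hy
      exact hρ.eq_zero fun h => absurd h.1 (not_lt.2 hy.2)
  -- Constancy in `x` removes the entropy flux and makes the test function periodic; the bound
  -- `hle1` makes it nonnegative.
  have key := hu.entropy (fun s _ => 1 - ∫ y in c..s, ρ y)
    ⟨by fun_prop, fun _ _ => rfl, d', by linarith [ht.2], fun s hs _ => by simp [hd' s hs]⟩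
    (fun s _ => by linarith [hle1 s])
  have hder : ∀ s, deriv (fun s => 1 - ∫ y in c..s, ρ y) s = -ρ s := fun s =>
    ((hPd s).const_sub 1).deriv
  simp only [hder, deriv_const', zero_mul, add_zero, sub_zero, h0, one_mul] at key
  have hi : Integrable (fun p : ℝ × ℝ => u p.1 p.2 ^ 2 / 2) (cylinderMeasure T) :=
    memLp_one_iff_integrable.1 ((memLp_top_comp hu.bounded
      (S := fun y => y ^ 2 / 2) (by fun_prop)).mono_exponent le_top)
  obtain ⟨D, hD⟩ := hρ.hasCompactSupport.exists_bound_of_continuous hρ.1.continuous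
  have hi2 : Integrable (fun p : ℝ × ℝ => -ρ p.1 * (u p.1 p.2 ^ 2 / 2)) (cylinderMeasure T) :=
    hi.bdd_mul (c := D) ((hρ.1.continuous.comp continuous_fst).neg).aestronglyMeasurable
      (.of_forall fun p => by rw [norm_neg]; exact hD p.1)
  rw [integral_cylinder hi2] at key
  simp only [integral_const_mul] at key
  have hi3 : IntegrableOn (fun s => -ρ s * ∫ x in Ioo (0 : ℝ) 1, u s x ^ 2 / 2) (Ioo 0 T) := by
    rw [cylinderMeasure_eq_prod] at hi2
    have := hi2.integral_prod_left
    simp only [integral_const_mul] at this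
    exact this
  -- The sign of `-ρ` reverses the lower bound from semicontinuity; outside the support of `ρ` both
  -- sides vanish.
  have h5 : ∫ s in Ioo 0 T, -ρ s * ∫ x in Ioo (0 : ℝ) 1, u s x ^ 2 / 2
      ≤ ∫ s in Ioo 0 T, -ρ s * ((∫ x in Ioo (0 : ℝ) 1, u t x ^ 2 / 2) - η) := by
    refine setIntegral_mono_on hi3 (hρI.neg.mul_const _).integrableOn measurableSet_Ioo
      fun s hs => ?_
    by_cases hsc : s ∈ Ioo c t
    · have := H s (Ioo_subset_Icc_self hs) (by
        rw [abs_lt]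
        exact ⟨by linarith [hsc.1, le_max_right 0 (t - δ)], by linarith [hsc.2]⟩)
      nlinarith [hρ0 s]
    · rw [hρ.eq_zero hsc]; simp
  have h6 : ∫ s in Ioo 0 T, ρ s = 1 := by
    rw [← htot]
    refine setIntegral_eq_integral_of_forall_compl_eq_zero fun y hy => hρ.eq_zero fun hy' => hy ?_
    exact ⟨(le_max_left _ _).trans_lt hy'.1, hy'.2.trans_le ht.2⟩
  rw [integral_mul_const, integral_neg, h6] at h5
  linarith

end Inviscid

lemma IsPrimitive.sum {ι : Type*} (s : Finset ι) {a b : ℝ} {φ φ' : ι → ℝ → ℝ}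
    (h : ∀ i, IsPrimitive a b (φ i) (φ' i)) :
    IsPrimitive a b (fun x => ∑ i ∈ s, φ i x) (fun x => ∑ i ∈ s, φ' i x) := by
  classical
  induction s using Finset.induction_on with
  | empty => simpa using IsPrimitive.const a b 0
  | insert i s hi ih =>
    simp only [Finset.sum_insert hi]
    exact (h i).add ih

lemma LipOn.isPrimitive {M n : ℕ} {T : ℝ} {v : ℝ → Broken M n} (hT : 0 ≤ T) (hv : LipOn T v)
    (L : Broken M n →ₗ[ℝ] ℝ) : IsPrimitive 0 T (fun t => L (v t)) (fun t => L (deriv v t)) := by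
  obtain ⟨K, hK⟩ := hv.clm L
  rw [← uIcc_of_le hT] at hK
  refine IsPrimitive.of_ac hT hK.absolutelyContinuousOnInterval ?_
  filter_upwards [hv.ae_hasDerivAt] with r hr hr'
  exact (LinearMap.toContinuousLinearMap L).hasFDerivAt.comp_hasDerivAt r (hr hr')

/-! ### Pairing of mild solutions with conforming broken polynomials, and the inviscid energy
estimate. -/

section Pairing

variable {M n : ℕ} [NeZero M] {X : Partition M 0 1} {T : ℝ} {e P Q : ℝ → ℝ → ℝ}
  {v : ℝ → Broken M n}

variable (X) in
/-- The functional `v ↦ ∫ v' φ`. -/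
noncomputable def evalDerivInner {φ : ℝ → ℝ} (hφ : MemLp φ 2 spaceMeasure) :
    Broken M n →ₗ[ℝ] ℝ where
  toFun v := ∫ x in Ioo (0 : ℝ) 1, X.evalDeriv v x * φ x
  map_add' v v' := by
    rw [← integral_add (integrable_fun_mul (X.memLp_evalDeriv v 2) hφ)
      (integrable_fun_mul (X.memLp_evalDeriv v' 2) hφ)]
    congr 1; funext x
    simp only [X.evalDeriv_eq_sum, Pi.add_apply, add_mul, Finset.sum_add_distrib]
  map_smul' m v := by
    simp only [RingHom.id_apply, smul_eq_mul]
    rw [← integral_const_mul]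
    congr 1; funext x
    simp only [X.evalDeriv_eq_sum, Pi.smul_apply, smul_eq_mul, Finset.mul_sum, Finset.sum_mul,
      mul_assoc]

variable (X n) in
/-- Continuous periodic broken polynomials. -/
noncomputable def conformingSpace : Submodule ℝ (Broken M n) where
  carrier := {v | (∃ g, X.HasNodeValues v g) ∧
    evalDerivInner X (n := n) (memLp_const (1 : ℝ)) v = 0}
  add_mem' := by
    rintro v v' ⟨⟨g, hg⟩, h⟩ ⟨⟨g', hg'⟩, h'⟩
    refine ⟨⟨g + g', fun j => ?_⟩, by rw [map_add, h, h', add_zero]⟩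
    have h1 := hg j
    have h2 := hg' j
    simp only [Partition.leftVal, Partition.rightVal] at h1 h2 ⊢
    rw [Pi.add_apply, Pi.add_apply, Pi.add_apply, ← h1.1, ← h1.2, ← h2.1, ← h2.2]
    exact ⟨(polyEvalLin n _).map_add _ _, (polyEvalLin n _).map_add _ _⟩
  zero_mem' := by
    refine ⟨⟨0, fun j => ?_⟩, map_zero _⟩
    exact ⟨(polyEvalLin n _).map_zero, (polyEvalLin n _).map_zero⟩
  smul_mem' := by
    rintro c v ⟨⟨g, hg⟩, h⟩
    refine ⟨⟨c • g, fun j => ?_⟩, by rw [map_smul, h, smul_zero]⟩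
    have h1 := hg j
    simp only [Partition.leftVal, Partition.rightVal] at h1 ⊢
    rw [Pi.smul_apply, Pi.smul_apply, Pi.smul_apply, ← h1.1, ← h1.2]
    exact ⟨(polyEvalLin n _).map_smul _ _, (polyEvalLin n _).map_smul _ _⟩

/-- The integral of the elementwise derivative is the difference of the end values of `contRep`; as
a linear condition it fits into the definition of a submodule. -/
lemma mem_conformingSpace {v : Broken M n} : v ∈ conformingSpace n X ↔
    (∃ g, X.HasNodeValues v g) ∧ X.contRep v 0 = X.contRep v 1 := by
  refine and_congr_right fun _ => ?_
  have h := (X.hasL2Deriv_contRep v).integral_deriv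
  simp only [evalDerivInner, LinearMap.coe_mk, AddHom.coe_mk, mul_one]
  rw [h, sub_eq_zero, eq_comm]

/-- The time derivative of `∫ e v` for a mild solution `e` and a conforming `v`. -/
theorem IsMild.integral_mul_eval (hT : 0 < T) (hw : IsWeaklyContinuous T e)
    (hP : MemLp (fun p : ℝ × ℝ => P p.1 p.2) 2 (cylinderMeasure T))
    (hQ : MemLp (fun p : ℝ × ℝ => Q p.1 p.2) 2 (cylinderMeasure T))
    (h : IsMild .periodic T e P Q) (hv : LipOn T v) (hvc : IsConforming X .periodic T v)
    {t : ℝ} (ht : t ∈ Icc 0 T) :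
    IntervalIntegrable (fun s => ((∫ x in Ioo (0 : ℝ) 1, X.eval (deriv v s) x * e s x)
        + ((∫ x in Ioo (0 : ℝ) 1, X.evalDeriv (v s) x * P s x)
          - ∫ x in Ioo (0 : ℝ) 1, X.eval (v s) x * Q s x))) volume 0 t ∧
    (∫ x in Ioo (0 : ℝ) 1, X.eval (v t) x * e t x) - ∫ x in Ioo (0 : ℝ) 1, X.eval (v 0) x * e 0 x
      = ∫ s in (0 : ℝ)..t, ((∫ x in Ioo (0 : ℝ) 1, X.eval (deriv v s) x * e s x)
        + ((∫ x in Ioo (0 : ℝ) 1, X.evalDeriv (v s) x * P s x)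
          - ∫ x in Ioo (0 : ℝ) 1, X.eval (v s) x * Q s x)) := by
  set W := conformingSpace n X with hW
  have hvW : ∀ t ∈ Icc 0 T, v t ∈ W := fun t ht => mem_conformingSpace.2 (hvc t ht)
  -- A linear projection onto the conforming subspace. It extends the coordinates on `W` to linear
  -- functionals on all broken polynomials, which can be applied to `deriv v` as well.
  obtain ⟨p, hp⟩ := W.subtype.exists_leftInverse_of_injective (by simp)
  have hpW : ∀ w ∈ W, (p w : Broken M n) = w := fun w hw => by
    have := LinearMap.congr_fun hp ⟨w, hw⟩
    simp only [LinearMap.comp_apply, Submodule.subtype_apply, LinearMap.id_apply] at this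
    rw [this]
  let b := Module.finBasis ℝ W
  set c : Fin (Module.finrank ℝ W) → Broken M n →ₗ[ℝ] ℝ := fun i => (b.coord i).comp p with hc
  have hrep : ∀ w ∈ W, ∀ L : Broken M n →ₗ[ℝ] ℝ, L w = ∑ i, c i w * L (b i) := fun w hw L => by
    have h1 : (p w : Broken M n) = ∑ i, c i w • (b i : Broken M n) := by
      have := congrArg W.subtype (b.sum_repr (p w))
      rw [map_sum] at this
      simpa [hc] using this.symm
    rw [hpW w hw] at h1
    conv_lhs => rw [h1]
    simp
  -- Near `s` the function equals its own projection, so by uniqueness its derivative equals the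
  -- projection of the derivative.
  have hdW : ∀ᵐ s, s ∈ Ioo 0 T → deriv v s ∈ W := by
    filter_upwards [hv.ae_hasDerivAt] with s hs hsT
    have h1 := (LinearMap.toContinuousLinearMap (W.subtype.comp p)).hasFDerivAt.comp_hasDerivAt s
      (hs hsT)
    have h2 : HasDerivAt v (W.subtype (p (deriv v s))) s := by
      refine h1.congr_of_eventuallyEq ?_
      filter_upwards [Ioo_mem_nhds hsT.1 hsT.2] with r hr
      exact (hpW _ (hvW r (Ioo_subset_Icc_self hr))).symm
    rw [(hs hsT).unique h2]
    exact (p (deriv v s)).2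
  -- For a fixed basis function, which is an admissible test function in space, the mild formulation
  -- says that the pairing with `e` is absolutely continuous. The product rule with the Lipschitz
  -- coordinates then covers time-dependent `v`.
  have hU : ∀ i, IsPrimitive 0 T
      (fun t => ∫ x in Ioo (0 : ℝ) 1, X.eval (b i : Broken M n) x * e t x)
      (fun s => (∫ x in Ioo (0 : ℝ) 1, X.evalDeriv (b i : Broken M n) x * P s x)
        - ∫ x in Ioo (0 : ℝ) 1, X.eval (b i : Broken M n) x * Q s x) := by
    intro i
    obtain ⟨⟨g, hg⟩, hper⟩ := mem_conformingSpace.1 (b i).2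
    have j1 := integrable_fun_mul ((X.memLp_evalDeriv (b i : Broken M n) 2).comp_snd
      (volume.restrict (Ioo 0 T))) (cylinderMeasure_eq_prod T ▸ hP)
    have j2 := integrable_fun_mul ((X.memLp_eval (b i : Broken M n) 2).comp_snd
      (volume.restrict (Ioo 0 T))) (cylinderMeasure_eq_prod T ▸ hQ)
    refine ⟨(intervalIntegrable_iff_integrableOn_Ioo_of_le hT.le).2
      (j1.integral_prod_left.sub j2.integral_prod_left), fun t ht => ?_⟩
    have h1 := h 0 t le_rfl ht.1 ht.2 _ _ (X.hasL2Deriv_contRep (b i : Broken M n)) hper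
    have h2 : ∫ x in Ioo (0 : ℝ) 1, (e t x - e 0 x) * X.contRep (b i : Broken M n) x
        = (∫ x in Ioo (0 : ℝ) 1, X.eval (b i : Broken M n) x * e t x)
          - ∫ x in Ioo (0 : ℝ) 1, X.eval (b i : Broken M n) x * e 0 x := by
      rw [← integral_sub (integrable_fun_mul (X.memLp_eval _ 2) (hw.1 t ht))
        (integrable_fun_mul (X.memLp_eval _ 2) (hw.1 0 (left_mem_Icc.2 hT.le)))]
      refine setIntegral_congr_fun measurableSet_Ioo fun x hx => ?_
      simp only [X.contRep_eq_eval hg ⟨hx.1.le, hx.2⟩]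
      ring
    have h3 : ∫ r in (0 : ℝ)..t, ∫ x in Ioo (0 : ℝ) 1,
          (P r x * X.evalDeriv (b i : Broken M n) x - Q r x * X.contRep (b i : Broken M n) x)
        = ∫ s in (0 : ℝ)..t, ((∫ x in Ioo (0 : ℝ) 1, X.evalDeriv (b i : Broken M n) x * P s x)
          - ∫ x in Ioo (0 : ℝ) 1, X.eval (b i : Broken M n) x * Q s x) := by
      rw [intervalIntegral.integral_of_le ht.1, intervalIntegral.integral_of_le ht.1,
        integral_Ioc_eq_integral_Ioo, integral_Ioc_eq_integral_Ioo]
      refine integral_congr_ae ?_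
      have hm := Measure.restrict_mono (μ := volume) (ν := volume)
        (Ioo_subset_Ioo_right ht.2 : Ioo 0 t ⊆ Ioo 0 T) le_rfl
      filter_upwards [ae_mono hm j1.prod_right_ae, ae_mono hm j2.prod_right_ae] with s k1 k2
      rw [← integral_sub k1 k2]
      refine setIntegral_congr_fun measurableSet_Ioo fun x hx => ?_
      simp only [X.contRep_eq_eval hg ⟨hx.1.le, hx.2⟩]
      ring
    rw [h2, h3] at h1
    simp only
    linarith
  have key := IsPrimitive.sum Finset.univ fun i =>
    (hv.isPrimitive hT.le (c i)).mul hT.le (hU i)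
  have hae : (fun s => ∑ i, (c i (deriv v s)
        * (∫ x in Ioo (0 : ℝ) 1, X.eval (b i : Broken M n) x * e s x)
      + c i (v s) * ((∫ x in Ioo (0 : ℝ) 1, X.evalDeriv (b i : Broken M n) x * P s x)
        - ∫ x in Ioo (0 : ℝ) 1, X.eval (b i : Broken M n) x * Q s x)))
      =ᵐ[volume.restrict (Ioo 0 t)] fun s => ((∫ x in Ioo (0 : ℝ) 1, X.eval (deriv v s) x * e s x)
        + ((∫ x in Ioo (0 : ℝ) 1, X.evalDeriv (v s) x * P s x)
          - ∫ x in Ioo (0 : ℝ) 1, X.eval (v s) x * Q s x)) := by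
    have hm := Measure.restrict_mono (μ := volume) (ν := volume)
      (Ioo_subset_Ioo_right ht.2 : Ioo 0 t ⊆ Ioo 0 T) le_rfl
    filter_upwards [ae_mono hm (MemLp.ae_section hP), ae_mono hm (MemLp.ae_section hQ),
      ae_restrict_of_ae hdW, ae_restrict_mem measurableSet_Ioo] with s hPs hQs hds hst
    have hsT : s ∈ Ioo 0 T := ⟨hst.1, hst.2.trans_le ht.2⟩
    have hvs := hvW s (Ioo_subset_Icc_self hsT)
    have k1 := hrep _ (hds hsT) (evalInner X (hw.1 s (Ioo_subset_Icc_self hsT)))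
    have k2 := hrep _ hvs (evalDerivInner X hPs)
    have k3 := hrep _ hvs (evalInner X hQs)
    simp only [evalInner, evalDerivInner, LinearMap.coe_mk, AddHom.coe_mk] at k1 k2 k3
    rw [k1, k2, k3, ← Finset.sum_sub_distrib, ← Finset.sum_add_distrib]
    refine Finset.sum_congr rfl fun i _ => ?_
    ring
  have hint : IntervalIntegrable _ volume 0 t := key.1.mono_set (by
    rw [uIcc_of_le ht.1, uIcc_of_le hT.le]; exact Icc_subset_Icc_right ht.2)
  rw [intervalIntegrable_iff_integrableOn_Ioo_of_le ht.1] at hint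
  refine ⟨(intervalIntegrable_iff_integrableOn_Ioo_of_le ht.1).2 (hint.congr hae), ?_⟩
  have h1 := key.2 t ht
  have h2 : ∀ t ∈ Icc 0 T,
      ∑ i, c i (v t) * ∫ x in Ioo (0 : ℝ) 1, X.eval (b i : Broken M n) x * e t x
      = ∫ x in Ioo (0 : ℝ) 1, X.eval (v t) x * e t x := fun t ht =>
    (hrep _ (hvW t ht) (evalInner X (hw.1 t ht))).symm
  simp only [h2 t ht, h2 0 (left_mem_Icc.2 hT.le)] at h1
  rw [h1, add_sub_cancel_left]
  rw [intervalIntegral.integral_of_le ht.1, intervalIntegral.integral_of_le ht.1,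
    integral_Ioc_eq_integral_Ioo, integral_Ioc_eq_integral_Ioo]
  exact integral_congr_ae hae

/-- Expand `‖u - v‖² = ‖u‖² - 2 ∫ u v + ‖v‖²`. The first term does not increase by the entropy
inequality, and the others have exact time derivatives. Only `v` is differentiated in space. -/
theorem energy_estimate_of_eq_zero {f A : ℝ → ℝ} {u ux : ℝ → ℝ → ℝ} (hT : 0 < T)
    (hf : Continuous f) (hA : Continuous A) (hu : IsEntropySolution .periodic T 0 f A u ux)
    (hv : LipOn T v) (hvc : IsConforming X .periodic T v) {t : ℝ} (ht : t ∈ Icc 0 T) :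
    (∫ x in Ioo (0 : ℝ) 1, (u t x - X.eval (v t) x) ^ 2)
      ≤ (∫ x in Ioo (0 : ℝ) 1, (u 0 x - X.eval (v 0) x) ^ 2)
        + 2 * ∫ s in (0 : ℝ)..t, ∫ x in Ioo (0 : ℝ) 1, errorRate X 0 f A u ux v s x := by
  have hw := hu.weaklyContinuous
  have h0T : (0 : ℝ) ∈ Icc 0 T := left_mem_Icc.2 hT.le
  have hP := memLp_totalFlux (ux := ux) hf hA hu.bounded (.inl rfl)
  have hQ := (hv.bddMeas_deriv.memLp_eval X).mono_exponent (p := 2) le_top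
  have hz : MemLp (fun _ : ℝ × ℝ => (0 : ℝ)) 2 (cylinderMeasure T) := MemLp.zero
  have hvw : IsWeaklyContinuous T (fun t => X.eval (v t)) := hv.eval_weaklyContinuous X
  have hzw : IsWeaklyContinuous T (fun _ _ => (0 : ℝ)) := ⟨fun _ _ => MemLp.zero, fun φ hφ => by
    simpa using continuousOn_const⟩
  have hzm : IsMild .periodic T (fun _ _ => (0 : ℝ)) (fun _ _ => 0) (fun _ _ => 0) := by
    intro s t _ _ _ φ φ' _ _
    simp
  have m1 := (hu.isMild hT le_rfl hf hA).integral_mul_eval hT hw hP hz hv hvc ht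
  -- Applied to the mild function `0 - v`, the same lemma differentiates `-‖v‖²`.
  have m2 := (hzm.sub_eval X hzw hz hv).integral_mul_eval hT (hzw.sub hvw) hz hQ hv hvc ht
  have hS := hu.integral_sq_le hT ht
  have hsq : ∀ t ∈ Icc 0 T, ∫ x in Ioo (0 : ℝ) 1, (u t x - X.eval (v t) x) ^ 2
      = 2 * (∫ x in Ioo (0 : ℝ) 1, u t x ^ 2 / 2)
        - 2 * (∫ x in Ioo (0 : ℝ) 1, X.eval (v t) x * u t x)
        - ∫ x in Ioo (0 : ℝ) 1, X.eval (v t) x * (0 - X.eval (v t) x) := by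
    intro t ht
    have i1 : Integrable (fun x => u t x ^ 2 / 2) spaceMeasure :=
      (hw.1 t ht).integrable_sq.div_const 2
    have i2 := integrable_fun_mul (X.memLp_eval (v t) 2) (hw.1 t ht)
    have i3 : Integrable (fun x => X.eval (v t) x * (0 - X.eval (v t) x)) spaceMeasure :=
      integrable_fun_mul (X.memLp_eval (v t) 2)
        ((MemLp.zero (ε := ℝ) (μ := spaceMeasure)).sub (X.memLp_eval (v t) 2))
    have i4 : Integrable (fun x => 2 * (u t x ^ 2 / 2) - 2 * (X.eval (v t) x * u t x))
      spaceMeasure := (i1.const_mul 2).sub (i2.const_mul 2)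
    rw [← integral_const_mul, ← integral_const_mul,
      ← integral_sub (i1.const_mul 2) (i2.const_mul 2), ← integral_sub i4 i3]
    congr 1; funext x
    ring
  -- Twice the rate is `-2` times the derivative of `∫ u v` minus the derivative of `∫ v (0 - v)`;
  -- this uses that `f(v) ∂ₓv` integrates to zero over a period.
  have hR : ∫ s in (0 : ℝ)..t, ∫ x in Ioo (0 : ℝ) 1, errorRate X 0 f A u ux v s x
      = ∫ s in (0 : ℝ)..t, (-1 * ((∫ x in Ioo (0 : ℝ) 1, X.eval (deriv v s) x * u s x)
        + ((∫ x in Ioo (0 : ℝ) 1, X.evalDeriv (v s) x * totalFlux 0 f A u ux s x)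
          - ∫ x in Ioo (0 : ℝ) 1, X.eval (v s) x * 0))
        - 1 / 2 * ((∫ x in Ioo (0 : ℝ) 1, X.eval (deriv v s) x * (0 - X.eval (v s) x))
        + ((∫ x in Ioo (0 : ℝ) 1, X.evalDeriv (v s) x * 0)
          - ∫ x in Ioo (0 : ℝ) 1, X.eval (v s) x * X.eval (deriv v s) x))) := by
    rw [intervalIntegral.integral_of_le ht.1, intervalIntegral.integral_of_le ht.1,
      integral_Ioc_eq_integral_Ioo, integral_Ioc_eq_integral_Ioo]
    refine integral_congr_ae ?_
    have hm := Measure.restrict_mono (μ := volume) (ν := volume)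
      (Ioo_subset_Ioo_right ht.2 : Ioo 0 t ⊆ Ioo 0 T) le_rfl
    filter_upwards [ae_mono hm (MemLp.ae_section hP), ae_restrict_mem measurableSet_Ioo]
      with s hPs hst
    have hsT : s ∈ Icc 0 T := ⟨hst.1.le, hst.2.le.trans ht.2⟩
    obtain ⟨⟨g, hg⟩, hper⟩ := hvc s hsT
    obtain ⟨hG, hG'⟩ := contDiff_one_primitive hf 0
    have k2 := (X.hasL2Deriv_contRep (v s)).comp hG
    rw [hG'] at k2
    have k3 := k2.integral_deriv
    rw [show X.contRep (v s) 0 = X.contRep (v s) 1 from hper, sub_self] at k3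
    have j1 := integrable_fun_mul (X.memLp_eval (deriv v s) 2) (hw.1 s hsT)
    have j2 := integrable_fun_mul (X.memLp_evalDeriv (v s) 2) hPs
    have j3 := integrable_fun_mul (X.memLp_eval (v s) 2) (X.memLp_eval (deriv v s) 2)
    have j4 : Integrable (fun x => X.eval (deriv v s) x * (0 - X.eval (v s) x)) spaceMeasure := by
      refine (j3.neg).congr (.of_forall fun x => ?_)
      simp only [Pi.neg_apply]; ring
    have j5 := k2.1.integrable (by norm_num)
    have e1 : ∫ x in Ioo (0 : ℝ) 1, X.eval (deriv v s) x * (0 - X.eval (v s) x)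
        = -∫ x in Ioo (0 : ℝ) 1, X.eval (v s) x * X.eval (deriv v s) x := by
      rw [← integral_neg]
      congr 1; funext x; ring
    have e2 : ∫ x in Ioo (0 : ℝ) 1, errorRate X 0 f A u ux v s x
        = ∫ x in Ioo (0 : ℝ) 1, (f (X.contRep (v s) x) * X.evalDeriv (v s) x
          + X.eval (v s) x * X.eval (deriv v s) x
          - X.evalDeriv (v s) x * totalFlux 0 f A u ux s x - X.eval (deriv v s) x * u s x) := by
      refine setIntegral_congr_fun measurableSet_Ioo fun x hx => ?_
      simp only [errorRate, totalFlux, X.contRep_eq_eval hg ⟨hx.1.le, hx.2⟩]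
      ring
    have j6 : Integrable (fun x => f (X.contRep (v s) x) * X.evalDeriv (v s) x
      + X.eval (v s) x * X.eval (deriv v s) x) spaceMeasure := j5.add j3
    have j7 : Integrable (fun x => f (X.contRep (v s) x) * X.evalDeriv (v s) x
      + X.eval (v s) x * X.eval (deriv v s) x
      - X.evalDeriv (v s) x * totalFlux 0 f A u ux s x) spaceMeasure := j6.sub j2
    rw [e2, integral_sub j7 j1, integral_sub j6 j2, integral_add j5 j3, k3, e1]
    simp only [mul_zero, integral_zero]
    ring
  rw [hR, intervalIntegral.integral_sub (m1.1.const_mul _) (m2.1.const_mul _),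
    intervalIntegral.integral_const_mul, intervalIntegral.integral_const_mul, ← m1.2, ← m2.2,
    hsq t ht, hsq 0 h0T]
  linarith

end Pairing

/-! ### Norms and duality -/

lemma normL2_eq {g : ℝ → ℝ} (hg : MemLp g 2 spaceMeasure) :
    normL2 g = ENNReal.ofReal (√(∫ x in Ioo (0 : ℝ) 1, g x ^ 2)) := by
  rw [normL2, hg.eLpNorm_eq_integral_rpow_norm (by norm_num) (by norm_num)]
  congr 1
  rw [Real.sqrt_eq_rpow]
  simp

lemma normL2_sq {g : ℝ → ℝ} (hg : MemLp g 2 spaceMeasure) :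
    normL2 g ^ 2 = ENNReal.ofReal (∫ x in Ioo (0 : ℝ) 1, g x ^ 2) := by
  rw [normL2_eq hg, ← ENNReal.ofReal_pow (Real.sqrt_nonneg _), Real.sq_sqrt]
  exact integral_nonneg fun x => sq_nonneg _

lemma abs_integral_mul_le {g k : ℝ → ℝ} (hg : MemLp g 2 spaceMeasure)
    (hk : MemLp k 2 spaceMeasure) : |∫ x in Ioo (0 : ℝ) 1, g x * k x|
      ≤ √(∫ x in Ioo (0 : ℝ) 1, g x ^ 2) * √(∫ x in Ioo (0 : ℝ) 1, k x ^ 2) := by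
  have h := integral_mul_norm_le_Lp_mul_Lq (μ := spaceMeasure) (f := g) (g := k)
    Real.HolderConjugate.two_two (by simpa using hg) (by simpa using hk)
  rw [Real.sqrt_eq_rpow, Real.sqrt_eq_rpow]
  refine (abs_integral_le_integral_abs).trans ?_
  simpa [abs_mul] using h

/-- Duality by rescaling the test function to norm at most one; a real bound `N` is used because the
norm takes values in `[0, ∞]`. -/
lemma abs_integral_le_of_normHm1_le {bc : BoundaryCondition} {G₀ G₁ φ φ' : ℝ → ℝ} {N : ℝ}
    (hN : 0 ≤ N) (h : normHm1 bc G₀ G₁ ≤ ENNReal.ofReal N) (hφ : HasL2Deriv φ φ')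
    (hφbc : bc.Homogeneous φ) :
    |∫ x in Ioo (0 : ℝ) 1, (G₀ x * φ x + G₁ x * φ' x)|
      ≤ N * √(∫ x in Ioo (0 : ℝ) 1, φ' x ^ 2) := by
  set D := √(∫ x in Ioo (0 : ℝ) 1, φ' x ^ 2) with hD
  -- Dividing by `D + η` instead of `D` covers the case `D = 0`; afterwards `η` tends to zero.
  have key : ∀ η : ℝ, 0 < η →
      |∫ x in Ioo (0 : ℝ) 1, (G₀ x * φ x + G₁ x * φ' x)| ≤ N * D + N * η := by
    intro η hη
    have hDη : 0 < D + η := by positivity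
    have hψ := hφ.const_mul (D + η)⁻¹
    have hbc : bc.Homogeneous (fun x => (D + η)⁻¹ * φ x) := by
      cases bc with
      | periodic => simp only [BoundaryCondition.Homogeneous] at *; rw [hφbc]
      | dirichlet gL gR => simp only [BoundaryCondition.Homogeneous] at *; simp [hφbc]
    have hle : normL2 (fun x => (D + η)⁻¹ * φ' x) ≤ 1 := by
      rw [normL2_eq hψ.1]
      simp only [mul_pow]
      rw [integral_const_mul, Real.sqrt_mul (by positivity), Real.sqrt_sq (by positivity), ← hD,
        ENNReal.ofReal_le_one, inv_mul_le_one₀ hDη]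
      linarith
    have h1 : ENNReal.ofReal |∫ x in Ioo (0 : ℝ) 1,
        (G₀ x * ((D + η)⁻¹ * φ x) + G₁ x * ((D + η)⁻¹ * φ' x))| ≤ normHm1 bc G₀ G₁ := by
      unfold normHm1
      exact le_iSup_of_le _ (le_iSup_of_le _ (le_iSup_of_le hψ.1 (le_iSup_of_le hψ.2
        (le_iSup_of_le hbc (le_iSup_of_le hle le_rfl)))))
    have h2 := (ENNReal.ofReal_le_ofReal_iff hN).1 (h1.trans h)
    have h3 : ∫ x in Ioo (0 : ℝ) 1, (G₀ x * ((D + η)⁻¹ * φ x) + G₁ x * ((D + η)⁻¹ * φ' x))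
        = (D + η)⁻¹ * ∫ x in Ioo (0 : ℝ) 1, (G₀ x * φ x + G₁ x * φ' x) := by
      rw [← integral_const_mul]
      congr 1; funext x; ring
    rw [h3, abs_mul, abs_of_pos (inv_pos.2 hDη), inv_mul_le_iff₀ hDη] at h2
    linarith
  refine le_of_forall_pos_le_add fun η hη => ?_
  have h1 := key (η / (N + 1)) (by positivity)
  have h2 : N * (η / (N + 1)) ≤ η := by
    rw [mul_div_assoc', div_le_iff₀ (by positivity)]
    nlinarith
  linarith

/-! ### Bounds for the nonlinearities -/

section Nonlinear

variable {a b : ℝ} {f A : ℝ → ℝ}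

lemma le_sSup_image {g : ℝ → ℝ} (hg : Continuous g) {y : ℝ} (hy : y ∈ Icc a b) :
    g y ≤ sSup (g '' Icc a b) :=
  le_csSup (isCompact_Icc.bddAbove_image hg.continuousOn) (mem_image_of_mem g hy)

/-- The mean value inequality, applied to `f'` and then to `f - f'(z) x`, gives the remainder
without the sharp factor one half; `K` is stated with this constant. -/
lemma abs_taylor_le (hf : ContDiff ℝ 2 f) {y z : ℝ} (hy : y ∈ Icc a b) (hz : z ∈ Icc a b) :
    |f y - f z - deriv f z * (y - z)|
      ≤ sSup ((fun v => |deriv (deriv f) v|) '' Icc a b) * (y - z) ^ 2 := by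
  set S := sSup ((fun v => |deriv (deriv f) v|) '' Icc a b)
  have hf' : ContDiff ℝ 1 (deriv f) := ((contDiff_succ_iff_deriv (n := 1)).1 hf).2.2
  have hS : ∀ y ∈ Icc a b, |deriv (deriv f) y| ≤ S := fun y hy =>
    le_sSup_image (hf'.continuous_deriv (by norm_num)).abs hy
  have hS0 : 0 ≤ S := (abs_nonneg _).trans (hS z hz)
  have h1 : ∀ y ∈ Icc a b, |deriv f y - deriv f z| ≤ S * |y - z| := fun y hy =>
    (convex_Icc a b).norm_image_sub_le_of_norm_deriv_le
      (fun x _ => (hf'.differentiable (by norm_num)) x) hS hz hy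
  have hsub : uIcc z y ⊆ Icc a b := uIcc_subset_Icc hz hy
  have hd : ∀ x, HasDerivAt (fun x => f x - deriv f z * x) (deriv f x - deriv f z) x := fun x => by
    simpa using ((hf.differentiable (by norm_num)) x).hasDerivAt.fun_sub
      ((hasDerivAt_id x).const_mul (deriv f z))
  have h2 := (convex_uIcc z y).norm_image_sub_le_of_norm_hasDerivWithin_le
    (C := S * |y - z|) (fun x _ => (hd x).hasDerivWithinAt) (fun x hx => by
      refine (h1 x (hsub hx)).trans (mul_le_mul_of_nonneg_left ?_ hS0)
      exact abs_sub_left_of_mem_uIcc hx) left_mem_uIcc right_mem_uIcc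
  rw [Real.norm_eq_abs, Real.norm_eq_abs, mul_assoc, abs_mul_abs_self] at h2
  calc _ = |f y - deriv f z * y - (f z - deriv f z * z)| := by congr 1; ring
    _ ≤ _ := h2
    _ = _ := by ring

lemma sq_sub_le (hA : ContDiff ℝ 2 A) {y z : ℝ} (hy : y ∈ Icc a b) (hz : z ∈ Icc a b) :
    (A y - A z) ^ 2 ≤ sSup ((fun v => |deriv A v| ^ 2) '' Icc a b) * (y - z) ^ 2 := by
  set S := sSup ((fun v => |deriv A v| ^ 2) '' Icc a b)
  have hS : ∀ y ∈ Icc a b, |deriv A y| ^ 2 ≤ S := fun y hy =>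
    le_sSup_image (g := fun v => |deriv A v| ^ 2)
      (((hA.continuous_deriv (by norm_num)).abs).pow 2) hy
  have hS0 : 0 ≤ S := (sq_nonneg _).trans (hS z hz)
  have h := (convex_Icc a b).norm_image_sub_le_of_norm_deriv_le (C := √S)
    (fun x _ => (hA.differentiable (by norm_num)) x)
    (fun x hx => Real.le_sqrt_of_sq_le (hS x hx)) hz hy
  rw [Real.norm_eq_abs, Real.norm_eq_abs] at h
  have := pow_le_pow_left₀ (abs_nonneg _) h 2
  rwa [mul_pow, sq_abs, sq_abs, Real.sq_sqrt hS0] at this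

/-- The pointwise heart of the estimate. With `∂_t v = r - f'(v) ∂ₓv + ε al`, the convective terms
become the Taylor remainder of `f`. In the diffusion, `A(u) ∂ₓu` splits into `A(u) ∂ₓe`, which is
coercive, `(A(u) - A(v)) ∂ₓv`, which is absorbed, and `A(v) ∂ₓv`, which together with `al` forms the
parabolic residual. -/
lemma errorRate_le_aux {ε L S₁ S₂ fu fv dfv Au Av u v vx ux r al : ℝ} (hε : 0 ≤ ε)
    (hvx : |vx| ≤ L) (hf : |fu - fv - dfv * (u - v)| ≤ S₂ * (u - v) ^ 2) (hAu : 1 ≤ Au)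
    (hA : (Au - Av) ^ 2 ≤ S₁ * (u - v) ^ 2) :
    -((fu - fv) * vx) - ε * (Au * ux * (ux - vx)) - (r - dfv * vx + ε * al) * (u - v)
      ≤ -(r * (u - v)) + (ε * L * S₁ + S₂) * L * (u - v) ^ 2
        - ε * (3 / 4 * (ux - vx) ^ 2 + (al * (u - v) + Av * vx * (ux - vx))) := by
  have h1 : -((fu - fv - dfv * (u - v)) * vx) ≤ S₂ * (u - v) ^ 2 * L := by
    refine (neg_le_abs _).trans ?_
    rw [abs_mul]
    exact mul_le_mul hf hvx (abs_nonneg _) ((abs_nonneg _).trans hf)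
  have h2 : ((Au - Av) * vx) ^ 2 ≤ S₁ * (u - v) ^ 2 * L ^ 2 := by
    rw [mul_pow]
    refine mul_le_mul hA ?_ (sq_nonneg _) ((sq_nonneg _).trans hA)
    rw [← sq_abs]
    exact pow_le_pow_left₀ (abs_nonneg _) hvx 2
  have h3 : -(Au * ux * (ux - vx)) ≤ S₁ * (u - v) ^ 2 * L ^ 2 - 3 / 4 * (ux - vx) ^ 2
      - Av * vx * (ux - vx) := by
    -- This square is Young's inequality for the middle term; it costs one quarter of the coercive
    -- term and leaves `3 / 4`.
    nlinarith [sq_nonneg ((ux - vx) / 2 + (Au - Av) * vx),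
      mul_nonneg (sub_nonneg.2 hAu) (sq_nonneg (ux - vx))]
  have h4 := mul_le_mul_of_nonneg_left h3 hε
  nlinarith

end Nonlinear

/-! ### The error balance in terms of the residuals. -/

section Stability

variable {M q : ℕ} {X : Partition M 0 1} {T ε a b : ℝ} {f A : ℝ → ℝ}
  {u ux : ℝ → ℝ → ℝ} {Ah : ℝ → Broken M (q + 1) → Broken M (q + 1)}
  {ut : ℝ → Broken M (q + 1)} {v : ℝ → Broken M (q + 2)}

/-- The density of the parabolic residual, tested with the error. -/
noncomputable def parabolicDefect (X : Partition M 0 1) (A : ℝ → ℝ) (u ux : ℝ → ℝ → ℝ)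
    (Ah : ℝ → Broken M (q + 1) → Broken M (q + 1)) (ut : ℝ → Broken M (q + 1))
    (v : ℝ → Broken M (q + 2)) (s x : ℝ) : ℝ :=
  X.eval (Ah s (ut s)) x * (u s x - X.eval (v s) x)
    + A (X.eval (v s) x) * X.evalDeriv (v s) x * (ux s x - X.evalDeriv (v s) x)

lemma ae_abs_evalDeriv_le_gradientBound (hv : LipOn T v) :
    ∀ᵐ p ∂cylinderMeasure T, |X.evalDeriv (v p.1) p.2| ≤ gradientBound X T v := by
  have h := (bddMeas_of_continuousOn hv.continuousOn).memLp_evalDeriv X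
  filter_upwards [ae_le_eLpNormEssSup (f := fun p : ℝ × ℝ => X.evalDeriv (v p.1) p.2)
    (μ := cylinderMeasure T)] with p hp
  rw [← eLpNorm_exponent_top] at hp
  have := ENNReal.toReal_mono h.2.ne hp
  simpa [gradientBound] using this

lemma memLp_residual₁ (hf : ContDiff ℝ 2 f) (hv : LipOn T v)
    (hα : BddMeas T fun s => Ah s (ut s)) :
    MemLp (fun p : ℝ × ℝ => residual₁ X f ε Ah ut v p.1 p.2) ⊤ (cylinderMeasure T) := by
  have hvB := bddMeas_of_continuousOn hv.continuousOn
  have h1 := memLp_top_comp (u := fun s x => X.eval (v s) x) (hvB.memLp_eval X)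
    (hf.continuous_deriv (by norm_num))
  exact ((hv.bddMeas_deriv.memLp_eval X).add ((hvB.memLp_evalDeriv X).mul h1)).sub
    ((hα.memLp_eval X).const_mul ε)

/-- Integrates `errorRate_le_aux` over space and time. The integrability statements are part of the
conclusion because the weights for the Gronwall argument are built from these integrals. -/
theorem error_balance (hε : 0 ≤ ε) (hf : ContDiff ℝ 2 f) (hA : ContDiff ℝ 2 A)
    (hA1 : ∀ y, 1 ≤ A y)
    (hub : MemLp (fun p : ℝ × ℝ => u p.1 p.2) ⊤ (cylinderMeasure T))
    (hux : MemLp (fun p : ℝ × ℝ => ux p.1 p.2) 2 (cylinderMeasure T))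
    (hv : LipOn T v) (hα : BddMeas T fun s => Ah s (ut s))
    (huI : ∀ t ∈ Icc 0 T, ∀ᵐ x ∂spaceMeasure, u t x ∈ Icc a b)
    (hvI : ∀ t ∈ Icc 0 T, ∀ x ∈ Ioo (0 : ℝ) 1, X.eval (v t) x ∈ Icc a b)
    (hen : ∀ t ∈ Icc 0 T, (∫ x in Ioo (0 : ℝ) 1, (u t x - X.eval (v t) x) ^ 2)
      ≤ (∫ x in Ioo (0 : ℝ) 1, (u 0 x - X.eval (v 0) x) ^ 2)
        + 2 * ∫ s in (0 : ℝ)..t, ∫ x in Ioo (0 : ℝ) 1, errorRate X ε f A u ux v s x) :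
    Integrable (fun p : ℝ × ℝ => (u p.1 p.2 - X.eval (v p.1) p.2) ^ 2) (cylinderMeasure T) ∧
    Integrable (fun p : ℝ × ℝ => (ux p.1 p.2 - X.evalDeriv (v p.1) p.2) ^ 2) (cylinderMeasure T) ∧
    Integrable (fun p : ℝ × ℝ => residual₁ X f ε Ah ut v p.1 p.2 * (u p.1 p.2 - X.eval (v p.1) p.2))
      (cylinderMeasure T) ∧
    Integrable (fun p : ℝ × ℝ => parabolicDefect X A u ux Ah ut v p.1 p.2) (cylinderMeasure T) ∧
    ∀ t ∈ Icc 0 T, (∫ x in Ioo (0 : ℝ) 1, (u t x - X.eval (v t) x) ^ 2)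
      ≤ (∫ x in Ioo (0 : ℝ) 1, (u 0 x - X.eval (v 0) x) ^ 2)
        + 2 * ∫ s in (0 : ℝ)..t,
          (|∫ x in Ioo (0 : ℝ) 1, residual₁ X f ε Ah ut v s x * (u s x - X.eval (v s) x)|
            + stabilityConstant X T ε f A a b v
              * (∫ x in Ioo (0 : ℝ) 1, (u s x - X.eval (v s) x) ^ 2)
            + ε * (|∫ x in Ioo (0 : ℝ) 1, parabolicDefect X A u ux Ah ut v s x|
              - 3 / 4 * ∫ x in Ioo (0 : ℝ) 1, (ux s x - X.evalDeriv (v s) x) ^ 2)) := by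
  have hvB := bddMeas_of_continuousOn hv.continuousOn
  have hve := hvB.memLp_eval X
  have hvx := hvB.memLp_evalDeriv X
  have he : MemLp (fun p : ℝ × ℝ => u p.1 p.2 - X.eval (v p.1) p.2) 2 (cylinderMeasure T) :=
    (hub.sub hve).mono_exponent le_top
  have hex : MemLp (fun p : ℝ × ℝ => ux p.1 p.2 - X.evalDeriv (v p.1) p.2) 2 (cylinderMeasure T) :=
    hux.sub (hvx.mono_exponent le_top)
  have i1 := he.integrable_sq
  have i2 := hex.integrable_sq
  have i3 := integrable_fun_mul
    ((memLp_residual₁ (ε := ε) (X := X) hf hv hα).mono_exponent (p := 2) le_top) he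
  have i4 : Integrable (fun p : ℝ × ℝ => parabolicDefect X A u ux Ah ut v p.1 p.2)
      (cylinderMeasure T) := by
    have hAv := memLp_top_comp (u := fun s x => X.eval (v s) x) hve hA.continuous
    have hAvx := (hvx.mul hAv (r := ⊤)).mono_exponent (p := 2) le_top
    exact (integrable_fun_mul ((hα.memLp_eval X).mono_exponent (p := 2) le_top) he).add
      (integrable_fun_mul hAvx hex)
  have i5 : Integrable (fun p : ℝ × ℝ => errorRate X ε f A u ux v p.1 p.2)
      (cylinderMeasure T) := by
    have h1 := ((memLp_top_comp hub hf.continuous).sub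
      (memLp_top_comp (u := fun s x => X.eval (v s) x) hve hf.continuous)).mono_exponent
      (p := 2) le_top
    have h2 := MemLp.bdd_mul_of_top (memLp_top_comp hub hA.continuous) hux
    exact ((integrable_fun_mul h1 (hvx.mono_exponent (p := 2) le_top)).neg.sub
      ((integrable_fun_mul h2 hex).const_mul ε)).sub
      (integrable_fun_mul ((hv.bddMeas_deriv.memLp_eval X).mono_exponent (p := 2) le_top) he)
  refine ⟨i1, i2, i3, i4, fun t ht => (hen t ht).trans ?_⟩
  have hL := ae_abs_evalDeriv_le_gradientBound (X := X) hv
  rw [cylinderMeasure_eq_prod] at i1 i2 i3 i4 i5 hL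
  have hm := Measure.restrict_mono (μ := volume) (ν := volume)
    (Ioo_subset_Ioo_right ht.2 : Ioo 0 t ⊆ Ioo 0 T) le_rfl
  have hI : ∀ g : ℝ → ℝ, Integrable g (volume.restrict (Ioo 0 T)) →
      Integrable g (volume.restrict (Ioo 0 t)) := fun g hg => hg.mono_measure hm
  have hKdef : stabilityConstant X T ε f A a b v
      = (ε * gradientBound X T v * sSup ((fun v => |deriv A v| ^ 2) '' Icc a b)
        + sSup ((fun v => |deriv (deriv f) v|) '' Icc a b)) * gradientBound X T v := rfl
  set K := stabilityConstant X T ε f A a b v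
  refine add_le_add_right (mul_le_mul_of_nonneg_left ?_ zero_le_two) _
  rw [intervalIntegral.integral_of_le ht.1, intervalIntegral.integral_of_le ht.1,
    integral_Ioc_eq_integral_Ioo, integral_Ioc_eq_integral_Ioo]
  refine integral_mono_ae (hI _ i5.integral_prod_left)
    (((hI _ i3.integral_prod_left).abs.add ((hI _ i1.integral_prod_left).const_mul K)).add
      (((hI _ i4.integral_prod_left).abs.sub
        ((hI _ i2.integral_prod_left).const_mul (3 / 4))).const_mul ε)) ?_
  filter_upwards [ae_mono hm i1.prod_right_ae, ae_mono hm i2.prod_right_ae,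
    ae_mono hm i3.prod_right_ae, ae_mono hm i4.prod_right_ae, ae_mono hm i5.prod_right_ae,
    ae_mono hm (Measure.ae_ae_of_ae_prod hL), ae_restrict_mem measurableSet_Ioo]
    with s j1 j2 j3 j4 j5 hLs hst
  have hsT : s ∈ Icc 0 T := ⟨hst.1.le, hst.2.le.trans ht.2⟩
  have j3' : Integrable (fun x => -(residual₁ X f ε Ah ut v s x * (u s x - X.eval (v s) x)))
      spaceMeasure := j3.neg
  have k1 : Integrable (fun x => -(residual₁ X f ε Ah ut v s x * (u s x - X.eval (v s) x))
      + K * (u s x - X.eval (v s) x) ^ 2) spaceMeasure := j3'.add (j1.const_mul K)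
  have k2 : Integrable (fun x => 3 / 4 * (ux s x - X.evalDeriv (v s) x) ^ 2
      + parabolicDefect X A u ux Ah ut v s x) spaceMeasure := (j2.const_mul (3 / 4)).add j4
  have hle : ∫ x in Ioo (0 : ℝ) 1, errorRate X ε f A u ux v s x
      ≤ ∫ x in Ioo (0 : ℝ) 1, (-(residual₁ X f ε Ah ut v s x * (u s x - X.eval (v s) x))
        + K * (u s x - X.eval (v s) x) ^ 2
        - ε * (3 / 4 * (ux s x - X.evalDeriv (v s) x) ^ 2
          + parabolicDefect X A u ux Ah ut v s x)) := by
    refine integral_mono_ae j5 (k1.sub (k2.const_mul ε)) ?_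
    filter_upwards [hLs, huI s hsT, ae_restrict_mem measurableSet_Ioo] with x hLx hux' hx
    have hvx' := hvI s hsT x hx
    -- With `r` equal to `residual₁`, the expression `r - f'(v) ∂ₓv + ε al` is exactly the time
    -- derivative of the reconstruction.
    have := errorRate_le_aux (ux := ux s x) (r := residual₁ X f ε Ah ut v s x)
      (al := X.eval (Ah s (ut s)) x) hε hLx (abs_taylor_le hf hux' hvx') (hA1 (u s x))
      (sq_sub_le hA hux' hvx')
    rw [hKdef]
    refine le_trans (le_of_eq ?_) this
    simp only [errorRate, residual₁]
    ring
  refine hle.trans ?_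
  rw [integral_sub k1 (k2.const_mul ε), integral_add j3' (j1.const_mul K), integral_const_mul,
    integral_const_mul, integral_add (j2.const_mul _) j4, integral_const_mul]
  simp only [integral_neg]
  have l1 := neg_le_abs
    (∫ x in Ioo (0 : ℝ) 1, residual₁ X f ε Ah ut v s x * (u s x - X.eval (v s) x))
  have l2 := mul_le_mul_of_nonneg_left
    (neg_le_abs (∫ x in Ioo (0 : ℝ) 1, parabolicDefect X A u ux Ah ut v s x)) hε
  linarith

end Stability

/-! ### A Gronwall inequality -/

/-- If `E + G ≤ a + 2 ∫ (m √E + K E)`, then `E + G ≤ (2 a + 8 (∫ m)²) e^{8 K τ}`. -/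
theorem gronwall_sqrt {τ a B K : ℝ} {E G m : ℝ → ℝ} (hτ : 0 ≤ τ) (hK : 0 ≤ K) (ha : 0 ≤ a)
    (hE : ∀ t ∈ Icc 0 τ, E t ∈ Icc 0 B) (hG : ∀ t ∈ Icc 0 τ, 0 ≤ G t) (hm : ∀ t, 0 ≤ m t)
    (hmi : IntervalIntegrable m volume 0 τ)
    (hi : IntervalIntegrable (fun s => m s * √(E s) + K * E s) volume 0 τ)
    (h : ∀ t ∈ Icc 0 τ, E t + G t ≤ a + 2 * ∫ s in (0 : ℝ)..t, (m s * √(E s) + K * E s)) :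
    E τ + G τ ≤ (2 * a + 8 * (∫ s in (0 : ℝ)..τ, m s) ^ 2) * Real.exp (8 * K * τ) := by
  set R := ∫ s in (0 : ℝ)..τ, m s with hR
  have hR0 : 0 ≤ R := intervalIntegral.integral_nonneg hτ fun s _ => hm s
  -- A bound `E ≤ N e^{8Ks}` improves itself: the rate `8 K` makes the linear term contribute at
  -- most `N / 4`, and Young's inequality gives another `N / 4` from the square root term.
  have step : ∀ N : ℝ, 0 ≤ N → (∀ s ∈ Icc 0 τ, E s ≤ N * Real.exp (8 * K * s)) →
      ∀ t ∈ Icc 0 τ, E t + G t ≤ (a + 4 * R ^ 2 + N / 2) * Real.exp (8 * K * t) := by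
    intro N hN hEN t ht
    have hsub : uIcc 0 t ⊆ uIcc 0 τ := by
      rw [uIcc_of_le ht.1, uIcc_of_le hτ]; exact Icc_subset_Icc_right ht.2
    have hexp : ∀ s, Real.exp (8 * K * s) = Real.exp (4 * K * s) ^ 2 := fun s => by
      rw [← Real.exp_nat_mul]; congr 1; push_cast; ring
    set X := Real.exp (4 * K * t) with hX
    have hX1 : 1 ≤ X := Real.one_le_exp (mul_nonneg (by positivity) ht.1)
    have hX2 : X ≤ X ^ 2 := le_self_pow₀ hX1 (by norm_num)
    have hmt : IntervalIntegrable m volume 0 t := hmi.mono_set hsub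
    have hcexp : Continuous fun s : ℝ => K * (N * Real.exp (8 * K * s)) := by fun_prop
    have h1 : ∫ s in (0 : ℝ)..t, (m s * √(E s) + K * E s)
        ≤ ∫ s in (0 : ℝ)..t, (m s * (√N * X) + K * (N * Real.exp (8 * K * s))) := by
      refine intervalIntegral.integral_mono_on ht.1 (hi.mono_set hsub)
        ((hmt.mul_const _).add (hcexp.intervalIntegrable _ _)) fun s hs => ?_
      have hs' : s ∈ Icc 0 τ := ⟨hs.1, hs.2.trans ht.2⟩
      have h2 := hEN s hs'
      refine add_le_add (mul_le_mul_of_nonneg_left ?_ (hm s)) (mul_le_mul_of_nonneg_left h2 hK)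
      calc √(E s) ≤ √(N * Real.exp (8 * K * s)) := Real.sqrt_le_sqrt h2
        _ = √N * Real.exp (4 * K * s) := by
          rw [Real.sqrt_mul hN, hexp, Real.sqrt_sq (Real.exp_nonneg _)]
        _ ≤ √N * X := mul_le_mul_of_nonneg_left (Real.exp_le_exp.2
          (mul_le_mul_of_nonneg_left hs.2 (by positivity))) (Real.sqrt_nonneg _)
    have h3 : ∫ s in (0 : ℝ)..t, K * (N * Real.exp (8 * K * s)) = N / 8 * X ^ 2 - N / 8 := by
      rw [intervalIntegral.integral_eq_sub_of_hasDerivAt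
        (f := fun s => N / 8 * Real.exp (8 * K * s)) (fun s _ => ?_)
        (hcexp.intervalIntegrable _ _)]
      · simp [hexp, hX]
      · have := (((hasDerivAt_id s).const_mul (8 * K)).exp).const_mul (N / 8)
        refine this.congr_deriv ?_
        simp only [id]; ring
    rw [intervalIntegral.integral_add (hmt.mul_const _) (hcexp.intervalIntegrable _ _), h3,
      intervalIntegral.integral_mul_const] at h1
    have h4 : ∫ s in (0 : ℝ)..t, m s ≤ R :=
      intervalIntegral.integral_mono_interval le_rfl ht.1 ht.2 (.of_forall hm) hmi
    have h5 : (∫ s in (0 : ℝ)..t, m s) * (√N * X) ≤ R * (√N * X) :=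
      mul_le_mul_of_nonneg_right h4 (by positivity)
    have h6 := h t ht
    -- Young's inequality in the form that fixes the constant `4 R²`, which doubles to `8 R²` at the
    -- end.
    have h7 : 2 * (R * √N) ≤ N / 4 + 4 * R ^ 2 := by
      nlinarith [sq_nonneg (√N / 2 - 2 * R), Real.sq_sqrt hN]
    have h8 : R * (√N * X) ≤ R * √N * X ^ 2 := by
      rw [← mul_assoc]
      exact mul_le_mul_of_nonneg_left hX2 (by positivity)
    have h9 : a ≤ a * X ^ 2 := le_mul_of_one_le_right ha (hX1.trans hX2)
    have h10 : 2 * (R * √N) * X ^ 2 ≤ (N / 4 + 4 * R ^ 2) * X ^ 2 :=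
      mul_le_mul_of_nonneg_right h7 (sq_nonneg _)
    rw [hexp]
    linarith
  -- The best constant in the exponential bound. Boundedness of `E` makes it finite; no continuity
  -- of `E` is needed.
  set N := sSup ((fun s => E s * Real.exp (-(8 * K * s))) '' Icc 0 τ) with hN
  have hbd : BddAbove ((fun s => E s * Real.exp (-(8 * K * s))) '' Icc 0 τ) := by
    refine ⟨B, ?_⟩
    rintro _ ⟨s, hs, rfl⟩
    have h1 : Real.exp (-(8 * K * s)) ≤ 1 :=
      Real.exp_le_one_iff.2 (neg_nonpos.2 (mul_nonneg (by positivity) hs.1))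
    exact (mul_le_of_le_one_right (hE s hs).1 h1).trans (hE s hs).2
  have hEN : ∀ s ∈ Icc 0 τ, E s ≤ N * Real.exp (8 * K * s) := fun s hs => by
    have := le_csSup hbd (mem_image_of_mem _ hs)
    rwa [Real.exp_neg, ← div_eq_mul_inv, div_le_iff₀ (Real.exp_pos _)] at this
  have hτm : τ ∈ Icc 0 τ := right_mem_Icc.2 hτ
  have hN0 : 0 ≤ N := by
    have := (hE τ hτm).1.trans (hEN τ hτm)
    exact nonneg_of_mul_nonneg_left this (Real.exp_pos _)
  have hst := step N hN0 hEN
  -- Inserting the best constant into the self-improvement gives `N ≤ 2 a + 8 R²`.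
  have hNle : N ≤ a + 4 * R ^ 2 + N / 2 := by
    refine csSup_le ⟨_, mem_image_of_mem _ hτm⟩ ?_
    rintro _ ⟨s, hs, rfl⟩
    simp only
    rw [Real.exp_neg, ← div_eq_mul_inv, div_le_iff₀ (Real.exp_pos _)]
    linarith [hst s hs, hG s hs]
  refine (hst τ hτm).trans (mul_le_mul_of_nonneg_right ?_ (Real.exp_nonneg _))
  linarith

/-! ### Absorption of the residuals and the estimate for the error of the reconstruction. -/

section Stability

variable {M q : ℕ} {X : Partition M 0 1} {T ε a b : ℝ} {f A : ℝ → ℝ}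
  {u ux : ℝ → ℝ → ℝ} {Ah : ℝ → Broken M (q + 1) → Broken M (q + 1)}
  {ut : ℝ → Broken M (q + 1)} {v : ℝ → Broken M (q + 2)} {bc : BoundaryCondition}

lemma stabilityConstant_nonneg (hε : 0 ≤ ε) : 0 ≤ stabilityConstant X T ε f A a b v := by
  have hL : 0 ≤ gradientBound X T v := ENNReal.toReal_nonneg
  have h1 : 0 ≤ sSup ((fun v => |deriv A v| ^ 2) '' Icc a b) := Real.sSup_nonneg (by
    rintro _ ⟨y, -, rfl⟩; positivity)
  have h2 : 0 ≤ sSup ((fun v => |deriv (deriv f) v|) '' Icc a b) := Real.sSup_nonneg (by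
    rintro _ ⟨y, -, rfl⟩; positivity)
  unfold stabilityConstant
  positivity

/-- A weight in time that controls the tested hyperbolic residual. -/
lemma exists_hyperbolic_weight {τ : ℝ} (hτ : τ ∈ Icc 0 T) {r e : ℝ → ℝ → ℝ}
    (hr : MemLp (fun p : ℝ × ℝ => r p.1 p.2) ⊤ (cylinderMeasure T))
    (he : MemLp (fun p : ℝ × ℝ => e p.1 p.2) 2 (cylinderMeasure T)) :
    ∃ m : ℝ → ℝ, (∀ s, 0 ≤ m s) ∧ IntervalIntegrable m volume 0 τ ∧
      (∀ᵐ s ∂volume.restrict (Ioo 0 T), |∫ x in Ioo (0 : ℝ) 1, r s x * e s x|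
        = m s * √(∫ x in Ioo (0 : ℝ) 1, e s x ^ 2)) ∧
      ENNReal.ofReal (∫ s in (0 : ℝ)..τ, m s) ≤ normL1L2 τ r := by
  have hr2 := hr.mono_exponent (p := 2) le_top
  have i1 := integrable_fun_mul hr2 he
  have i2 := he.integrable_sq
  obtain ⟨C, hC⟩ := exists_ae_bound hr
  rw [cylinderMeasure_eq_prod] at i1 i2 hC
  have hle : ∀ᵐ s ∂volume.restrict (Ioo 0 T), MemLp (r s) 2 spaceMeasure ∧
      |∫ x in Ioo (0 : ℝ) 1, r s x * e s x|
        ≤ √(∫ x in Ioo (0 : ℝ) 1, r s x ^ 2) * √(∫ x in Ioo (0 : ℝ) 1, e s x ^ 2) := by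
    filter_upwards [MemLp.ae_section hr2, MemLp.ae_section he] with s h1 h2
    exact ⟨h1, abs_integral_mul_le h1 h2⟩
  have hb : ∀ᵐ s ∂volume.restrict (Ioo 0 T), √(∫ x in Ioo (0 : ℝ) 1, r s x ^ 2) ≤ |C| := by
    filter_upwards [Measure.ae_ae_of_ae_prod hC, hle] with s h1 h2
    refine Real.sqrt_le_iff.2 ⟨abs_nonneg _, ?_⟩
    have h3 : ∫ x in Ioo (0 : ℝ) 1, r s x ^ 2 ≤ ∫ x in Ioo (0 : ℝ) 1, |C| ^ 2 := by
      refine integral_mono_ae h2.1.integrable_sq (integrable_const _) ?_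
      filter_upwards [h1] with x hx
      exact sq_le_sq.2 (by rw [abs_abs]; exact hx.trans (le_abs_self C))
    simpa using h3
  -- As a quotient, `m` times the square root reproduces the tested residual exactly, whose
  -- measurability is known, and Cauchy-Schwarz bounds `m` by the norm of `r s`. Where `e s`
  -- vanishes in `L²`, both sides of the product identity are zero.
  set m : ℝ → ℝ := fun s => |∫ x in Ioo (0 : ℝ) 1, r s x * e s x|
    / √(∫ x in Ioo (0 : ℝ) 1, e s x ^ 2) with hm
  have hm0 : ∀ s, 0 ≤ m s := fun s => by positivity
  have hmle : ∀ᵐ s ∂volume.restrict (Ioo 0 T), m s ≤ √(∫ x in Ioo (0 : ℝ) 1, r s x ^ 2) := by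
    filter_upwards [hle] with s h
    exact div_le_of_le_mul₀ (Real.sqrt_nonneg _) (Real.sqrt_nonneg _) h.2
  have hms : AEStronglyMeasurable m (volume.restrict (Ioo 0 T)) :=
    (i1.integral_prod_left.abs.1.aemeasurable.div
      i2.integral_prod_left.1.aemeasurable.sqrt).aestronglyMeasurable
  have hmi : IntegrableOn m (Ioo 0 T) := by
    refine Integrable.of_bound hms |C| ?_
    filter_upwards [hmle, hb] with s h1 h2
    rw [Real.norm_of_nonneg (hm0 s)]
    exact h1.trans h2
  have hmi' : IntegrableOn m (Ioo 0 τ) := hmi.mono_set (Ioo_subset_Ioo_right hτ.2)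
  refine ⟨m, hm0, (intervalIntegrable_iff_integrableOn_Ioo_of_le hτ.1).2 hmi', ?_, ?_⟩
  · filter_upwards [hle] with s h
    rcases eq_or_ne (√(∫ x in Ioo (0 : ℝ) 1, e s x ^ 2)) 0 with h0 | h0
    · rw [h0, mul_zero] at h ⊢
      exact le_antisymm h.2 (abs_nonneg _)
    · rw [hm, div_mul_cancel₀ _ h0]
  · rw [intervalIntegral.integral_of_le hτ.1, integral_Ioc_eq_integral_Ioo,
      ofReal_integral_eq_lintegral_ofReal hmi' (.of_forall hm0)]
    refine lintegral_mono_ae ?_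
    have hm := Measure.restrict_mono (μ := volume) (ν := volume)
      (Ioo_subset_Ioo_right hτ.2 : Ioo 0 τ ⊆ Ioo 0 T) le_rfl
    filter_upwards [ae_mono hm hle, ae_mono hm hmle] with s h1 h2
    rw [normL2_eq h1.1]
    exact ENNReal.ofReal_le_ofReal h2

/-- A weight in time that controls the tested parabolic residual. -/
lemma exists_parabolic_weight {τ : ℝ} (hτ : τ ∈ Icc 0 T) {ρ D : ℝ → ℝ} {N : ℝ → ℝ≥0∞}
    (hρ : IntegrableOn ρ (Ioo 0 T)) (hD : IntegrableOn D (Ioo 0 T)) (hD0 : ∀ s, 0 ≤ D s)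
    (hN : ∫⁻ s in Ioo 0 τ, N s ^ 2 ≠ ⊤)
    (h : ∀ᵐ s ∂volume.restrict (Ioo 0 T), ∀ n : ℝ, 0 ≤ n → N s ≤ ENNReal.ofReal n →
      |ρ s| ≤ n * √(D s)) :
    ∃ m : ℝ → ℝ, (∀ s, 0 ≤ m s) ∧ IntervalIntegrable m volume 0 τ ∧
      (∀ᵐ s ∂volume.restrict (Ioo 0 τ), |ρ s| ≤ m s + D s / 4) ∧
      ENNReal.ofReal (∫ s in (0 : ℝ)..τ, m s) ≤ ∫⁻ s in Ioo 0 τ, N s ^ 2 := by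
  have hsub : Ioo 0 τ ⊆ Ioo 0 T := Ioo_subset_Ioo_right hτ.2
  -- The dual norm `N` is a supremum over an uncountable family, and no measurability is assumed for
  -- it. The measurable quotient `ρ² / D` lies below `N²` and serves in its place.
  set k : ℝ → ℝ≥0∞ := fun s => ENNReal.ofReal (ρ s ^ 2) / ENNReal.ofReal (D s) with hk
  have hkm : AEMeasurable k (volume.restrict (Ioo 0 τ)) :=
    ((hρ.mono_set hsub).1.aemeasurable.pow_const 2).ennreal_ofReal.div
      (hD.mono_set hsub).1.aemeasurable.ennreal_ofReal
  have hkN : ∀ᵐ s ∂volume.restrict (Ioo 0 τ), k s ≤ N s ^ 2 := by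
    filter_upwards [ae_mono (Measure.restrict_mono hsub le_rfl) h] with s hs
    rcases eq_or_ne (N s) ⊤ with hNs | hNs
    · simp [hNs]
    · have h1 := hs _ ENNReal.toReal_nonneg (ENNReal.ofReal_toReal hNs).ge
      refine ENNReal.div_le_of_le_mul ?_
      have h2 := pow_le_pow_left₀ (abs_nonneg _) h1 2
      rw [sq_abs, mul_pow, Real.sq_sqrt (hD0 s)] at h2
      refine (ENNReal.ofReal_le_ofReal h2).trans_eq ?_
      rw [ENNReal.ofReal_mul (sq_nonneg _), ENNReal.ofReal_pow ENNReal.toReal_nonneg,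
        ENNReal.ofReal_toReal hNs]
  have hle := lintegral_mono_ae hkN
  have hfin : ∫⁻ s in Ioo 0 τ, k s ≠ ⊤ := (hle.trans_lt (lt_top_iff_ne_top.2 hN)).ne
  have hkfin := ae_lt_top' hkm hfin
  have hki : IntegrableOn (fun s => (k s).toReal) (Ioo 0 τ) :=
    integrable_toReal_of_lintegral_ne_top hkm hfin
  refine ⟨fun s => (k s).toReal, fun s => ENNReal.toReal_nonneg,
    (intervalIntegrable_iff_integrableOn_Ioo_of_le hτ.1).2 hki, ?_, ?_⟩
  · filter_upwards [hkfin] with s hs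
    have h1 : ENNReal.ofReal (ρ s ^ 2) = k s * ENNReal.ofReal (D s) := by
      -- If `D s = 0`, a nonzero `ρ s` would make the quotient infinite, which is excluded for
      -- almost every `s`.
      rcases (hD0 s).eq_or_lt with h0 | h0
      · by_contra hne
        have h2 : k s = ⊤ := by
          rw [hk]
          simp only [← h0, ENNReal.ofReal_zero, mul_zero] at hne ⊢
          exact ENNReal.div_zero hne
        exact hs.ne h2
      · exact (ENNReal.div_mul_cancel (by simpa using h0) ENNReal.ofReal_ne_top).symm
    have h2 : ρ s ^ 2 = (k s).toReal * D s := by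
      have := congrArg ENNReal.toReal h1
      rwa [ENNReal.toReal_mul, ENNReal.toReal_ofReal (sq_nonneg _),
        ENNReal.toReal_ofReal (hD0 s)] at this
    have h3 : 0 ≤ (k s).toReal := ENNReal.toReal_nonneg
    have h4 := hD0 s
    refine abs_le_of_sq_le_sq ?_ (by positivity)
    -- Young's inequality: `ρ² = k D ≤ (k + D / 4)²`.
    nlinarith [sq_nonneg ((k s).toReal - D s / 4)]
  · rw [intervalIntegral.integral_of_le hτ.1, integral_Ioc_eq_integral_Ioo,
      integral_toReal hkm hkfin]
    exact ENNReal.ofReal_toReal_le.trans hle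

/-- The parabolic weight uses up a quarter of the gradient term, so that `3 / 4` in the balance
becomes `1 / 2` and, after doubling, the full dissipation `G` in `gronwall_sqrt`. The integral of
`m₂` enters there as part of the constant, that of `m₁` through the square root term. -/
theorem error_estimate (hε : 0 ≤ ε) (hf : ContDiff ℝ 2 f) (hA : ContDiff ℝ 2 A)
    (hA1 : ∀ y, 1 ≤ A y) (hw : IsWeaklyContinuous T u)
    (hub : MemLp (fun p : ℝ × ℝ => u p.1 p.2) ⊤ (cylinderMeasure T))
    (hux : MemLp (fun p : ℝ × ℝ => ux p.1 p.2) 2 (cylinderMeasure T))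
    (hv : LipOn T v) (hα : BddMeas T fun s => Ah s (ut s))
    (huI : ∀ t ∈ Icc 0 T, ∀ᵐ x ∂spaceMeasure, u t x ∈ Icc a b)
    (hvI : ∀ t ∈ Icc 0 T, ∀ x ∈ Ioo (0 : ℝ) 1, X.eval (v t) x ∈ Icc a b)
    (hen : ∀ t ∈ Icc 0 T, (∫ x in Ioo (0 : ℝ) 1, (u t x - X.eval (v t) x) ^ 2)
      ≤ (∫ x in Ioo (0 : ℝ) 1, (u 0 x - X.eval (v 0) x) ^ 2)
        + 2 * ∫ s in (0 : ℝ)..t, ∫ x in Ioo (0 : ℝ) 1, errorRate X ε f A u ux v s x)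
    (hH1 : 0 < ε → ∀ᵐ s ∂volume.restrict (Ioo 0 T), ∃ e : ℝ → ℝ,
      HasL2Deriv e (fun x => ux s x - X.evalDeriv (v s) x) ∧ bc.Homogeneous e ∧
      ∀ x ∈ Ioo (0 : ℝ) 1, e x = u s x - X.eval (v s) x)
    {τ : ℝ} (hτ : τ ∈ Icc 0 T) :
    ENNReal.ofReal ((∫ x in Ioo (0 : ℝ) 1, (u τ x - X.eval (v τ) x) ^ 2)
        + ε * ∫ s in (0 : ℝ)..τ, ∫ x in Ioo (0 : ℝ) 1, (ux s x - X.evalDeriv (v s) x) ^ 2)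
      ≤ (2 * ENNReal.ofReal (∫ x in Ioo (0 : ℝ) 1, (u 0 x - X.eval (v 0) x) ^ 2)
        + 8 * normL1L2 τ (residual₁ X f ε Ah ut v) ^ 2
        + 4 * ENNReal.ofReal ε * residual₂NormSq bc X A Ah ut v τ)
        * ENNReal.ofReal (Real.exp (8 * stabilityConstant X T ε f A a b v * τ)) := by
  have hT : 0 ≤ T := hτ.1.trans hτ.2
  -- An infinite parabolic residual makes the right hand side infinite, for instance in the periodic
  -- case if the residual does not annihilate constants.
  by_cases hres : 0 < ε ∧ residual₂NormSq bc X A Ah ut v τ = ⊤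
  · have hε' : ENNReal.ofReal ε ≠ 0 := by simpa using hres.1
    have h4 : (4 : ℝ≥0∞) * ENNReal.ofReal ε * ⊤ = ⊤ :=
      ENNReal.mul_top (mul_ne_zero (by norm_num) hε')
    rw [hres.2, h4, add_top, ENNReal.top_mul (by simpa using Real.exp_pos _)]
    exact le_top
  obtain ⟨i1, i2, i3, i4, hbal⟩ :=
    error_balance hε hf hA hA1 hub hux hv hα huI hvI hen
  have he : MemLp (fun p : ℝ × ℝ => u p.1 p.2 - X.eval (v p.1) p.2) 2 (cylinderMeasure T) :=
    (hub.sub ((bddMeas_of_continuousOn hv.continuousOn).memLp_eval X)).mono_exponent le_top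
  obtain ⟨m₁, hm₁, hm₁i, hm₁e, hm₁n⟩ := exists_hyperbolic_weight hτ
    (memLp_residual₁ (ε := ε) (X := X) hf hv hα) (e := fun s x => u s x - X.eval (v s) x) he
  rw [cylinderMeasure_eq_prod] at i1 i2 i3 i4
  have I1 : IntegrableOn _ (Ioo 0 T) := i1.integral_prod_left
  have I2 : IntegrableOn _ (Ioo 0 T) := i2.integral_prod_left
  have I3 : IntegrableOn _ (Ioo 0 T) := i3.integral_prod_left
  have I4 : IntegrableOn _ (Ioo 0 T) := i4.integral_prod_left
  simp only at I1 I2 I3 I4 hm₁e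
  have hK : 0 ≤ stabilityConstant X T ε f A a b v := stabilityConstant_nonneg hε
  set K := stabilityConstant X T ε f A a b v
  set E : ℝ → ℝ := fun s => ∫ x in Ioo (0 : ℝ) 1, (u s x - X.eval (v s) x) ^ 2 with hE
  set D : ℝ → ℝ := fun s => ∫ x in Ioo (0 : ℝ) 1, (ux s x - X.evalDeriv (v s) x) ^ 2 with hD
  set ρ₁ : ℝ → ℝ := fun s =>
    ∫ x in Ioo (0 : ℝ) 1, residual₁ X f ε Ah ut v s x * (u s x - X.eval (v s) x) with hρ₁
  set ρ₂ : ℝ → ℝ := fun s => ∫ x in Ioo (0 : ℝ) 1, parabolicDefect X A u ux Ah ut v s x with hρ₂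
  have hE0 : ∀ s, 0 ≤ E s := fun s => integral_nonneg fun x => sq_nonneg _
  have hD0 : ∀ s, 0 ≤ D s := fun s => integral_nonneg fun x => sq_nonneg _
  -- Stated with the factor `ε`, so that the inviscid case is served by the zero weight.
  have hw₂ : ∃ m : ℝ → ℝ, (∀ s, 0 ≤ m s) ∧ IntervalIntegrable m volume 0 τ ∧
      (∀ᵐ s ∂volume.restrict (Ioo 0 τ), ε * |ρ₂ s| ≤ ε * (m s + D s / 4)) ∧
      ENNReal.ofReal ε * ENNReal.ofReal (∫ s in (0 : ℝ)..τ, m s)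
        ≤ ENNReal.ofReal ε * residual₂NormSq bc X A Ah ut v τ := by
    rcases hε.eq_or_lt with rfl | hε'
    · exact ⟨fun _ => 0, fun _ => le_rfl, by simp, by simp, by simp⟩
    obtain ⟨m, h1, h2, h3, h4⟩ := exists_parabolic_weight hτ (ρ := ρ₂) (D := D) I4 I2 hD0
      (N := fun s => normHm1 bc (fun x => X.eval (Ah s (ut s)) x)
        (fun x => A (X.eval (v s) x) * X.evalDeriv (v s) x))
      (fun h => hres ⟨hε', h⟩) (by
        filter_upwards [hH1 hε'] with s ⟨e, hs, hse, hsx⟩ n hn hNn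
        have := abs_integral_le_of_normHm1_le hn hNn hs hse
        refine le_of_eq_of_le (congrArg _ ?_) this
        refine setIntegral_congr_fun measurableSet_Ioo fun x hx => ?_
        simp only [parabolicDefect, hsx x hx])
    exact ⟨m, h1, h2, h3.mono fun s hs => mul_le_mul_of_nonneg_left hs hε,
      mul_le_mul_right h4 _⟩
  obtain ⟨m₂, hm₂, hm₂i, hm₂e, hm₂n⟩ := hw₂
  have hR₂ : 0 ≤ ∫ s in (0 : ℝ)..τ, m₂ s := intervalIntegral.integral_nonneg hτ.1 fun s _ => hm₂ s
  -- Both functions take values in `[a, b]`, which gives the a priori bound required by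
  -- `gronwall_sqrt`.
  have hEB : ∀ t ∈ Icc 0 τ, E t ∈ Icc 0 ((b - a) ^ 2) := fun t ht => by
    have htT : t ∈ Icc 0 T := ⟨ht.1, ht.2.trans hτ.2⟩
    refine ⟨hE0 t, ?_⟩
    have h1 : E t ≤ ∫ x in Ioo (0 : ℝ) 1, (b - a) ^ 2 := by
      refine integral_mono_ae ((hw.1 t htT).sub (X.memLp_eval (v t) 2)).integrable_sq
        (integrable_const _) ?_
      filter_upwards [huI t htT, ae_restrict_mem measurableSet_Ioo] with x hx hx'
      have h2 := hvI t htT x hx'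
      exact sq_le_sq' (by linarith [hx.1, h2.2]) (by linarith [hx.2, h2.1])
    simpa using h1
  have hI : ∀ t ∈ Icc 0 τ, ∀ g : ℝ → ℝ, IntegrableOn g (Ioo 0 T) →
      IntervalIntegrable g volume 0 t := fun t ht g hg =>
    (intervalIntegrable_iff_integrableOn_Ioo_of_le ht.1).2
      (hg.mono_set (Ioo_subset_Ioo_right (ht.2.trans hτ.2)))
  have hJ : ∀ t ∈ Icc 0 τ, ∀ g : ℝ → ℝ, IntervalIntegrable g volume 0 τ →
      IntervalIntegrable g volume 0 t := fun t ht g hg => hg.mono_set (by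
    rw [uIcc_of_le ht.1, uIcc_of_le hτ.1]; exact Icc_subset_Icc_right ht.2)
  have hτm : τ ∈ Icc 0 τ := right_mem_Icc.2 hτ.1
  have hmE : IntervalIntegrable (fun s => m₁ s * √(E s)) volume 0 τ := by
    refine (intervalIntegrable_iff_integrableOn_Ioo_of_le hτ.1).2 ?_
    exact Integrable.congr ((I3.mono_set (Ioo_subset_Ioo_right hτ.2)).abs)
      (ae_mono (Measure.restrict_mono (Ioo_subset_Ioo_right hτ.2) le_rfl) hm₁e)
  have hi := hmE.add ((hI τ hτm E I1).const_mul K)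
  have key := gronwall_sqrt (E := E) (G := fun t => ε * ∫ s in (0 : ℝ)..t, D s) (m := m₁)
    (a := E 0 + 2 * (ε * ∫ s in (0 : ℝ)..τ, m₂ s)) (K := K) hτ.1 hK
    (add_nonneg (hE0 0) (by positivity)) hEB
    (fun t ht => mul_nonneg hε (intervalIntegral.integral_nonneg ht.1 fun s _ => hD0 s)) hm₁ hm₁i
    hi fun t ht => by
      have h1 := hbal t ⟨ht.1, ht.2.trans hτ.2⟩
      have iA := hJ t ht _ hi
      have iB := (hJ t ht _ hm₂i).const_mul ε
      have iC := (hI t ht D I2).const_mul (ε / 2)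
      have h2 : ∫ s in (0 : ℝ)..t, (|ρ₁ s| + K * E s + ε * (|ρ₂ s| - 3 / 4 * D s))
          ≤ ∫ s in (0 : ℝ)..t, (m₁ s * √(E s) + K * E s + ε * m₂ s - ε / 2 * D s) := by
        rw [intervalIntegral.integral_of_le ht.1, intervalIntegral.integral_of_le ht.1]
        refine integral_mono_ae ?_ ((iA.add iB).sub iC).1 ?_
        · exact (((hI t ht _ I3).abs.add ((hI t ht _ I1).const_mul K)).add
            (((hI t ht _ I4).abs.sub ((hI t ht _ I2).const_mul (3 / 4))).const_mul ε)).1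
        · rw [EventuallyLE, ← restrict_Ioo_eq_restrict_Ioc]
          filter_upwards [ae_mono (Measure.restrict_mono
            (Ioo_subset_Ioo_right (ht.2.trans hτ.2)) le_rfl) hm₁e, ae_mono (Measure.restrict_mono
            (Ioo_subset_Ioo_right ht.2) le_rfl) hm₂e] with s h3 h4
          rw [h3]
          linarith
      rw [intervalIntegral.integral_sub (iA.add iB) iC, intervalIntegral.integral_add iA iB,
        intervalIntegral.integral_const_mul, intervalIntegral.integral_const_mul] at h2
      have h3 : ∫ s in (0 : ℝ)..t, m₂ s ≤ ∫ s in (0 : ℝ)..τ, m₂ s :=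
        intervalIntegral.integral_mono_interval le_rfl ht.1 ht.2 (.of_forall hm₂) hm₂i
      have h4 := mul_le_mul_of_nonneg_left h3 hε
      linarith
  refine (ENNReal.ofReal_le_ofReal key).trans ?_
  have hR₁ : 0 ≤ ∫ s in (0 : ℝ)..τ, m₁ s := intervalIntegral.integral_nonneg hτ.1 fun s _ => hm₁ s
  rw [ENNReal.ofReal_mul (add_nonneg (mul_nonneg zero_le_two (add_nonneg (hE0 0)
    (by positivity))) (by positivity))]
  refine mul_le_mul_left ?_ _
  rw [show 2 * (E 0 + 2 * (ε * ∫ s in (0 : ℝ)..τ, m₂ s)) + 8 * (∫ s in (0 : ℝ)..τ, m₁ s) ^ 2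
    = 2 * E 0 + 8 * (∫ s in (0 : ℝ)..τ, m₁ s) ^ 2 + 4 * (ε * ∫ s in (0 : ℝ)..τ, m₂ s) by ring]
  rw [ENNReal.ofReal_add (by have := hE0 0; positivity) (by positivity),
    ENNReal.ofReal_add (by have := hE0 0; positivity) (by positivity),
    ENNReal.ofReal_mul zero_le_two, ENNReal.ofReal_mul (by norm_num),
    ENNReal.ofReal_mul (by norm_num), ENNReal.ofReal_mul hε, ENNReal.ofReal_pow hR₁,
    mul_assoc 4 (ENNReal.ofReal ε)]
  simp only [ENNReal.ofReal_ofNat]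
  gcongr

end Stability

/-! ### Traces and jumps -/

namespace Partition

variable {M n : ℕ} (X : Partition M 0 1)

lemma tendsto_eval_left (v : Broken M n) (j : Fin M) :
    Tendsto (X.eval v) (𝓝[<] X.z j.succ) (𝓝 (X.rightVal v j)) := by
  have h : Tendsto (polyEval (v j)) (𝓝[<] X.z j.succ) (𝓝 (X.rightVal v j)) :=
    (continuous_polyEval (v j)).continuousAt.tendsto.mono_left nhdsWithin_le_nhds
  refine h.congr' ?_
  filter_upwards [Ico_mem_nhdsLT (X.z_lt j)] with x hx
  exact (X.eval_of_mem v hx).symm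

lemma tendsto_eval_right (v : Broken M n) (j : Fin M) :
    Tendsto (X.eval v) (𝓝[>] X.z j.castSucc) (𝓝 (X.leftVal v j)) := by
  have h : Tendsto (polyEval (v j)) (𝓝[>] X.z j.castSucc) (𝓝 (X.leftVal v j)) :=
    (continuous_polyEval (v j)).continuousAt.tendsto.mono_left nhdsWithin_le_nhds
  refine h.congr' ?_
  filter_upwards [Ioo_mem_nhdsGT (X.z_lt j)] with x hx
  exact (X.eval_of_mem v ⟨hx.1.le, hx.2⟩).symm

variable {g k c : ℝ → ℝ} {v : Broken M n} {m : ℕ} {v' : Broken M m}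

lemma leftLim_eq_add (hg : ∀ x ∈ Ioo (0 : ℝ) 1, g x = X.eval v x - X.eval v' x + c x)
    (hc : ContinuousOn c (Icc 0 1)) {i : Fin (M + 1)} (hi : i ≠ 0) :
    Function.leftLim g (X.z i)
      = Function.leftLim (fun x => X.eval v x - X.eval v' x) (X.z i) + c (X.z i) := by
  obtain ⟨j, rfl⟩ := Fin.exists_succ_eq.2 hi
  have h1 := (X.tendsto_eval_left v j).sub (X.tendsto_eval_left v' j)
  have hs : Ico (X.z j.castSucc) (X.z j.succ) ∈ 𝓝[<] X.z j.succ := Ico_mem_nhdsLT (X.z_lt j)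
  have h2 : Tendsto c (𝓝[<] X.z j.succ) (𝓝 (c (X.z j.succ))) := by
    refine (hc _ (X.mem_Icc _)).mono_left ?_
    rw [nhdsWithin_le_iff]
    filter_upwards [hs] with x hx
    exact ⟨(X.mem_Icc _).1.trans hx.1, hx.2.le.trans (X.mem_Icc _).2⟩
  rw [leftLim_eq_of_tendsto h1, leftLim_eq_of_tendsto ((h1.add h2).congr' ?_)]
  filter_upwards [Ioo_mem_nhdsLT (X.z_lt j)] with x hx
  exact (hg x ⟨(X.mem_Icc _).1.trans_lt hx.1, hx.2.trans_le (X.mem_Icc _).2⟩).symm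

lemma rightLim_eq_add (hg : ∀ x ∈ Ioo (0 : ℝ) 1, g x = X.eval v x - X.eval v' x + c x)
    (hc : ContinuousOn c (Icc 0 1)) {i : Fin (M + 1)} (hi : i ≠ Fin.last M) :
    Function.rightLim g (X.z i)
      = Function.rightLim (fun x => X.eval v x - X.eval v' x) (X.z i) + c (X.z i) := by
  obtain ⟨j, rfl⟩ := Fin.exists_castSucc_eq.2 hi
  have h1 := (X.tendsto_eval_right v j).sub (X.tendsto_eval_right v' j)
  have hs : Ioo (X.z j.castSucc) (X.z j.succ) ∈ 𝓝[>] X.z j.castSucc := Ioo_mem_nhdsGT (X.z_lt j)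
  have hsub : Ioo (X.z j.castSucc) (X.z j.succ) ⊆ Ioo 0 1 := fun x hx =>
    ⟨(X.mem_Icc _).1.trans_lt hx.1, hx.2.trans_le (X.mem_Icc _).2⟩
  have h2 : Tendsto c (𝓝[>] X.z j.castSucc) (𝓝 (c (X.z j.castSucc))) := by
    refine (hc _ (X.mem_Icc _)).mono_left ?_
    rw [nhdsWithin_le_iff]
    filter_upwards [hs] with x hx using Ioo_subset_Icc_self (hsub hx)
  rw [rightLim_eq_of_tendsto h1, rightLim_eq_of_tendsto ((h1.add h2).congr' ?_)]
  filter_upwards [hs] with x hx using (hg x (hsub hx)).symm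

/-- A continuous summand that satisfies the homogeneous boundary condition creates no jumps, either
across the identified end points or against the continuation by zero. It is applied with `c = u -
û`, so only the computable jumps of `û - û_h^t` remain. -/
lemma jump_eq [NeZero M] {bc : BoundaryCondition}
    (hg : ∀ x ∈ Ioo (0 : ℝ) 1, g x = X.eval v x - X.eval v' x + c x)
    (hc : ContinuousOn c (Icc 0 1)) (hbc : bc.Homogeneous c) {i : Fin (M + 1)}
    (hi : i ∈ jumpNodes bc M) :
    limMinus bc X g i - limPlus bc X g i
      = limMinus bc X (fun x => X.eval v x - X.eval v' x) i
        - limPlus bc X (fun x => X.eval v x - X.eval v' x) i := by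
  have hlast : Fin.last M ≠ 0 := by
    have := NeZero.ne M
    simpa [Fin.ext_iff] using this
  cases bc with
  | periodic =>
    have hi' : i ≠ Fin.last M := by simpa [jumpNodes] using hi
    simp only [limMinus, limPlus, if_neg hi', X.rightLim_eq_add hg hc hi']
    by_cases h0 : i = 0
    · have h1 := X.leftLim_eq_add hg hc hlast
      have h2 : c 0 = c 1 := hbc
      rw [X.final] at h1
      simp only [if_pos h0, h1]
      rw [h0, X.first, h2]; ring
    · simp only [if_neg h0, X.leftLim_eq_add hg hc h0]; ring
  | dirichlet gL gR =>
    have h2 : c 0 = 0 ∧ c 1 = 0 := hbc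
    by_cases h0 : i = 0
    · have hi' : i ≠ Fin.last M := h0 ▸ hlast.symm
      simp only [limMinus, limPlus, if_neg hi', if_pos h0, X.rightLim_eq_add hg hc hi']
      rw [h0, X.first, h2.1, add_zero]
    · by_cases h1 : i = Fin.last M
      · simp only [limMinus, limPlus, if_neg h0, if_pos h1, X.leftLim_eq_add hg hc h0]
        rw [h1, X.final, h2.2, add_zero]
      · simp only [limMinus, limPlus, if_neg h0, if_neg h1, X.leftLim_eq_add hg hc h0,
          X.rightLim_eq_add hg hc h1]
        ring

lemma sum_eLpNorm_sq_le {g : ℝ → ℝ} :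
    ∑ j : Fin M, eLpNorm g 2 (volume.restrict (Ioo (X.z j.castSucc) (X.z j.succ))) ^ 2
      ≤ normL2 g ^ 2 := by
  have h : ∀ μ : Measure ℝ, eLpNorm g 2 μ ^ 2 = ∫⁻ x, ‖g x‖ₑ ^ 2 ∂μ := fun μ => by
    have := eLpNorm_nnreal_pow_eq_lintegral (f := g) (μ := μ) (p := 2) (by norm_num)
    simpa only [NNReal.coe_ofNat, ENNReal.rpow_ofNat, ENNReal.coe_ofNat] using this
  rw [normL2, h, Finset.sum_congr rfl fun j _ => h _]
  rw [← tsum_fintype (L := .unconditional _), ← lintegral_iUnion (fun _ => measurableSet_Ioo)]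
  · refine lintegral_mono_set (iUnion_subset fun j x hx => ?_)
    exact ⟨(X.mem_Icc _).1.trans_lt hx.1, hx.2.trans_le (X.mem_Icc _).2⟩
  · intro i j hij
    refine Set.disjoint_left.2 fun x hx hx' => hij ?_
    exact X.index_unique ⟨hx.1.le, hx.2⟩ ⟨hx'.1.le, hx'.2⟩

end Partition

lemma ennreal_add_sq_le (x y : ℝ≥0∞) : (x + y) ^ 2 ≤ 2 * x ^ 2 + 2 * y ^ 2 := by
  rcases eq_or_ne x ⊤ with rfl | hx
  · simp
  rcases eq_or_ne y ⊤ with rfl | hy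
  · simp
  lift x to ℝ≥0 using hx
  lift y to ℝ≥0 using hy
  norm_cast
  rw [← mul_add]
  exact add_sq_le

lemma eLpNorm_sub_sq_le {μ : Measure ℝ} {g k l : ℝ → ℝ}
    (h1 : AEStronglyMeasurable (fun x => g x - k x) μ)
    (h2 : AEStronglyMeasurable (fun x => k x - l x) μ) :
    eLpNorm (fun x => g x - l x) 2 μ ^ 2
      ≤ 2 * eLpNorm (fun x => g x - k x) 2 μ ^ 2 + 2 * eLpNorm (fun x => k x - l x) 2 μ ^ 2 := by
  refine le_trans ?_ (ennreal_add_sq_le _ _)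
  gcongr
  refine le_trans (le_of_eq ?_) (eLpNorm_add_le h1 h2 (by norm_num))
  congr 1
  funext x
  simp

/-! ### The error of the discrete solution -/

section Final

variable {M q : ℕ} [NeZero M] {X : Partition M 0 1} {bc : BoundaryCondition} {T ε a b : ℝ}
  {f A : ℝ → ℝ} {w : ℝ → ℝ → ℝ} {u ux : ℝ → ℝ → ℝ} {ut : ℝ → Broken M (q + 1)}
  {uts : ℝ → Broken M (q + 2)}

lemma IsSpaceTimeReconstruction.isConforming (h : IsSpaceTimeReconstruction bc X T w ut uts) :
    IsConforming X bc T uts := fun t ht =>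
  have hn : X.HasNodeValues (uts t) (nodeValue bc X w t (ut t)) := (h t ht).2
  ⟨⟨_, hn⟩, holds_contRep hn⟩

/-- By continuity the bounds on the open interval extend to its closure. In particular Dirichlet
data lie in `[a, b]`, as the maximum principle requires. -/
lemma IsConforming.contRep_mem_Icc {n : ℕ} {v : ℝ → Broken M n} (h : IsConforming X bc T v)
    (hv : ∀ t ∈ Icc 0 T, ∀ x ∈ Ioo (0 : ℝ) 1, X.eval (v t) x ∈ Icc a b) {t : ℝ}
    (ht : t ∈ Icc 0 T) {x : ℝ} (hx : x ∈ Icc (0 : ℝ) 1) : X.contRep (v t) x ∈ Icc a b := by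
  obtain ⟨⟨g, hg⟩, -⟩ := h t ht
  have hm : MapsTo (X.contRep (v t)) (Ioo 0 1) (Icc a b) := fun y hy => by
    rw [X.contRep_eq_eval hg ⟨hy.1.le, hy.2⟩]; exact hv t ht y hy
  have hcl : closure (Ioo (0 : ℝ) 1) = Icc 0 1 := closure_Ioo zero_ne_one
  have := hm.closure_of_continuousOn (by
    rw [hcl]; exact (X.hasL2Deriv_contRep (v t)).continuousOn)
  rw [hcl, isClosed_Icc.closure_eq] at this
  exact this hx

/-- For `ε = 0` nothing is known about `ux`, not even measurability; it is replaced by zero, since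
it only enters multiplied by `ε`. -/
lemma IsEntropySolution.eq_zero_grad (hu : IsEntropySolution bc T 0 f A u ux) :
    IsEntropySolution bc T 0 f A u (fun _ _ => 0) where
  bounded := hu.bounded
  weaklyContinuous := hu.weaklyContinuous
  regular h := absurd h (lt_irrefl _)
  weak φ hφ := by simpa using hu.weak φ hφ
  entropy Φ hΦ h0 := by simpa using hu.entropy Φ hΦ h0

/-- The gradients are split elementwise by the squared triangle inequality, while the jumps of `u -
û_h^t` and `û - û_h^t` agree. -/
lemma dgEnergySq_le {τ : ℝ} (hτ : τ ∈ Icc 0 T)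
    (hux : MemLp (fun p : ℝ × ℝ => ux p.1 p.2) 2 (cylinderMeasure T))
    (huts : LipOn T uts) (hconf : IsConforming X bc T uts)
    (hreg : ∀ᵐ s ∂volume.restrict (Ioo 0 T), HasL2Deriv (u s) (ux s) ∧ bc.Holds s (u s)) :
    dgEnergySq bc X τ (fun t x => u t x - X.eval (ut t) x)
        (fun t x => ux t x - X.evalDeriv (ut t) x)
      ≤ 2 * ENNReal.ofReal (∫ s in (0 : ℝ)..τ, ∫ x in Ioo (0 : ℝ) 1,
          (ux s x - X.evalDeriv (uts s) x) ^ 2)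
        + 2 * dgEnergySq bc X τ (fun t x => X.eval (uts t) x - X.eval (ut t) x)
          (fun t x => X.evalDeriv (uts t) x - X.evalDeriv (ut t) x) := by
  have hex : MemLp (fun p : ℝ × ℝ => ux p.1 p.2 - X.evalDeriv (uts p.1) p.2) 2
      (cylinderMeasure T) := hux.sub
    (((bddMeas_of_continuousOn huts.continuousOn).memLp_evalDeriv X).mono_exponent le_top)
  have hi := hex.integrable_sq
  rw [cylinderMeasure_eq_prod] at hi
  have hD : IntegrableOn _ (Ioo 0 τ) :=
    hi.integral_prod_left.mono_measure (Measure.restrict_mono (Ioo_subset_Ioo_right hτ.2) le_rfl)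
  rw [intervalIntegral.integral_of_le hτ.1, integral_Ioc_eq_integral_Ioo,
    ofReal_integral_eq_lintegral_ofReal hD
      (.of_forall fun s => integral_nonneg fun x => sq_nonneg _)]
  unfold dgEnergySq
  rw [← lintegral_const_mul' _ _ (by simp), ← lintegral_const_mul' _ _ (by simp),
    ← lintegral_add_left' (hD.1.aemeasurable.ennreal_ofReal.const_mul _)]
  refine lintegral_mono_ae ?_
  have hm := Measure.restrict_mono (μ := volume) (ν := volume)
    (Ioo_subset_Ioo_right hτ.2 : Ioo 0 τ ⊆ Ioo 0 T) le_rfl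
  filter_upwards [ae_mono hm (MemLp.ae_section hux), ae_mono hm hreg,
    ae_restrict_mem measurableSet_Ioo] with s hs hr hsτ
  have hsT : s ∈ Icc 0 T := ⟨hsτ.1.le, hsτ.2.le.trans hτ.2⟩
  obtain ⟨⟨g, hg⟩, hbc⟩ := hconf s hsT
  have hd : MemLp (fun x => ux s x - X.evalDeriv (uts s) x) 2 spaceMeasure :=
    hs.sub (X.memLp_evalDeriv _ 2)
  have hjump : ∀ k ∈ jumpNodes bc M,
      ENNReal.ofReal ((nodeSize bc X k)⁻¹ * |limMinus bc X (fun x => u s x - X.eval (ut s) x) k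
        - limPlus bc X (fun x => u s x - X.eval (ut s) x) k| ^ 2)
      = ENNReal.ofReal ((nodeSize bc X k)⁻¹
        * |limMinus bc X (fun x => X.eval (uts s) x - X.eval (ut s) x) k
          - limPlus bc X (fun x => X.eval (uts s) x - X.eval (ut s) x) k| ^ 2) := fun k hk => by
    rw [X.jump_eq (c := fun x => u s x - X.contRep (uts s) x) (fun x hx => ?_)
      (hr.1.continuousOn.sub (X.hasL2Deriv_contRep _).continuousOn) (hr.2.sub hbc) hk]
    rw [X.contRep_eq_eval hg ⟨hx.1.le, hx.2⟩]
    ring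
  rw [Finset.sum_congr rfl hjump]
  set J := ∑ k ∈ jumpNodes bc M, ENNReal.ofReal ((nodeSize bc X k)⁻¹
        * |limMinus bc X (fun x => X.eval (uts s) x - X.eval (ut s) x) k
          - limPlus bc X (fun x => X.eval (uts s) x - X.eval (ut s) x) k| ^ 2)
  have hsub : ∀ j : Fin M, Ioo (X.z j.castSucc) (X.z j.succ) ⊆ Ioo 0 1 := fun j x hx =>
    ⟨(X.mem_Icc _).1.trans_lt hx.1, hx.2.trans_le (X.mem_Icc _).2⟩
  have hsum : ∑ j : Fin M, eLpNorm (fun x => ux s x - X.evalDeriv (ut s) x) 2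
        (volume.restrict (Ioo (X.z j.castSucc) (X.z j.succ))) ^ 2
      ≤ 2 * ENNReal.ofReal (∫ x in Ioo (0 : ℝ) 1, (ux s x - X.evalDeriv (uts s) x) ^ 2)
        + 2 * ∑ j : Fin M, eLpNorm (fun x => X.evalDeriv (uts s) x - X.evalDeriv (ut s) x) 2
        (volume.restrict (Ioo (X.z j.castSucc) (X.z j.succ))) ^ 2 := by
    rw [← normL2_sq hd]
    refine le_trans ?_ (add_le_add_left (mul_le_mul_right X.sum_eLpNorm_sq_le _) _)
    rw [Finset.mul_sum, Finset.mul_sum, ← Finset.sum_add_distrib]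
    exact Finset.sum_le_sum fun j _ => eLpNorm_sub_sq_le
      (hd.1.mono_measure (Measure.restrict_mono (hsub j) le_rfl))
      ((X.measurable_evalDeriv _).sub (X.measurable_evalDeriv _)).aestronglyMeasurable
  rw [mul_add, ← add_assoc]
  refine add_le_add hsum ?_
  -- The equal jump sums would not need the factor 2; one of the two copies is dropped.
  rw [two_mul]
  exact le_self_add

end Final

end RKdG
theorem mainTheorem10
    -- the equation
    (T ε : ℝ) (hT : 0 < T) (hε : 0 ≤ ε)
    (f A : ℝ → ℝ) (hf : ContDiff ℝ 2 f) (hA : ContDiff ℝ 2 A) (hAinf : IsGLB (Set.range A) 1)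
    -- Dirichlet or periodic boundary conditions; only the latter in the inviscid case
    (bc : BoundaryCondition) (hbc : ε = 0 → bc = BoundaryCondition.periodic)
    (hbcLip : bc.LipschitzData T)
    -- the exact solution
    (u ux : ℝ → ℝ → ℝ) (hu : IsEntropySolution bc T ε f A u ux)
    -- meshes in space and time, numerical flux, discrete diffusion operator
    {M N q : ℕ} [NeZero M] (X : Partition M 0 1) (τ : Partition N 0 T)
    (w : ℝ → ℝ → ℝ) (F : ℝ → ℝ → ℝ → ℝ) (hF : IsAdmissibleFlux f w F)
    (Ah : ℝ → Broken M (q + 1) → Broken M (q + 1))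
    (hAh : ContinuousOn (fun p : ℝ × Broken M (q + 1) => Ah p.1 p.2)
      (Set.Icc 0 T ×ˢ Set.univ))
    -- the discrete solutions and their reconstructions
    (uh : Fin (N + 1) → Broken M (q + 1))
    (ut : ℝ → Broken M (q + 1)) (hut : IsTemporalReconstruction bc X τ f F ε Ah uh ut)
    (uts : ℝ → Broken M (q + 2)) (huts : IsSpaceTimeReconstruction bc X T w ut uts)
    -- the interval of values that enters the constant `K`
    (a b : ℝ) (hab₀ : ∀ᵐ x ∂spaceMeasure, u 0 x ∈ Set.Icc a b)
    (habts : ∀ t ∈ Set.Icc 0 T, ∀ x ∈ Set.Ioo (0 : ℝ) 1, X.eval (uts t) x ∈ Set.Icc a b)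
    (habu : ε = 0 → ∀ᵐ p ∂(cylinderMeasure T), u p.1 p.2 ∈ Set.Icc a b)
    (i : Fin (N + 1)) :
    normL2 (fun x => u (τ.z i) x - X.eval (uh i) x) ^ 2
        + ENNReal.ofReal ε * dgEnergySq bc X (τ.z i)
            (fun t x => u t x - X.eval (ut t) x)
            (fun t x => ux t x - X.evalDeriv (ut t) x)
      ≤ 2 * (4 * normL2 (fun x => u 0 x - X.eval (uts 0) x) ^ 2
            + 16 * normL1L2 (τ.z i) (residual₁ X f ε Ah ut uts) ^ 2
            + 8 * ENNReal.ofReal ε * residual₂NormSq bc X A Ah ut uts (τ.z i))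
          * ENNReal.ofReal (Real.exp (8 * stabilityConstant X T ε f A a b uts * τ.z i))
        + 2 * (normL2 (fun x => X.eval (uts (τ.z i)) x - X.eval (uh i) x) ^ 2
            + ENNReal.ofReal ε * dgEnergySq bc X (τ.z i)
                (fun t x => X.eval (uts t) x - X.eval (ut t) x)
                (fun t x => X.evalDeriv (uts t) x - X.evalDeriv (ut t) x)) := by
  have hA1 : ∀ y, 1 ≤ A y := fun y => hAinf.1 (mem_range_self y)
  have hutL := hut.lipOn
  have hutsL : LipOn T uts := huts.lipOn hutL hF.1 hbcLip
  have hconf : IsConforming X bc T uts := huts.isConforming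
  have hα : BddMeas T fun s => Ah s (ut s) := bddMeas_of_continuousOn
    (hAh.comp (continuousOn_id.prodMk hutL.continuousOn) fun s hs => ⟨hs, mem_univ _⟩)
  have hτ : τ.z i ∈ Icc 0 T := τ.mem_Icc i
  have h0T : (0 : ℝ) ∈ Icc 0 T := left_mem_Icc.2 hT.le
  -- The interval is nonempty because it contains the value of the reconstruction at `t = 0`, `x = 1
  -- / 2`.
  have hab : a ≤ b := by
    have := habts 0 h0T (1 / 2) ⟨by norm_num, by norm_num⟩
    exact this.1.trans this.2
  have hmem : ∀ t ∈ Icc 0 T, MemLp (fun x => u t x - X.eval (uts t) x) 2 spaceMeasure :=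
    fun t ht => (hu.weaklyContinuous.1 t ht).sub (X.memLp_eval _ 2)
  rw [normL2_sq (hmem 0 h0T)]
  have htri : normL2 (fun x => u (τ.z i) x - X.eval (uh i) x) ^ 2
      ≤ 2 * ENNReal.ofReal (∫ x in Ioo (0 : ℝ) 1, (u (τ.z i) x - X.eval (uts (τ.z i)) x) ^ 2)
        + 2 * normL2 (fun x => X.eval (uts (τ.z i)) x - X.eval (uh i) x) ^ 2 := by
    rw [← normL2_sq (hmem _ hτ)]
    exact eLpNorm_sub_sq_le (hmem _ hτ).1
      ((X.measurable_eval _).sub (X.measurable_eval _)).aestronglyMeasurable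
  set E₀ := ENNReal.ofReal (∫ x in Ioo (0 : ℝ) 1, (u 0 x - X.eval (uts 0) x) ^ 2)
  set Eτ := ∫ x in Ioo (0 : ℝ) 1, (u (τ.z i) x - X.eval (uts (τ.z i)) x) ^ 2 with hEτ
  set K := stabilityConstant X T ε f A a b uts with hK
  have hEτ0 : 0 ≤ Eτ := integral_nonneg fun x => sq_nonneg _
  -- `error_estimate` yields half of the constants in the claim.
  have hmono : ∀ R₁ R₂ e : ℝ≥0∞, (2 * E₀ + 8 * R₁ + 4 * ENNReal.ofReal ε * R₂) * e
      ≤ (4 * E₀ + 16 * R₁ + 8 * ENNReal.ofReal ε * R₂) * e := fun R₁ R₂ e => by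
    gcongr <;> norm_num
  rcases hε.eq_or_lt with rfl | hε'
  · obtain rfl := hbc rfl
    have hen := fun t (ht : t ∈ Icc 0 T) =>
      energy_estimate_of_eq_zero hT hf.continuous hA.continuous hu.eq_zero_grad hutsL hconf ht
    have key := error_estimate (bc := .periodic) le_rfl hf hA hA1 hu.weaklyContinuous hu.bounded
      MemLp.zero hutsL hα (fun t ht => ae_mem_Icc_of_weaklyContinuous hT hu.weaklyContinuous
        (habu rfl) ht) habts hen (fun h => absurd h (lt_irrefl _)) hτ
    simp only [zero_mul, add_zero, ENNReal.ofReal_zero, mul_zero] at key ⊢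
    simp only [ENNReal.ofReal_zero, mul_zero, zero_mul, add_zero] at hmono
    refine htri.trans (add_le_add_left ?_ _)
    rw [mul_assoc]
    exact mul_le_mul_right (key.trans (hmono _ 0 _)) _
  · have hux := (hu.regular hε').2.1
    have hreg := (hu.regular hε').ae_hasL2Deriv
    have hen := fun t (ht : t ∈ Icc 0 T) =>
      energy_estimate_of_pos hT hε' hf.continuous hA.continuous hu hutsL hconf ht
    have huI := fun t (ht : t ∈ Icc 0 T) =>
      hu.mem_Icc hT hε' hf.continuous hA.continuous (fun y => zero_le_one.trans (hA1 y)) hab hab₀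
        -- Dirichlet data are the end values of the reconstruction, whose range lies in `[a, b]`.
        (fun gL gR hb t ht => by
          have h := (hconf t ht).2
          rw [hb] at h
          obtain ⟨h0, h1⟩ : X.contRep (uts t) 0 = gL t ∧ X.contRep (uts t) 1 = gR t := h
          rw [← h0, ← h1]
          exact ⟨hconf.contRep_mem_Icc habts ht (by simp),
            hconf.contRep_mem_Icc habts ht (by simp)⟩)
        ht
    have key := error_estimate (bc := bc) hε hf hA hA1 hu.weaklyContinuous hu.bounded hux hutsL hα
      huI habts hen (fun _ => by
        filter_upwards [hreg, ae_restrict_mem measurableSet_Ioo] with s hs hsT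
        obtain ⟨⟨g, hg⟩, hb⟩ := hconf s (Ioo_subset_Icc_self hsT)
        exact ⟨_, hs.1.sub (X.hasL2Deriv_contRep _), hs.2.sub hb, fun x hx => by
          rw [X.contRep_eq_eval hg ⟨hx.1.le, hx.2⟩]⟩) hτ
    have hdg := dgEnergySq_le (ut := ut) hτ hux hutsL hconf hreg
    rw [ENNReal.ofReal_add hEτ0 (mul_nonneg hε (intervalIntegral.integral_nonneg hτ.1
      fun s _ => integral_nonneg fun x => sq_nonneg _)), ENNReal.ofReal_mul hε] at key
    have hdg' := mul_le_mul_right hdg (ENNReal.ofReal ε)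
    have key' := mul_le_mul_right (key.trans (hmono _ _ _)) 2
    refine (add_le_add htri hdg').trans ?_
    rw [mul_assoc 2 (_ + _)]
    refine le_trans (le_of_eq ?_) (add_le_add_left key' _)
    ring
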